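/- All manifolds are smooth, Hausdorff, second countable and finite-dimensional, and $G$ is a Lie group with Lie algebra $\mathfrak g$ (neither $G$ nor $F$ below is assumed connected). **Definitions.** Let $p:M\to B$ be a smooth submersion with vertical bundle $\mathrm{Ver}=\ker dp$. An Ehresmann connection is a smooth splitting $TM=\mathrm{Ver}\oplus\mathrm{Hor}$, with horizontal lift $h:\mathfrak X(B)\to\Gamma(\mathrm{Hor})$ and curvature $C(u,v)=[h(u),h(v)]-h([u,v])$; it is complete if every smooth curve in $B$ has a horizontal lift, defined for all times, through each point over its origin. A *weakly hamiltonian fibration* structure on $p$ consists of a vertical $2$-form $\omega_V\in\Omega^2(\mathrm{Ver})$, non-degenerate and closed along the fibres, and a complete Ehresmann connection such that $L_{h(u)}\omega_V=0$ on $\mathrm{Ver}$ for all $u\in\mathfrak X(B)$, and whose curvature is hamiltonian: there is $\omega_H\in\Omega^2(B,C^\infty(M))$ with $$-\,i_{C(u,v)}\omega_V+d^V\big(\omega_H(u,v)\big)=0\qquad\text{for all }u,v\in\mathfrak X(B),\qquad(\ast)$$ where $d^V$ is the differential along the fibres. **Proposition.** Let $\pi:P\to B$ be a smooth principal $G$-bundle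 (right action) with a principal connection $\theta\in\Omega^1(P,\mathfrak g)$. Let $G$ act smoothly on the left on a symplectic manifold $(F,\omega_F)$, preserving $\omega_F$, and let $J:F\to\mathfrak g^*$ be a smooth, not necessarily equivariant, moment map: $d\langle J,\xi\rangle=-i_{\xi_F}\omega_F$ for all $\xi\in\mathfrak g$, where $\xi_F(f)=\frac{d}{dt}\big|_{t=0}\exp(t\xi)\cdot f$. Then the associated bundle $M=P\times_GF=(P\times F)/\big((x,f)\sim(xg,g^{-1}f)\big)$ is a (Hausdorff, second countable) manifold, with a smooth structure for which $P\times F\to M$ is a submersion, and $M\to B$, $[x,f]\mapsto\pi(x)$, carries a weakly hamiltonian fibration structure. More precisely, such a structure is given by the connection induced by $\theta$ (whose horizontal vectors are the images of $\theta$-horizontal vectors under the maps $x\mapsto[x,f]$) together with the vertical form $\omega_V$ which corresponds to $\omega_F$ under each map $f\mapsto[x,f]$ from $F$ onto a fibre. Moreover, let $(\rho_i)$ be any smooth partition of unity on $B$ subordinate to a family of open sets $(U_i)$ on which $P$ has smooth sections $s_i:U_i\to P$. Let $a_i=s_i^*\theta$, and let $\omega_\theta^i(u,v)=u\,a_i(v)-v\,a_i(u)-a_i([u,v])+[a_i(u),a_i(v)]$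 be the local curvature forms. Then $(\ast)$ is satisfied by $$\omega_H=\sum_i\rho_i\,\langle J,\omega_\theta^i\rangle,$$ where, over $U_i$, the term $\langle J,\omega_\theta^i\rangle$ is the form whose value at $[s_i(b),f]$ is $\langle J(f),\omega_\theta^i|_b\rangle$. -/

import Mathlib

open Bundle MulOpposite VectorField
open scoped Manifold ContDiff

noncomputable section

/-! Manifolds are modelled on finite-dimensional normed spaces `E`, with model `𝓘(ℝ, E)`. -/

/-! ### Vector fields and differential 2-forms -/

section Forms

variable {E : Type*} [NormedAddCommGroup E] [NormedSpace ℝ E]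
  {M : Type*} [TopologicalSpace M] [ChartedSpace E M] [IsManifold 𝓘(ℝ, E) ∞ M]

/-- Smoothness of a vector field on `M`. -/
def IsSmoothVectorField (X : ∀ x : M, TangentSpace 𝓘(ℝ, E) x) : Prop :=
  ContMDiff 𝓘(ℝ, E) 𝓘(ℝ, E).tangent ∞ (fun x ↦ (⟨x, X x⟩ : TangentBundle 𝓘(ℝ, E) M))

variable (E M) in
/-- Smooth differential 2-forms on `M`: smooth sections of the bundle of bilinear forms on the
tangent spaces, alternating at each point. -/
structure TwoForm where
  toFun : ∀ x : M, TangentSpace 𝓘(ℝ, E) x →L[ℝ] TangentSpace 𝓘(ℝ, E) x →L[ℝ] ℝ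
  alternating : ∀ (x : M) (v : TangentSpace 𝓘(ℝ, E) x), toFun x v v = 0
  smooth : ContMDiff 𝓘(ℝ, E) (𝓘(ℝ, E).prod 𝓘(ℝ, E →L[ℝ] E →L[ℝ] ℝ)) ∞
    (fun x ↦ TotalSpace.mk' (E →L[ℝ] E →L[ℝ] ℝ)
      (E := fun x : M ↦ TangentSpace 𝓘(ℝ, E) x →L[ℝ] TangentSpace 𝓘(ℝ, E) x →L[ℝ] ℝ) x (toFun x))

namespace TwoForm

/-- The function `α(Y, Z)`. -/
def eval (α : TwoForm E M) (Y Z : ∀ x : M, TangentSpace 𝓘(ℝ, E) x) : M → ℝ :=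
  fun x ↦ α.toFun x (Y x) (Z x)

/-- The value at `x` of `dα(X, Y, Z)`, by the invariant formula. -/
def extDeriv (α : TwoForm E M) (X Y Z : ∀ x : M, TangentSpace 𝓘(ℝ, E) x) (x : M) : ℝ :=
  mvfderiv 𝓘(ℝ, E) (α.eval Y Z) x (X x)
    - mvfderiv 𝓘(ℝ, E) (α.eval X Z) x (Y x)
    + mvfderiv 𝓘(ℝ, E) (α.eval X Y) x (Z x)
    - α.eval (mlieBracket 𝓘(ℝ, E) X Y) Z x
    + α.eval (mlieBracket 𝓘(ℝ, E) X Z) Y x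
    - α.eval (mlieBracket 𝓘(ℝ, E) Y Z) X x

/-- The value at `x` of `(L_X α)(Y, Z)`. -/
def lieDeriv (α : TwoForm E M) (X Y Z : ∀ x : M, TangentSpace 𝓘(ℝ, E) x) (x : M) : ℝ :=
  mvfderiv 𝓘(ℝ, E) (α.eval Y Z) x (X x)
    - α.eval (mlieBracket 𝓘(ℝ, E) X Y) Z x
    - α.eval Y (mlieBracket 𝓘(ℝ, E) X Z) x

/-- A symplectic form: a closed non-degenerate 2-form. -/
structure IsSymplectic (α : TwoForm E M) : Prop where
  closed : ∀ X Y Z : ∀ x : M, TangentSpace 𝓘(ℝ, E) x,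
    IsSmoothVectorField X → IsSmoothVectorField Y → IsSmoothVectorField Z →
      ∀ x, α.extDeriv X Y Z x = 0
  nondegenerate : ∀ (x : M) (v : TangentSpace 𝓘(ℝ, E) x), (∀ w, α.toFun x v w = 0) → v = 0

end TwoForm

end Forms

/-! ### Ehresmann connections and weakly hamiltonian fibrations -/

section Fibrations

variable {EM : Type*} [NormedAddCommGroup EM] [NormedSpace ℝ EM]
  {M : Type*} [TopologicalSpace M] [ChartedSpace EM M] [IsManifold 𝓘(ℝ, EM) ∞ M]
  {EB : Type*} [NormedAddCommGroup EB] [NormedSpace ℝ EB]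
  {B : Type*} [TopologicalSpace B] [ChartedSpace EB B] [IsManifold 𝓘(ℝ, EB) ∞ B]

variable (EB) in
/-- The vertical space `ker dp` at `x`. -/
def Vert (p : M → B) (x : M) : Submodule ℝ (TangentSpace 𝓘(ℝ, EM) x) :=
  LinearMap.ker (mfderiv 𝓘(ℝ, EM) 𝓘(ℝ, EB) p x).toLinearMap

variable (EM EB) in
/-- An Ehresmann connection on `p : M → B`: a smooth splitting of `TM → p^* TB`, that is, a smooth
choice of horizontal lifts. -/
structure EhresmannConnection (p : M → B) where
  lift : ∀ x : M, TangentSpace 𝓘(ℝ, EB) (p x) →L[ℝ] TangentSpace 𝓘(ℝ, EM) x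
  proj_lift : ∀ (x : M) (u : TangentSpace 𝓘(ℝ, EB) (p x)),
    mfderiv 𝓘(ℝ, EM) 𝓘(ℝ, EB) p x (lift x u) = u
  smooth_lift : ∀ u : ∀ b : B, TangentSpace 𝓘(ℝ, EB) b,
    IsSmoothVectorField u → IsSmoothVectorField (fun x : M ↦ lift x (u (p x)))

namespace EhresmannConnection

variable {p : M → B}

/-- The horizontal space at `x`. -/
def Hor (h : EhresmannConnection EM EB p) (x : M) : Submodule ℝ (TangentSpace 𝓘(ℝ, EM) x) :=
  LinearMap.range (h.lift x).toLinearMap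

/-- The horizontal lift `h(u)` of a vector field `u` on the base. -/
def liftField (h : EhresmannConnection EM EB p) (u : ∀ b : B, TangentSpace 𝓘(ℝ, EB) b) :
    ∀ x : M, TangentSpace 𝓘(ℝ, EM) x :=
  fun x ↦ h.lift x (u (p x))

/-- The curvature `C(u, v) = [h(u), h(v)] - h([u, v])`. -/
def curvature (h : EhresmannConnection EM EB p) (u v : ∀ b : B, TangentSpace 𝓘(ℝ, EB) b) :
    ∀ x : M, TangentSpace 𝓘(ℝ, EM) x :=
  fun x ↦ mlieBracket 𝓘(ℝ, EM) (h.liftField u) (h.liftField v) x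
    - h.liftField (mlieBracket 𝓘(ℝ, EB) u v) x

/-- Completeness: every smooth curve in the base has a horizontal lift, defined for all times,
through every point over its origin. -/
def IsComplete (h : EhresmannConnection EM EB p) : Prop :=
  ∀ γ : ℝ → B, ContMDiff 𝓘(ℝ, ℝ) 𝓘(ℝ, EB) ∞ γ → ∀ x : M, p x = γ 0 →
    ∃ c : ℝ → M, ContMDiff 𝓘(ℝ, ℝ) 𝓘(ℝ, EM) ∞ c ∧ c 0 = x ∧ (∀ t, p (c t) = γ t) ∧
      ∀ t : ℝ, mfderiv 𝓘(ℝ, ℝ) 𝓘(ℝ, EM) c t (1 : ℝ) ∈ h.Hor (c t)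

end EhresmannConnection

variable (EB) in
/-- Vertical vector fields (smooth sections of `ker dp`). -/
def IsVerticalField (p : M → B) (X : ∀ x : M, TangentSpace 𝓘(ℝ, EM) x) : Prop :=
  IsSmoothVectorField X ∧ ∀ x, X x ∈ Vert EB p x

variable (EM EB) in
/-- Smooth 2-forms on `B` with values in `C^∞(M)`. -/
structure BaseTwoForm (p : M → B) where
  toFun : ∀ x : M, TangentSpace 𝓘(ℝ, EB) (p x) →L[ℝ] TangentSpace 𝓘(ℝ, EB) (p x) →L[ℝ] ℝ
  alternating : ∀ (x : M) (u : TangentSpace 𝓘(ℝ, EB) (p x)), toFun x u u = 0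
  smooth : ∀ u v : ∀ b : B, TangentSpace 𝓘(ℝ, EB) b,
    IsSmoothVectorField u → IsSmoothVectorField v →
      ContMDiff 𝓘(ℝ, EM) 𝓘(ℝ, ℝ) ∞ (fun x ↦ toFun x (u (p x)) (v (p x)))

/-- The form `ωH` prescribes hamiltonian functions for the curvature of `h`: for all vector fields
`u`, `v` on the base and every vertical `w`, one has
`(d^C ωV)(u, v)(w) + (d^V ωH)(u, v)(w) = - ωV(C(u, v), w) + d(ωH(u, v))(w) = 0`. -/
def PrescribesCurvature {p : M → B} (h : EhresmannConnection EM EB p) (ωV : TwoForm EM M)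
    (ωH : BaseTwoForm EM EB p) : Prop :=
  ∀ u v : ∀ b : B, TangentSpace 𝓘(ℝ, EB) b, IsSmoothVectorField u → IsSmoothVectorField v →
    ∀ x : M, ∀ w ∈ Vert EB p x,
      - ωV.toFun x (h.curvature u v x) w
        + mvfderiv 𝓘(ℝ, EM) (fun y ↦ ωH.toFun y (u (p y)) (v (p y))) x w = 0

variable (EM EB) in
/-- A weakly hamiltonian fibration structure on `p : M → B`: a smooth submersion, with a complete
Ehresmann connection `conn` and a vertical symplectic form `ωV`, such that `conn` preserves `ωV`
and has hamiltonian curvature. A vertical 2-form is identified with the 2-form on `M` which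
restricts to it on the vertical spaces and which vanishes when an argument is horizontal. -/
structure WeaklyHamiltonianFibration (p : M → B) where
  smooth_proj : ContMDiff 𝓘(ℝ, EM) 𝓘(ℝ, EB) ∞ p
  submersion : ∀ x : M, Function.Surjective (mfderiv 𝓘(ℝ, EM) 𝓘(ℝ, EB) p x)
  conn : EhresmannConnection EM EB p
  complete : conn.IsComplete
  ωV : TwoForm EM M
  ωV_horizontal : ∀ x : M, ∀ v ∈ conn.Hor x, ∀ w, ωV.toFun x v w = 0
  /-- `ωV` is non-degenerate on the fibres -/
  nondegenerate : ∀ x : M, ∀ v ∈ Vert EB p x, (∀ w ∈ Vert EB p x, ωV.toFun x v w = 0) → v = 0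
  /-- `d^V ωV = 0` -/
  vertically_closed : ∀ X Y Z : ∀ x : M, TangentSpace 𝓘(ℝ, EM) x,
    IsVerticalField EB p X → IsVerticalField EB p Y → IsVerticalField EB p Z →
      ∀ x, ωV.extDeriv X Y Z x = 0
  /-- `d^H ωV = 0` -/
  symplectic_conn : ∀ u : ∀ b : B, TangentSpace 𝓘(ℝ, EB) b, IsSmoothVectorField u →
    ∀ X Y : ∀ x : M, TangentSpace 𝓘(ℝ, EM) x, IsVerticalField EB p X → IsVerticalField EB p Y →
      ∀ x, ωV.lieDeriv (conn.liftField u) X Y x = 0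
  /-- there is `ωH` with `d^C ωV + d^V ωH = 0` -/
  hamiltonian_curvature : ∃ ωH : BaseTwoForm EM EB p, PrescribesCurvature conn ωV ωH

end Fibrations

/-! ### Principal bundles and principal connections -/

section Principal

variable {EG : Type*} [NormedAddCommGroup EG] [NormedSpace ℝ EG]
  {G : Type*} [TopologicalSpace G] [ChartedSpace EG G] [Group G]
  {EP : Type*} [NormedAddCommGroup EP] [NormedSpace ℝ EP]
  {P : Type*} [TopologicalSpace P] [ChartedSpace EP P] [IsManifold 𝓘(ℝ, EP) ∞ P]
  [MulAction Gᵐᵒᵖ P]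
  {EB : Type*} [NormedAddCommGroup EB] [NormedSpace ℝ EB]
  {B : Type*} [TopologicalSpace B] [ChartedSpace EB B]

variable (EG G EP EB) in
/-- `pr : P → B` is a smooth principal `G`-bundle for the right action `op g • x` of `G` on `P`. -/
structure IsPrincipalBundle (pr : P → B) : Prop where
  smooth_action : ContMDiff (𝓘(ℝ, EP).prod 𝓘(ℝ, EG)) 𝓘(ℝ, EP) ∞ (fun y : P × G ↦ op y.2 • y.1)
  smooth_proj : ContMDiff 𝓘(ℝ, EP) 𝓘(ℝ, EB) ∞ pr
  proj_smul : ∀ (g : G) (x : P), pr (op g • x) = pr x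
  locally_trivial : ∀ b : B, ∃ e : Trivialization G pr, b ∈ e.baseSet ∧
    ContMDiffOn 𝓘(ℝ, EP) (𝓘(ℝ, EB).prod 𝓘(ℝ, EG)) ∞ e e.source ∧
    ContMDiffOn (𝓘(ℝ, EB).prod 𝓘(ℝ, EG)) 𝓘(ℝ, EP) ∞ e.toOpenPartialHomeomorph.symm e.target ∧
    ∀ x ∈ e.source, ∀ g : G, e (op g • x) = ((e x).1, (e x).2 * g)

/-- The adjoint action of `g` on the Lie algebra of `G`: the differential at `1` of conjugation. -/
def adjointAction (g : G) (ξ : GroupLieAlgebra 𝓘(ℝ, EG) G) : GroupLieAlgebra 𝓘(ℝ, EG) G :=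
  (mfderiv 𝓘(ℝ, EG) 𝓘(ℝ, EG) (fun k : G ↦ g * k * g⁻¹) (1 : G) ξ : EG)

/-- The infinitesimal right action: the value at `x` of the fundamental vector field of `ξ`, the
derivative at `t = 0` of `x · exp(tξ)`. -/
def infinitesimalRight (ξ : GroupLieAlgebra 𝓘(ℝ, EG) G) (x : P) : TangentSpace 𝓘(ℝ, EP) x :=
  (mfderiv 𝓘(ℝ, EG) 𝓘(ℝ, EP) (fun g : G ↦ op g • x) (1 : G) ξ : EP)

variable (EG G EP P) in
/-- A principal connection: a smooth Lie algebra valued 1-form on `P`, which reproduces the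
generators of the fundamental vector fields and is equivariant. Smoothness of the 1-form is
smoothness of the fibrewise linear map `TP → 𝔤`. -/
structure PrincipalConnection where
  toFun : ∀ x : P, TangentSpace 𝓘(ℝ, EP) x →L[ℝ] GroupLieAlgebra 𝓘(ℝ, EG) G
  smooth : ContMDiff (M' := EG) 𝓘(ℝ, EP).tangent 𝓘(ℝ, EG) ∞
    (fun v : TangentBundle 𝓘(ℝ, EP) P ↦ toFun v.proj v.2)
  fundamental : ∀ (x : P) (ξ : GroupLieAlgebra 𝓘(ℝ, EG) G), toFun x (infinitesimalRight ξ x) = ξ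
  equivariant : ∀ (x : P) (g : G) (v : TangentSpace 𝓘(ℝ, EP) x),
    toFun (op g • x) (mfderiv 𝓘(ℝ, EP) 𝓘(ℝ, EP) (fun y : P ↦ op g • y) x v)
      = adjointAction g⁻¹ (toFun x v)

namespace PrincipalConnection

/-- The local connection form `a = s^* θ` of a local section `s`, applied to a vector field. -/
def localForm (θ : PrincipalConnection EG G EP P) (s : B → P)
    (u : ∀ b : B, TangentSpace 𝓘(ℝ, EB) b) (b : B) : GroupLieAlgebra 𝓘(ℝ, EG) G :=
  θ.toFun (s b) (mfderiv 𝓘(ℝ, EB) 𝓘(ℝ, EP) s b (u b))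

/-- The derivative at `b`, along `u`, of the Lie algebra valued function `a(v)`. -/
def localFormDeriv (θ : PrincipalConnection EG G EP P) (s : B → P)
    (u v : ∀ b : B, TangentSpace 𝓘(ℝ, EB) b) (b : B) : GroupLieAlgebra 𝓘(ℝ, EG) G :=
  mvfderiv 𝓘(ℝ, EB) (F := EG) (θ.localForm s v) b (u b)

/-- The local curvature form `da + [a, a]`:
`u(a(v)) - v(a(u)) - a([u, v]) + [a(u), a(v)]`. -/
def localCurvature (θ : PrincipalConnection EG G EP P) (s : B → P)
    (u v : ∀ b : B, TangentSpace 𝓘(ℝ, EB) b) (b : B) : GroupLieAlgebra 𝓘(ℝ, EG) G :=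
  θ.localFormDeriv s u v b - θ.localFormDeriv s v u b
    - θ.localForm s (mlieBracket 𝓘(ℝ, EB) u v) b
    + ⁅θ.localForm s u b, θ.localForm s v b⁆

end PrincipalConnection

end Principal

/-! ### Symplectic actions and moment maps -/

section Moment

variable {EG : Type*} [NormedAddCommGroup EG] [NormedSpace ℝ EG]
  {G : Type*} [TopologicalSpace G] [ChartedSpace EG G] [Group G]
  {EF : Type*} [NormedAddCommGroup EF] [NormedSpace ℝ EF]
  {F : Type*} [TopologicalSpace F] [ChartedSpace EF F] [IsManifold 𝓘(ℝ, EF) ∞ F]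
  [MulAction G F]

/-- The infinitesimal left action: the value at `f` of the fundamental vector field of `ξ`, the
derivative at `t = 0` of `exp(tξ) · f`. -/
def infinitesimalLeft (ξ : GroupLieAlgebra 𝓘(ℝ, EG) G) (f : F) : TangentSpace 𝓘(ℝ, EF) f :=
  (mfderiv 𝓘(ℝ, EG) 𝓘(ℝ, EF) (fun g : G ↦ g • f) (1 : G) ξ : EF)

variable (EG G) in
/-- The action of `G` on `F` is smooth and preserves the symplectic form `ωF`. -/
structure IsSymplecticAction (ωF : TwoForm EF F) : Prop where
  smooth_action : ContMDiff (𝓘(ℝ, EG).prod 𝓘(ℝ, EF)) 𝓘(ℝ, EF) ∞ (fun y : G × F ↦ y.1 • y.2)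
  symplectic : ωF.IsSymplectic
  invariant : ∀ (g : G) (f : F) (v w : TangentSpace 𝓘(ℝ, EF) f),
    ωF.toFun (g • f) (mfderiv 𝓘(ℝ, EF) 𝓘(ℝ, EF) (fun y : F ↦ g • y) f v)
      (mfderiv 𝓘(ℝ, EF) 𝓘(ℝ, EF) (fun y : F ↦ g • y) f w) = ωF.toFun f v w

/-- `J : F → 𝔤^*` is a (not necessarily equivariant) moment map: it is smooth and
`d⟨J, ξ⟩ = - i_{ξ_F} ωF` for every `ξ` in the Lie algebra. -/
structure IsMomentMap (ωF : TwoForm EF F)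
    (J : F → (GroupLieAlgebra 𝓘(ℝ, EG) G →L[ℝ] ℝ)) : Prop where
  smooth : ∀ ξ, ContMDiff 𝓘(ℝ, EF) 𝓘(ℝ, ℝ) ∞ (fun f ↦ J f ξ)
  moment : ∀ (ξ : GroupLieAlgebra 𝓘(ℝ, EG) G) (f : F) (w : TangentSpace 𝓘(ℝ, EF) f),
    mvfderiv 𝓘(ℝ, EF) (fun f' ↦ J f' ξ) f w = - ωF.toFun f (infinitesimalLeft ξ f) w

end Moment

/-! ### The associated bundle -/

section Associated

/-- The equivalence relation `(x, f) ∼ (x · g, g⁻¹ · f)` on `P × F`. -/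
def associatedSetoid (G P F : Type*) [Group G] [MulAction Gᵐᵒᵖ P] [MulAction G F] :
    Setoid (P × F) where
  r y z := ∃ g : G, z = (op g • y.1, g⁻¹ • y.2)
  iseqv :=
    { refl := fun y ↦ ⟨1, by simp⟩
      symm := by
        rintro y z ⟨g, rfl⟩
        exact ⟨g⁻¹, by simp [smul_smul]⟩
      trans := by
        rintro y z w ⟨g, rfl⟩ ⟨k, rfl⟩
        exact ⟨g * k, by simp [smul_smul]⟩ }

/-- The associated bundle `P ×_G F`. -/
def AssociatedBundle (G P F : Type*) [Group G] [MulAction Gᵐᵒᵖ P] [MulAction G F] : Type _ :=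
  Quotient (associatedSetoid G P F)

namespace AssociatedBundle

variable (G : Type*) {P F : Type*} [Group G] [MulAction Gᵐᵒᵖ P] [MulAction G F]

/-- The quotient topology. -/
instance [TopologicalSpace P] [TopologicalSpace F] : TopologicalSpace (AssociatedBundle G P F) :=
  inferInstanceAs (TopologicalSpace (Quotient (associatedSetoid G P F)))

/-- The class `[x, f]`. -/
def mk (x : P) (f : F) : AssociatedBundle G P F := Quotient.mk (associatedSetoid G P F) (x, f)

variable {G} in
/-- The projection `[x, f] ↦ pr x`. -/
def proj {B : Type*} (pr : P → B) (hpr : ∀ (g : G) (x : P), pr (op g • x) = pr x) :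
    AssociatedBundle G P F → B :=
  Quotient.lift (fun y ↦ pr y.1) (by
    rintro y z ⟨g, rfl⟩
    exact (hpr g y.1).symm)

end AssociatedBundle

end Associated

/-! ### Structures induced on the associated bundle -/

section Induced

variable {EG : Type*} [NormedAddCommGroup EG] [NormedSpace ℝ EG]
  {G : Type*} [TopologicalSpace G] [ChartedSpace EG G] [Group G]
  {EP : Type*} [NormedAddCommGroup EP] [NormedSpace ℝ EP]
  {P : Type*} [TopologicalSpace P] [ChartedSpace EP P] [IsManifold 𝓘(ℝ, EP) ∞ P]
  [MulAction Gᵐᵒᵖ P]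
  {EB : Type*} [NormedAddCommGroup EB] [NormedSpace ℝ EB]
  {B : Type*} [TopologicalSpace B] [ChartedSpace EB B] [IsManifold 𝓘(ℝ, EB) ∞ B]
  {EF : Type*} [NormedAddCommGroup EF] [NormedSpace ℝ EF]
  {F : Type*} [TopologicalSpace F] [ChartedSpace EF F] [IsManifold 𝓘(ℝ, EF) ∞ F]
  [MulAction G F]
  {EM : Type*} [NormedAddCommGroup EM] [NormedSpace ℝ EM]
  [ChartedSpace EM (AssociatedBundle G P F)] [IsManifold 𝓘(ℝ, EM) ∞ (AssociatedBundle G P F)]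

variable (G EP P EF F EM) in
/-- The manifold structure of `P ×_G F` is that of the quotient manifold: the quotient map
`P × F → P ×_G F` is a smooth submersion. (At most one smooth structure has this property.) -/
structure IsQuotientManifold : Prop where
  smooth : ContMDiff (𝓘(ℝ, EP).prod 𝓘(ℝ, EF)) 𝓘(ℝ, EM) ∞
    (fun y : P × F ↦ AssociatedBundle.mk G y.1 y.2)
  submersion : ∀ y : P × F, Function.Surjective
    (mfderiv (𝓘(ℝ, EP).prod 𝓘(ℝ, EF)) 𝓘(ℝ, EM)
      (fun y : P × F ↦ AssociatedBundle.mk G y.1 y.2) y)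

/-- The connection `h` on `P ×_G F` is induced by `θ`: for each `f`, the map `x ↦ [x, f]` sends
horizontal vectors to horizontal vectors. -/
def IsInducedConnection {p : AssociatedBundle G P F → B} (h : EhresmannConnection EM EB p)
    (θ : PrincipalConnection EG G EP P) : Prop :=
  ∀ (x : P) (f : F) (v : TangentSpace 𝓘(ℝ, EP) x), θ.toFun x v = 0 →
    mfderiv 𝓘(ℝ, EP) 𝓘(ℝ, EM) (fun x' : P ↦ AssociatedBundle.mk G x' f) x v
      ∈ h.Hor (AssociatedBundle.mk G x f)

/-- The form `ωV` corresponds to `ωF` under each of the identifications `f ↦ [x, f]` of `F` with a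
fibre of `P ×_G F`. -/
def IsInducedForm (ωV : TwoForm EM (AssociatedBundle G P F)) (ωF : TwoForm EF F) : Prop :=
  ∀ (x : P) (f : F) (v w : TangentSpace 𝓘(ℝ, EF) f),
    ωV.toFun (AssociatedBundle.mk G x f)
      (mfderiv 𝓘(ℝ, EF) 𝓘(ℝ, EM) (fun f' : F ↦ AssociatedBundle.mk G x f') f v)
      (mfderiv 𝓘(ℝ, EF) 𝓘(ℝ, EM) (fun f' : F ↦ AssociatedBundle.mk G x f') f w)
      = ωF.toFun f v w

/-- The form `ωH` is `∑ i, ρ i ⟨J, ω_θ^i⟩`, where `ω_θ^i` is the local curvature form of `θ` for the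
local section `s i : U i → P`. At a point `y` over `b`, the function `J` is evaluated in the
trivialization given by `s i`, that is, at the point `f i` of `F` such that `y = [s i b, f i]`. -/
def IsGluedForm {p : AssociatedBundle G P F → B} (ωH : BaseTwoForm EM EB p)
    (θ : PrincipalConnection EG G EP P) (J : F → (GroupLieAlgebra 𝓘(ℝ, EG) G →L[ℝ] ℝ))
    {ι : Type*} (ρ : SmoothPartitionOfUnity ι 𝓘(ℝ, EB) B) (U : ι → Set B) (s : ι → B → P) :
    Prop :=
  ∀ u v : ∀ b : B, TangentSpace 𝓘(ℝ, EB) b, IsSmoothVectorField u → IsSmoothVectorField v →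
    ∀ (y : AssociatedBundle G P F) (f : ι → F),
      (∀ i, p y ∈ U i → AssociatedBundle.mk G (s i (p y)) (f i) = y) →
        ωH.toFun y (u (p y)) (v (p y))
          = ∑ᶠ i, ρ i (p y) * J (f i) (θ.localCurvature (s i) u v (p y))

end Induced

end

/-! A section `s` of `P` over `U` identifies the part of `P ×_G F` over `U` with `U × F`, by `(b, f)
↦ [s b, f]`. Two sections differ by a smooth map `g` into `G`, so that the transition maps are `(b,
f) ↦ (b, g(b) • f)`. This gives the manifold structure, and `IsBundleManifold` records all that is
used of its charts afterwards.

Write `a = s^*θ`, and `ξ_F` for the fundamental field of `ξ`. In the trivialization the horizontal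
lift of `u` is `(u, -a(u)_F)` (`horLift`) and the vertical projection of `(u, w)` is `w + a(u)_F`
(`vertProj`). The lift does not depend on `s`, because it is the image of a horizontal vector of `P`
(`horLift_eq`). The vertical form, which is `ωF` applied to vertical projections, does not depend on
`s` either, because `G` preserves `ωF` (`bundleForm_eq`).

Closedness along the fibres is pulled back to `F` by `f ↦ [s b, f]`. For the invariance of the form
under horizontal lifts, a section is chosen with `a = 0` at the given point: there the lift points
in the base direction, the point of `F` stays fixed, and only the product rule for a constant
bilinear form is left (`bundleTwoForm_lieDeriv`); no flow is needed. A computation in coordinates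
gives `C(u, v) = -(ω_θ(u, v))_F` (`curvature_mk`), where the term `[a, a]` has its sign because
fundamental fields of a left action form an anti-homomorphism. The moment map condition then reads
`d⟨J, ω_θ⟩ = -ωF((ω_θ)_F, ·) = ωV(C, ·)` on the fibres, which is the required equation
(`bundleTwoForm_curvature`).

As `J` need not be equivariant, different sections may give different functions `⟨J, ω_θ⟩`. Their
vertical derivatives agree nevertheless, and the weights of a partition of unity on `B` are constant
on the fibres, so the glued form works as well (`gluedForm_prescribesCurvature`). Completeness comes
from `P`: the curve `t ↦ [c t, f]` is horizontal when `c` is, and in `P` local solutions of an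
equation in `G` can be translated by the group and glued (`exists_isHorizontalLift_univ`).

Derivatives are handled as maps between the fixed model spaces (`tder`), so that tangent spaces at
points which are equal only by a proof need not be identified. -/

noncomputable section

set_option linter.unusedSectionVars false

/-! ### Derivatives between model spaces, and vector fields along maps -/

section TangentMaps

open Set Filter Topology

section General

variable {EA HA : Type*} [NormedAddCommGroup EA] [NormedSpace ℝ EA] [TopologicalSpace HA]
  {IA : ModelWithCorners ℝ EA HA} {A : Type*} [TopologicalSpace A] [ChartedSpace HA A]
  {EN HN : Type*} [NormedAddCommGroup EN] [NormedSpace ℝ EN] [TopologicalSpace HN]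
  {IN : ModelWithCorners ℝ EN HN} {N : Type*} [TopologicalSpace N] [ChartedSpace HN N]
  {EM HM : Type*} [NormedAddCommGroup EM] [NormedSpace ℝ EM] [TopologicalSpace HM]
  {IM : ModelWithCorners ℝ EM HM} {M : Type*} [TopologicalSpace M] [ChartedSpace HM M]

variable (IN IM) in
/-- The derivative of a map between manifolds, as a map between the model spaces. -/
def tder (f : N → M) (n : N) : EN →L[ℝ] EM := mfderiv IN IM f n

lemma tder_comp {g : N → M} {f : A → N} {a : A} (hg : MDifferentiableAt IN IM g (f a))
    (hf : MDifferentiableAt IA IN f a) (v : EA) :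
    tder IA IM (fun a ↦ g (f a)) a v = tder IN IM g (f a) (tder IA IN f a v) :=
  congrArg (fun L : EA →L[ℝ] EM ↦ L v) (mfderiv_comp a hg hf)

lemma Filter.EventuallyEq.tder_eq {f g : N → M} {n : N} (h : f =ᶠ[𝓝 n] g) :
    tder IN IM f n = tder IN IM g n :=
  h.mfderiv_eq

@[simp] lemma tder_id (n : N) (v : EN) : tder IN IN (fun n ↦ n) n v = v :=
  congrArg (fun L : EN →L[ℝ] EN ↦ L v) (mfderiv_id (I := IN) (x := n))

@[simp] lemma tder_const (m : M) (n : N) : tder IN IM (fun _ ↦ m) n = 0 :=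
  mfderiv_const

lemma tder_prodMk {f : A → N} {g : A → M} {a : A} (hf : MDifferentiableAt IA IN f a)
    (hg : MDifferentiableAt IA IM g a) (v : EA) :
    tder IA (IN.prod IM) (fun a ↦ (f a, g a)) a v = (tder IA IN f a v, tder IA IM g a v) :=
  congrArg (fun L : EA →L[ℝ] EN × EM ↦ L v) (mfderiv_prodMk hf hg)

lemma tder_prod_left {f : N × M → A} {p : N × M} (hf : MDifferentiableAt (IN.prod IM) IA f p)
    (v : EN) :
    tder (IN.prod IM) IA f p (v, 0) = tder IN IA (fun n ↦ f (n, p.2)) p.1 v := by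
  have h : MDifferentiableAt IN (IN.prod IM) (fun n : N ↦ (n, p.2)) p.1 :=
    mdifferentiableAt_id.prodMk mdifferentiableAt_const
  have h2 := tder_comp (g := f) hf h
  simp only [Prod.mk.eta] at h2
  rw [h2, tder_prodMk (f := fun n : N ↦ n) mdifferentiableAt_id mdifferentiableAt_const]
  simp

lemma tder_prod_right {f : N × M → A} {p : N × M} (hf : MDifferentiableAt (IN.prod IM) IA f p)
    (w : EM) :
    tder (IN.prod IM) IA f p (0, w) = tder IM IA (fun m ↦ f (p.1, m)) p.2 w := by
  have h : MDifferentiableAt IM (IN.prod IM) (fun m : M ↦ (p.1, m)) p.2 :=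
    mdifferentiableAt_const.prodMk mdifferentiableAt_id
  have h2 := tder_comp (g := f) hf h
  simp only [Prod.mk.eta] at h2
  rw [h2, tder_prodMk (g := fun m : M ↦ m) mdifferentiableAt_const mdifferentiableAt_id]
  simp

lemma tder_prod {f : N × M → A} {p : N × M} (hf : MDifferentiableAt (IN.prod IM) IA f p)
    (v : EN) (w : EM) :
    tder (IN.prod IM) IA f p (v, w) =
      tder IN IA (fun n ↦ f (n, p.2)) p.1 v + tder IM IA (fun m ↦ f (p.1, m)) p.2 w := by
  rw [← tder_prod_left hf, ← tder_prod_right hf, ← map_add]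
  simp

lemma tder_eq_fderiv {E E' : Type*} [NormedAddCommGroup E] [NormedSpace ℝ E]
    [NormedAddCommGroup E'] [NormedSpace ℝ E'] (f : E → E') (x : E) :
    tder 𝓘(ℝ, E) 𝓘(ℝ, E') f x = fderiv ℝ f x :=
  mfderiv_eq_fderiv

variable [IsManifold IN ∞ N] [IsManifold IM ∞ M]

variable (IA IN) in
/-- Smoothness at a point of a vector field `v` along a map `g`. -/
def SmoothAlongAt (g : A → N) (v : A → EN) (a₀ : A) : Prop :=
  ContMDiffAt IA IN.tangent ∞ (fun a ↦ (⟨g a, v a⟩ : TangentBundle IN N)) a₀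

/-- The derivative of a smooth map, applied to a smooth vector field along a map, is smooth. -/
lemma SmoothAlongAt.tder {Φ : N → M} {g : A → N} {V : A → EN} {a₀ : A}
    (hV : SmoothAlongAt IA IN g V a₀) (hΦ : ContMDiffAt IN IM ∞ Φ (g a₀)) :
    SmoothAlongAt IA IM (fun a ↦ Φ (g a)) (fun a ↦ _root_.tder IN IM Φ (g a) (V a)) a₀ := by
  have hg : ContMDiffAt IA IN ∞ g a₀ := (contMDiffAt_totalSpace.1 hV).1
  have hIN : IsManifold IN (∞ + 1) N := by simpa using ‹IsManifold IN ∞ N›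
  have h : ContMDiffAt IA 𝓘(ℝ, EN →L[ℝ] EM) ∞ (fun a ↦ ContinuousLinearMap.inCoordinates
      EN (TangentSpace IN) EM (TangentSpace IM) (g a₀) (g a) (Φ (g a₀)) (Φ (g a))
      (mfderiv IN IM Φ (g a))) a₀ :=
    (hΦ.mfderiv_const (m := ∞) (by simp)).comp a₀ hg
  have hc : ContMDiffAt IA IM ∞ (fun a ↦ Φ (g a)) a₀ := hΦ.comp a₀ hg
  exact ContMDiffAt.clm_apply_of_inCoordinates (b₁ := g) (b₂ := fun a ↦ Φ (g a)) (v := V)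
    (ϕ := fun a ↦ mfderiv IN IM Φ (g a)) h hV hc

lemma SmoothAlongAt.contMDiffAt {g : A → N} {V : A → EN} {a₀ : A}
    (hV : SmoothAlongAt IA IN g V a₀) : ContMDiffAt IA IN ∞ g a₀ :=
  (contMDiffAt_totalSpace.1 hV).1

lemma SmoothAlongAt.congr {g g' : A → N} {V V' : A → EN} {a₀ : A}
    (hV : SmoothAlongAt IA IN g V a₀) (hg : g' =ᶠ[𝓝 a₀] g) (h : V' =ᶠ[𝓝 a₀] V) :
    SmoothAlongAt IA IN g' V' a₀ := by
  refine ContMDiffAt.congr_of_eventuallyEq hV ?_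
  filter_upwards [hg, h] with a h1 h2
  rw [h1, h2]

lemma SmoothAlongAt.comp {EC HC : Type*} [NormedAddCommGroup EC] [NormedSpace ℝ EC]
    [TopologicalSpace HC] {IC : ModelWithCorners ℝ EC HC} {C : Type*} [TopologicalSpace C]
    [ChartedSpace HC C] {g : A → N} {V : A → EN} {k : C → A} {c₀ : C}
    (hV : SmoothAlongAt IA IN g V (k c₀)) (hk : ContMDiffAt IC IA ∞ k c₀) :
    SmoothAlongAt IC IN (fun c ↦ g (k c)) (fun c ↦ V (k c)) c₀ :=
  ContMDiffAt.comp c₀ hV hk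

lemma SmoothAlongAt.prod {g : A → N} {V : A → EN} {k : A → M} {W : A → EM} {a₀ : A}
    (hV : SmoothAlongAt IA IN g V a₀) (hW : SmoothAlongAt IA IM k W a₀) :
    SmoothAlongAt IA (IN.prod IM) (fun a ↦ (g a, k a)) (fun a ↦ (V a, W a)) a₀ :=
  ContMDiffAt.comp a₀ (I' := IN.tangent.prod IM.tangent)
    (contMDiff_equivTangentBundleProd_symm (I := IN) (I' := IM) (M := N) (M' := M)
      (n := ∞)).contMDiffAt (ContMDiffAt.prodMk hV hW)

lemma SmoothAlongAt.zero {g : A → N} {a₀ : A} (hg : ContMDiffAt IA IN ∞ g a₀) :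
    SmoothAlongAt IA IN g (fun _ ↦ 0) a₀ :=
  ContMDiffAt.comp a₀ (Bundle.contMDiff_zeroSection ℝ (TangentSpace IN : N → Type _)).contMDiffAt hg

end General

section Model

variable {EA HA : Type*} [NormedAddCommGroup EA] [NormedSpace ℝ EA] [TopologicalSpace HA]
  {IA : ModelWithCorners ℝ EA HA} {A : Type*} [TopologicalSpace A] [ChartedSpace HA A]
  {E : Type*} [NormedAddCommGroup E] [NormedSpace ℝ E]
  {N : Type*} [TopologicalSpace N] [ChartedSpace E N] [IsManifold 𝓘(ℝ, E) ∞ N]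

lemma smoothAlongAt_vectorSpace {g v : A → E} {a₀ : A} :
    SmoothAlongAt IA 𝓘(ℝ, E) g v a₀ ↔
      ContMDiffAt IA 𝓘(ℝ, E) ∞ g a₀ ∧ ContMDiffAt IA 𝓘(ℝ, E) ∞ v a₀ := by
  refine contMDiffAt_totalSpace.trans (and_congr_right fun _ ↦ ?_)
  refine Iff.of_eq (congrArg (fun f ↦ ContMDiffAt IA 𝓘(ℝ, E) ∞ f a₀) ?_)
  ext a
  rw [trivializationAt_model_space_apply]

/-- All vectors lie in one tangent space, and the trivialization of the tangent bundle at `n` is the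
identity over `n` itself. -/
lemma smoothAlongAt_const {n : N} {v : A → E} {a₀ : A} :
    SmoothAlongAt IA 𝓘(ℝ, E) (fun _ ↦ n) v a₀ ↔ ContMDiffAt IA 𝓘(ℝ, E) ∞ v a₀ := by
  refine contMDiffAt_totalSpace.trans ((and_iff_right contMDiffAt_const).trans ?_)
  refine Iff.of_eq (congrArg (fun f ↦ ContMDiffAt IA 𝓘(ℝ, E) ∞ f a₀) ?_)
  ext a
  rw [TangentBundle.trivializationAt_apply]
  exact (tangentBundleCore 𝓘(ℝ, E) N).coordChange_self (achart E n) n (mem_chart_source E n) (v a)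

end Model

/-- Relatedness is compatible with brackets, for vector fields on normed spaces. -/
lemma lieBracket_related {E E' : Type*} [NormedAddCommGroup E] [NormedSpace ℝ E]
    [NormedAddCommGroup E'] [NormedSpace ℝ E'] {ψ : E → E'} {V W : E → E} {V' W' : E' → E'} {z : E}
    (hψ : ContDiffAt ℝ 2 ψ z) (hV : DifferentiableAt ℝ V z) (hW : DifferentiableAt ℝ W z)
    (hV' : DifferentiableAt ℝ V' (ψ z)) (hW' : DifferentiableAt ℝ W' (ψ z))
    (hVV : ∀ᶠ y in 𝓝 z, fderiv ℝ ψ y (V y) = V' (ψ y))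
    (hWW : ∀ᶠ y in 𝓝 z, fderiv ℝ ψ y (W y) = W' (ψ y)) :
    fderiv ℝ ψ z (lieBracket ℝ V W z) = lieBracket ℝ V' W' (ψ z) := by
  have hd : DifferentiableAt ℝ (fderiv ℝ ψ) z :=
    (hψ.fderiv_right (m := 1) (by norm_num)).differentiableAt (by norm_num)
  have hψd : DifferentiableAt ℝ ψ z := hψ.differentiableAt (by norm_num)
  -- Differentiate the relation `Dψ(X) = X' ∘ ψ` in a direction `w`. In the difference that forms
  -- the bracket, the terms with the second derivative of `ψ` cancel by symmetry.
  have key : ∀ {X : E → E} {X' : E' → E'}, DifferentiableAt ℝ X z → DifferentiableAt ℝ X' (ψ z) →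
      (∀ᶠ y in 𝓝 z, fderiv ℝ ψ y (X y) = X' (ψ y)) → ∀ w,
      fderiv ℝ X' (ψ z) (fderiv ℝ ψ z w) =
        fderiv ℝ (fderiv ℝ ψ) z w (X z) + fderiv ℝ ψ z (fderiv ℝ X z w) := by
    intro X X' hX hX' h w
    have h1 : fderiv ℝ (fun y ↦ fderiv ℝ ψ y (X y)) z = fderiv ℝ (X' ∘ ψ) z :=
      Filter.EventuallyEq.fderiv_eq h
    rw [fderiv_comp z hX' hψd, fderiv_clm_apply hd hX] at h1
    have := congrArg (fun L ↦ L w) h1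
    simp at this
    rw [← this]; abel
  have hs := (hψ.isSymmSndFDerivAt (by simp [minSmoothness_of_isRCLikeNormedField]))
  simp only [lieBracket_eq, map_sub]
  rw [← hVV.self_of_nhds, ← hWW.self_of_nhds, key hV hV' hVV, key hW hW' hWW, hs.eq]
  abel

end TangentMaps

/-! ### Brackets of related vector fields on manifolds -/

section Related

open Set Filter Topology

variable {E : Type*} [NormedAddCommGroup E] [NormedSpace ℝ E]
  {N : Type*} [TopologicalSpace N] [ChartedSpace E N] [IsManifold 𝓘(ℝ, E) ∞ N]
  {E' : Type*} [NormedAddCommGroup E'] [NormedSpace ℝ E']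
  {M : Type*} [TopologicalSpace M] [ChartedSpace E' M] [IsManifold 𝓘(ℝ, E') ∞ M]

lemma tder_chart_symm_chart {n₀ n : N} (hn : n ∈ (chartAt E n₀).source) (v : E) :
    tder 𝓘(ℝ, E) 𝓘(ℝ, E) (chartAt E n₀).symm (chartAt E n₀ n)
      (tder 𝓘(ℝ, E) 𝓘(ℝ, E) (chartAt E n₀) n v) = v :=
  congrArg (fun L : E →L[ℝ] E ↦ L v)
    ((mdifferentiable_chart (I := 𝓘(ℝ, E)) n₀).symm_comp_deriv hn)

/-- The coordinate representation of a vector field in the chart at `n₀`. -/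
def chartField (n₀ : N) (V : N → E) (z : E) : E :=
  tder 𝓘(ℝ, E) 𝓘(ℝ, E) (chartAt E n₀) ((chartAt E n₀).symm z) (V ((chartAt E n₀).symm z))

lemma tder_symm_chartField {n₀ : N} (V : N → E) {z : E} (hz : z ∈ (chartAt E n₀).target) :
    tder 𝓘(ℝ, E) 𝓘(ℝ, E) (chartAt E n₀).symm z (chartField n₀ V z) =
      V ((chartAt E n₀).symm z) := by
  have h := tder_chart_symm_chart ((chartAt E n₀).map_target hz) (V ((chartAt E n₀).symm z))
  rwa [(chartAt E n₀).right_inv hz] at h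

/-- `mlieBracket` is defined by pulling back along the inverse chart, with the inverse of its
derivative; that inverse is the derivative of the chart. -/
lemma chartField_eq_mpullbackWithin {n₀ : N} (V : ∀ n : N, TangentSpace 𝓘(ℝ, E) n) {z : E}
    (hz : z ∈ (chartAt E n₀).target) :
    chartField n₀ V z = mpullbackWithin 𝓘(ℝ, E) 𝓘(ℝ, E) (extChartAt 𝓘(ℝ, E) n₀).symm V
      (range 𝓘(ℝ, E)) z := by
  have h : (mfderivWithin 𝓘(ℝ, E) 𝓘(ℝ, E) (extChartAt 𝓘(ℝ, E) n₀).symm (range 𝓘(ℝ, E)) z).inverse =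
      mfderiv 𝓘(ℝ, E) 𝓘(ℝ, E) (chartAt E n₀) ((chartAt E n₀).symm z) := by
    apply ContinuousLinearMap.inverse_eq
    · have := (mdifferentiable_chart (I := 𝓘(ℝ, E)) n₀).symm_comp_deriv
        ((chartAt E n₀).map_target hz)
      rw [(chartAt E n₀).right_inv hz] at this
      simpa [mfderivWithin_univ] using! this
    · have := (mdifferentiable_chart (I := 𝓘(ℝ, E)) n₀).comp_symm_deriv hz
      simpa [mfderivWithin_univ] using! this
  rw [mpullbackWithin_apply, h]
  rfl

lemma contDiffAt_chartField {n₀ n : N} {V : N → E} (hn : n ∈ (chartAt E n₀).source)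
    (hV : SmoothAlongAt 𝓘(ℝ, E) 𝓘(ℝ, E) (fun n ↦ n) V n) :
    ContDiffAt ℝ ∞ (chartField n₀ V) (chartAt E n₀ n) := by
  have hs : (chartAt E n₀).symm (chartAt E n₀ n) = n := (chartAt E n₀).left_inv hn
  have h1 : ContMDiffAt 𝓘(ℝ, E) 𝓘(ℝ, E) ∞ (chartAt E n₀).symm (chartAt E n₀ n) :=
    contMDiffOn_chart_symm.contMDiffAt
      ((chartAt E n₀).open_target.mem_nhds ((chartAt E n₀).map_source hn))
  have h2 : ContMDiffAt 𝓘(ℝ, E) 𝓘(ℝ, E) ∞ (chartAt E n₀) ((chartAt E n₀).symm (chartAt E n₀ n)) :=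
    contMDiffOn_chart.contMDiffAt ((chartAt E n₀).open_source.mem_nhds (by rwa [hs]))
  rw [← hs] at hV
  exact (smoothAlongAt_vectorSpace.1 ((hV.comp h1).tder h2)).2.contDiffAt

/-- The derivative at `n₀` of the chart at `n₀` is the identity of the model space, so the bracket
in that chart needs no push-forward. -/
lemma mlieBracket_eq_lieBracket_chartField (V W : ∀ n : N, TangentSpace 𝓘(ℝ, E) n) (n₀ : N) :
    mlieBracket 𝓘(ℝ, E) V W n₀ =
      lieBracket ℝ (chartField n₀ V) (chartField n₀ W) (chartAt E n₀ n₀) := by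
  rw [← mlieBracketWithin_univ, mlieBracketWithin_apply, mfderiv_extChartAt_self]
  refine (congrArg (fun L : E →L[ℝ] E ↦ L _) ContinuousLinearMap.inverse_id).trans ?_
  simp only [preimage_univ, modelWithCornersSelf_coe, range_id, univ_inter]
  have key : ∀ X : ∀ n : N, TangentSpace 𝓘(ℝ, E) n, mpullbackWithin 𝓘(ℝ, E) 𝓘(ℝ, E)
      (extChartAt 𝓘(ℝ, E) n₀).symm X univ =ᶠ[𝓝 (chartAt E n₀ n₀)] chartField n₀ X := fun X ↦ by
    filter_upwards [(chartAt E n₀).open_target.mem_nhds (mem_chart_target E n₀)] with z hz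
    rw [chartField_eq_mpullbackWithin X hz, modelWithCornersSelf_coe, range_id]
  refine (congrFun (lieBracketWithin_univ (𝕜 := ℝ) (V := fun z : E ↦ (mpullbackWithin 𝓘(ℝ, E)
    𝓘(ℝ, E) (extChartAt 𝓘(ℝ, E) n₀).symm V univ z : E)) (W := fun z : E ↦ (mpullbackWithin 𝓘(ℝ, E)
    𝓘(ℝ, E) (extChartAt 𝓘(ℝ, E) n₀).symm W univ z : E))) _).trans ?_
  exact (key V).lieBracket_vectorField_eq (key W)

/-- The bracket of vector fields, which are viewed as maps to the model space. -/
def mBracket (V W : N → E) (n : N) : E :=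
  mlieBracket 𝓘(ℝ, E) (fun n ↦ (V n : TangentSpace 𝓘(ℝ, E) n)) (fun n ↦ W n) n

lemma mBracket_eq_lieBracket (V W : N → E) (n : N) :
    mBracket V W n = lieBracket ℝ (chartField n V) (chartField n W) (chartAt E n n) :=
  mlieBracket_eq_lieBracket_chartField _ _ _

/-- Brackets of `ψ`-related vector fields are `ψ`-related. -/
theorem tder_mBracket_of_related {ψ : N → M}
    {V W : N → E} {V' W' : M → E'} {n₀ : N}
    (hψ : ContMDiffAt 𝓘(ℝ, E) 𝓘(ℝ, E') ∞ ψ n₀)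
    (hV : SmoothAlongAt 𝓘(ℝ, E) 𝓘(ℝ, E) (fun n ↦ n) V n₀)
    (hW : SmoothAlongAt 𝓘(ℝ, E) 𝓘(ℝ, E) (fun n ↦ n) W n₀)
    (hV' : SmoothAlongAt 𝓘(ℝ, E') 𝓘(ℝ, E') (fun m ↦ m) V' (ψ n₀))
    (hW' : SmoothAlongAt 𝓘(ℝ, E') 𝓘(ℝ, E') (fun m ↦ m) W' (ψ n₀))
    (hVV : ∀ᶠ n in 𝓝 n₀, tder 𝓘(ℝ, E) 𝓘(ℝ, E') ψ n (V n) = V' (ψ n))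
    (hWW : ∀ᶠ n in 𝓝 n₀, tder 𝓘(ℝ, E) 𝓘(ℝ, E') ψ n (W n) = W' (ψ n)) :
    tder 𝓘(ℝ, E) 𝓘(ℝ, E') ψ n₀ (mBracket V W n₀) = mBracket V' W' (ψ n₀) := by
  set φ := chartAt E n₀
  set φ' := chartAt E' (ψ n₀)
  set ψ' : E → E' := φ' ∘ ψ ∘ φ.symm
  have hn : φ.symm (φ n₀) = n₀ := φ.left_inv (mem_chart_source E n₀)
  have hψ'n : ψ' (φ n₀) = φ' (ψ n₀) := by simp [ψ', hn]
  have hψ' : ContDiffAt ℝ ∞ ψ' (φ n₀) := by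
    have := (contMDiffAt_iff.1 hψ).2
    simpa [contDiffWithinAt_univ] using this
  -- By definition `mfderiv` at `n₀` is the derivative of the expression of `ψ` in the charts at
  -- `n₀` and `ψ n₀`. Hence the claim reduces to `lieBracket_related` for `ψ'` and the coordinate
  -- fields.
  have hmf : tder 𝓘(ℝ, E) 𝓘(ℝ, E') ψ n₀ = fderiv ℝ ψ' (φ n₀) := by
    have := hψ.mdifferentiableAt (by simp)
    simp only [tder, mfderiv, this, writtenInExtChartAt, modelWithCornersSelf_coe, range_id,
      fderivWithin_univ]
    rfl
  have hcs : ContinuousAt φ.symm (φ n₀) := φ.continuousAt_symm (mem_chart_target E n₀)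
  have hev : ∀ᶠ z in 𝓝 (φ n₀), z ∈ φ.target ∧ ψ (φ.symm z) ∈ φ'.source ∧
      MDifferentiableAt 𝓘(ℝ, E) 𝓘(ℝ, E') ψ (φ.symm z) := by
    refine Filter.Eventually.and (φ.open_target.mem_nhds (mem_chart_target E n₀))
      (Filter.Eventually.and ?_ ?_)
    · have : ContinuousAt (fun z ↦ ψ (φ.symm z)) (φ n₀) :=
        ContinuousAt.comp (by rw [hn]; exact hψ.continuousAt) hcs
      refine this (φ'.open_source.mem_nhds ?_)
      simp only [hn]; exact mem_chart_source E' _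
    · have h1 : ∀ᶠ n in 𝓝 n₀, MDifferentiableAt 𝓘(ℝ, E) 𝓘(ℝ, E') ψ n := by
        have : ContMDiffAt 𝓘(ℝ, E) 𝓘(ℝ, E') 1 ψ n₀ := hψ.of_le (by simp)
        filter_upwards [(contMDiffAt_iff_contMDiffAt_nhds (by simp)).1 this] with n hn
        exact ContMDiffAt.mdifferentiableAt hn one_ne_zero
      rw [← hn] at h1
      exact hcs h1
  have key : ∀ {X : N → E} {X' : M → E'},
      (∀ᶠ n in 𝓝 n₀, tder 𝓘(ℝ, E) 𝓘(ℝ, E') ψ n (X n) = X' (ψ n)) →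
      ∀ᶠ z in 𝓝 (φ n₀), fderiv ℝ ψ' z (chartField n₀ X z) = chartField (ψ n₀) X' (ψ' z) := by
    intro X X' h
    rw [← hn] at h
    filter_upwards [hev, hcs h] with z ⟨hz, hz', hd⟩ hX
    have hsymm : MDifferentiableAt 𝓘(ℝ, E) 𝓘(ℝ, E) φ.symm z :=
      (mdifferentiable_chart (I := 𝓘(ℝ, E)) n₀).mdifferentiableAt_symm hz
    have hch : MDifferentiableAt 𝓘(ℝ, E') 𝓘(ℝ, E') φ' (ψ (φ.symm z)) :=
      (mdifferentiable_chart (I := 𝓘(ℝ, E')) (ψ n₀)).mdifferentiableAt hz'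
    rw [← tder_eq_fderiv]
    have h1 := tder_comp (f := fun z ↦ ψ (φ.symm z)) (g := φ') hch (hd.comp z hsymm)
      (chartField n₀ X z)
    rw [tder_comp hd hsymm, tder_symm_chartField X hz] at h1
    refine h1.trans ?_
    rw [mem_preimage, mem_ofPred] at hX
    rw [hX, chartField]
    simp only [ψ', Function.comp_apply]
    rw [φ'.left_inv hz']
  rw [mBracket_eq_lieBracket, mBracket_eq_lieBracket]
  have := lieBracket_related (contDiffAt_infty.1 hψ' 2)
    ((contDiffAt_chartField (mem_chart_source E n₀) hV).differentiableAt (by simp))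
    ((contDiffAt_chartField (mem_chart_source E n₀) hW).differentiableAt (by simp))
    (V' := chartField (ψ n₀) V') (W' := chartField (ψ n₀) W')
    (by rw [hψ'n]
        exact (contDiffAt_chartField (mem_chart_source E' _) hV').differentiableAt (by simp))
    (by rw [hψ'n]
        exact (contDiffAt_chartField (mem_chart_source E' _) hW').differentiableAt (by simp))
    (key hVV) (key hWW)
  rw [hψ'n, ← hmf] at this
  exact this

end Related

/-! ### Local sections of a principal bundle and the group coordinate -/

section Sections

open Set Filter Topology

variable {EG : Type*} [NormedAddCommGroup EG] [NormedSpace ℝ EG]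
  {G : Type*} [TopologicalSpace G] [ChartedSpace EG G] [Group G] [LieGroup 𝓘(ℝ, EG) ∞ G]
  {EB : Type*} [NormedAddCommGroup EB] [NormedSpace ℝ EB]
  {B : Type*} [TopologicalSpace B] [ChartedSpace EB B] [IsManifold 𝓘(ℝ, EB) ∞ B]
  {EP : Type*} [NormedAddCommGroup EP] [NormedSpace ℝ EP]
  {P : Type*} [TopologicalSpace P] [ChartedSpace EP P] [IsManifold 𝓘(ℝ, EP) ∞ P]
  [MulAction Gᵐᵒᵖ P]
  {EF : Type*} [NormedAddCommGroup EF] [NormedSpace ℝ EF]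
  {F : Type*} [TopologicalSpace F] [ChartedSpace EF F] [IsManifold 𝓘(ℝ, EF) ∞ F] [MulAction G F]
  {pr : P → B}

variable (EB EP) in
/-- `s` is a smooth section of `pr` over the open set `U`. -/
structure IsLocalSection (pr : P → B) (U : Set B) (s : B → P) : Prop where
  isOpen : IsOpen U
  smooth : ContMDiffOn 𝓘(ℝ, EB) 𝓘(ℝ, EP) ∞ s U
  proj : ∀ b ∈ U, pr (s b) = b

lemma IsLocalSection.contMDiffAt {U : Set B} {s : B → P} (hs : IsLocalSection EB EP pr U s) {b : B}
    (hb : b ∈ U) : ContMDiffAt 𝓘(ℝ, EB) 𝓘(ℝ, EP) ∞ s b :=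
  hs.smooth.contMDiffAt (hs.isOpen.mem_nhds hb)

namespace IsPrincipalBundle

variable (hpr : IsPrincipalBundle EG G EP EB pr)
include hpr

/-- The group component of `x` in a trivialization is kept constant, which makes the section pass
through `x`. -/
lemma exists_localSection (x : P) :
    ∃ (U : Set B) (s : B → P), IsLocalSection EB EP pr U s ∧ pr x ∈ U ∧ s (pr x) = x := by
  obtain ⟨e, hb, -, he, -⟩ := hpr.locally_trivial (pr x)
  refine ⟨e.baseSet, fun b ↦ e.toOpenPartialHomeomorph.symm (b, (e x).2), ⟨e.open_baseSet, ?_, ?_⟩,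
    hb, ?_⟩
  · refine he.comp (contMDiffOn_id.prodMk contMDiffOn_const) fun b hb ↦ ?_
    rw [mem_preimage, e.mem_target]
    exact hb
  · exact fun b hb ↦ e.proj_symm_apply (e.mem_target.2 hb)
  · exact e.symm_apply_mk_proj (e.mem_source.2 hb)

/-- In a trivialization `G` acts by right multiplication on the group factor; so it is transitive on
the fibres and, in the next lemma, free. -/
lemma exists_smul_eq {x x' : P} (h : pr x = pr x') : ∃ g : G, op g • x = x' := by
  obtain ⟨e, hb, -, -, he⟩ := hpr.locally_trivial (pr x)
  have hx : x ∈ e.source := e.mem_source.2 hb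
  have hx' : x' ∈ e.source := e.mem_source.2 (h ▸ hb)
  refine ⟨(e x).2⁻¹ * (e x').2, e.injOn (e.mem_source.2 ?_) hx' ?_⟩
  · rwa [hpr.proj_smul]
  · refine (he x hx _).trans (Prod.ext ?_ (by simp))
    exact (e.coe_fst hx).trans (h.trans (e.coe_fst hx').symm)

lemma smul_injective {x : P} {g g' : G} (h : op g • x = op g' • x) : g = g' := by
  obtain ⟨e, hb, -, -, he⟩ := hpr.locally_trivial (pr x)
  have hx : x ∈ e.source := e.mem_source.2 hb
  have := congrArg (fun y ↦ (e y).2) h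
  simpa [he x hx] using this

end IsPrincipalBundle

variable (G) in
/-- The element `g` of the group such that `x = s (pr x) · g`. -/
def groupCoord (pr : P → B) (s : B → P) (x : P) : G :=
  Classical.epsilon fun g : G ↦ op g • s (pr x) = x

section

variable (hpr : IsPrincipalBundle EG G EP EB pr) {U : Set B} {s : B → P}
  (hs : IsLocalSection EB EP pr U s)
include hpr

lemma groupCoord_eq_of_smul {x : P} {g : G} (h : op g • s (pr x) = x) : groupCoord G pr s x = g :=
  hpr.smul_injective ((Classical.epsilon_spec (p := fun g : G ↦ op g • s (pr x) = x) ⟨g, h⟩).trans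
    h.symm)

include hs

lemma groupCoord_smul {x : P} (hx : pr x ∈ U) : op (groupCoord G pr s x) • s (pr x) = x :=
  Classical.epsilon_spec (p := fun g : G ↦ op g • s (pr x) = x)
    (hpr.exists_smul_eq (hs.proj _ hx))

lemma groupCoord_section {b : B} (hb : b ∈ U) : groupCoord G pr s (s b) = 1 :=
  groupCoord_eq_of_smul hpr (by rw [hs.proj b hb]; simp)

lemma groupCoord_op_smul {x : P} (hx : pr x ∈ U) (g : G) :
    groupCoord G pr s (op g • x) = groupCoord G pr s x * g := by
  refine groupCoord_eq_of_smul hpr ?_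
  rw [hpr.proj_smul, op_mul, mul_smul, groupCoord_smul hpr hs hx]

/-- In a trivialization `e` the group coordinate of `x` is the inverse of the group component of `s
(pr x)` times that of `x`. -/
lemma contMDiffAt_groupCoord {x₀ : P} (hx₀ : pr x₀ ∈ U) :
    ContMDiffAt 𝓘(ℝ, EP) 𝓘(ℝ, EG) ∞ (groupCoord G pr s) x₀ := by
  obtain ⟨e, hb, hsm, -, he⟩ := hpr.locally_trivial (pr x₀)
  have hpr₀ := hpr.smooth_proj.contMDiffAt (x := x₀)
  have hsrc : ∀ {x}, pr x ∈ e.baseSet → ContMDiffAt 𝓘(ℝ, EP) 𝓘(ℝ, EG) ∞ (fun x ↦ (e x).2) x :=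
    fun {x} hx ↦ contMDiffAt_snd.comp x
      (hsm.contMDiffAt (e.open_source.mem_nhds (e.mem_source.2 hx)))
  have h1 : ContMDiffAt 𝓘(ℝ, EP) 𝓘(ℝ, EP) ∞ (fun x ↦ s (pr x)) x₀ :=
    (hs.contMDiffAt hx₀).comp x₀ hpr₀
  have h2 : ContMDiffAt 𝓘(ℝ, EP) 𝓘(ℝ, EG) ∞ (fun x ↦ (e (s (pr x))).2) x₀ :=
    ContMDiffAt.comp x₀ (g := fun x ↦ (e x).2) (hsrc (by rwa [hs.proj _ hx₀])) h1
  refine ((h2.inv).mul (hsrc hb)).congr_of_eventuallyEq ?_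
  have hU : ∀ᶠ x in 𝓝 x₀, pr x ∈ U ∩ e.baseSet :=
    hpr₀.continuousAt ((hs.isOpen.inter e.open_baseSet).mem_nhds ⟨hx₀, hb⟩)
  filter_upwards [hU] with x hx
  have hsx : s (pr x) ∈ e.source := e.mem_source.2 (by rw [hs.proj _ hx.1]; exact hx.2)
  have h3 := he _ hsx (groupCoord G pr s x)
  rw [groupCoord_smul hpr hs hx.1] at h3
  rw [Pi.mul_apply, h3]
  simp

end

end Sections

/-! ### Trivializations of the associated bundle and its quotient topology -/

section FibreCoord

open Set Filter Topology

variable {EG : Type*} [NormedAddCommGroup EG] [NormedSpace ℝ EG]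
  {G : Type*} [TopologicalSpace G] [ChartedSpace EG G] [Group G] [LieGroup 𝓘(ℝ, EG) ∞ G]
  {EB : Type*} [NormedAddCommGroup EB] [NormedSpace ℝ EB]
  {B : Type*} [TopologicalSpace B] [ChartedSpace EB B] [IsManifold 𝓘(ℝ, EB) ∞ B]
  {EP : Type*} [NormedAddCommGroup EP] [NormedSpace ℝ EP]
  {P : Type*} [TopologicalSpace P] [ChartedSpace EP P] [IsManifold 𝓘(ℝ, EP) ∞ P]
  [MulAction Gᵐᵒᵖ P]
  {EF : Type*} [NormedAddCommGroup EF] [NormedSpace ℝ EF]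
  {F : Type*} [TopologicalSpace F] [ChartedSpace EF F] [IsManifold 𝓘(ℝ, EF) ∞ F] [MulAction G F]
  {pr : P → B}

/-- The fibre component of a point of the associated bundle, in the trivialization given by a
section. -/
def fibreCoord (pr : P → B) (s : B → P) (y : AssociatedBundle G P F) : F :=
  groupCoord G pr s (Quotient.out y).1 • (Quotient.out y).2

namespace AssociatedBundle

lemma mk_smul (g : G) (x : P) (f : F) : mk G (op g • x) f = mk G x (g • f) := by
  refine Quotient.sound ⟨g⁻¹, ?_⟩
  simp [smul_smul]

lemma exists_rep (y : AssociatedBundle G P F) : ∃ x f, mk G x f = y :=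
  ⟨(Quotient.out y).1, (Quotient.out y).2, Quotient.out_eq y⟩

@[simp] lemma proj_mk (hp : ∀ (g : G) (x : P), pr (op g • x) = pr x) (x : P) (f : F) :
    proj pr hp (mk G x f) = pr x := rfl

end AssociatedBundle

open AssociatedBundle

section

variable (hpr : IsPrincipalBundle EG G EP EB pr) {U : Set B} {s : B → P}
  (hs : IsLocalSection EB EP pr U s)
include hpr hs

/-- The chosen representative is `(x · g, g⁻¹ • f)` for some `g`, which cancels: the fibre
coordinate does not depend on the choice. -/
lemma fibreCoord_mk {x : P} (hx : pr x ∈ U) (f : F) :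
    fibreCoord pr s (mk G x f) = groupCoord G pr s x • f := by
  obtain ⟨g, hg⟩ := (associatedSetoid G P F).symm
    (Quotient.mk_out (s := associatedSetoid G P F) (x, f))
  have h : Quotient.out (mk G x f) = (op g • x, g⁻¹ • f) := hg
  rw [fibreCoord, h]
  simp [groupCoord_op_smul hpr hs hx, smul_smul]

lemma fibreCoord_mk_section {b : B} (hb : b ∈ U) (f : F) :
    fibreCoord pr s (mk G (s b) f) = f := by
  rw [fibreCoord_mk hpr hs (by rwa [hs.proj b hb]), groupCoord_section hpr hs hb, one_smul]

lemma mk_fibreCoord {y : AssociatedBundle G P F} (hy : proj pr hpr.proj_smul y ∈ U) :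
    mk G (s (proj pr hpr.proj_smul y)) (fibreCoord pr s y) = y := by
  obtain ⟨x, f, rfl⟩ := exists_rep y
  rw [fibreCoord_mk hpr hs hy, ← mk_smul, proj_mk, groupCoord_smul hpr hs hy]

end

lemma continuous_mk : Continuous fun y : P × F ↦ mk G y.1 y.2 := continuous_quotient_mk'

variable (hpr : IsPrincipalBundle EG G EP EB pr)

include hpr in
lemma continuous_proj : Continuous (proj pr hpr.proj_smul : AssociatedBundle G P F → B) :=
  Continuous.quotient_lift (hpr.smooth_proj.continuous.comp continuous_fst) _

variable (hact : ContMDiff (𝓘(ℝ, EG).prod 𝓘(ℝ, EF)) 𝓘(ℝ, EF) ∞ (fun y : G × F ↦ y.1 • y.2))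

include hpr hact in
-- The saturation of an open set is the union of its translates under `G`. As the map is open,
-- continuity at a point of the quotient can be tested upstairs on `P × F`.
lemma isOpenQuotientMap_mk : IsOpenQuotientMap fun y : P × F ↦ mk G y.1 y.2 := by
  refine ⟨fun y ↦ ?_, continuous_mk, fun V hV ↦ ?_⟩
  · obtain ⟨x, f, h⟩ := exists_rep y
    exact ⟨(x, f), h⟩
  · refine (isQuotientMap_quotient_mk' (s := associatedSetoid G P F)).isOpen_preimage.1 ?_
    have h : Quotient.mk (associatedSetoid G P F) ⁻¹' ((fun y : P × F ↦ mk G y.1 y.2) '' V) =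
        ⋃ g : G, (fun y : P × F ↦ (op g • y.1, g⁻¹ • y.2)) ⁻¹' V := by
      ext y
      simp only [mem_preimage, mem_iUnion]
      constructor
      · rintro ⟨z, hz, h⟩
        obtain ⟨g, hg⟩ := (associatedSetoid G P F).symm (Quotient.exact h)
        exact ⟨g, hg ▸ hz⟩
      · rintro ⟨g, hg⟩
        exact ⟨_, hg, Quotient.sound ((associatedSetoid G P F).symm ⟨g, rfl⟩)⟩
    refine h ▸ isOpen_iUnion fun g ↦ hV.preimage ?_
    refine Continuous.prodMk ?_ ?_
    · exact hpr.smooth_action.continuous.comp (continuous_fst.prodMk continuous_const)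
    · exact hact.continuous.comp (continuous_const.prodMk continuous_snd)

variable {U : Set B} {s : B → P} (hs : IsLocalSection EB EP pr U s)

include hpr hact hs in
lemma continuousAt_fibreCoord {y : AssociatedBundle G P F} (hy : proj pr hpr.proj_smul y ∈ U) :
    ContinuousAt (fibreCoord pr s : AssociatedBundle G P F → F) y := by
  obtain ⟨x, f, rfl⟩ := exists_rep y
  rw [proj_mk] at hy
  have h := (isOpenQuotientMap_mk hpr hact (F := F) (G := G)).continuousAt_comp_iff
    (g := (fibreCoord pr s : AssociatedBundle G P F → F)) (x := (x, f))
  refine h.1 ?_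
  have h1 : ContinuousAt (fun y : P × F ↦ groupCoord G pr s y.1 • y.2) (x, f) := by
    refine ContinuousAt.comp (g := fun y : G × F ↦ y.1 • y.2)
      (f := fun y : P × F ↦ (groupCoord G pr s y.1, y.2)) hact.continuous.continuousAt ?_
    have h2 : ContinuousAt (fun y : P × F ↦ groupCoord G pr s y.1) (x, f) :=
      ContinuousAt.comp (g := groupCoord G pr s) (x := (x, f)) (contMDiffAt_groupCoord hpr hs hy).continuousAt
        continuousAt_fst
    exact h2.prodMk continuousAt_snd
  refine h1.congr_of_eventuallyEq ?_
  have : ∀ᶠ y : P × F in 𝓝 (x, f), pr y.1 ∈ U :=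
    (hpr.smooth_proj.continuous.comp continuous_fst).continuousAt (hs.isOpen.mem_nhds hy)
  filter_upwards [this] with y hy'
  exact fibreCoord_mk hpr hs hy' y.2

end FibreCoord

/-! ### Hausdorff property and smooth atlas of the associated bundle -/

section BundleManifold

open Set Filter Topology AssociatedBundle

variable {EG : Type*} [NormedAddCommGroup EG] [NormedSpace ℝ EG]
  {G : Type*} [TopologicalSpace G] [ChartedSpace EG G] [Group G] [LieGroup 𝓘(ℝ, EG) ∞ G]
  {EB : Type*} [NormedAddCommGroup EB] [NormedSpace ℝ EB]
  {B : Type*} [TopologicalSpace B] [ChartedSpace EB B] [IsManifold 𝓘(ℝ, EB) ∞ B]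
  {EP : Type*} [NormedAddCommGroup EP] [NormedSpace ℝ EP]
  {P : Type*} [TopologicalSpace P] [ChartedSpace EP P] [IsManifold 𝓘(ℝ, EP) ∞ P]
  [MulAction Gᵐᵒᵖ P]
  {EF : Type*} [NormedAddCommGroup EF] [NormedSpace ℝ EF]
  {F : Type*} [TopologicalSpace F] [ChartedSpace EF F] [IsManifold 𝓘(ℝ, EF) ∞ F] [MulAction G F]
  {pr : P → B}

variable (hpr : IsPrincipalBundle EG G EP EB pr)
  (hact : ContMDiff (𝓘(ℝ, EG).prod 𝓘(ℝ, EF)) 𝓘(ℝ, EF) ∞ (fun y : G × F ↦ y.1 • y.2))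

include hpr hact in
-- Points over different base points are separated in `B`; points of one fibre are separated by
-- their fibre coordinates in a common trivialization.
lemma AssociatedBundle.t2Space [T2Space B] [T2Space F] : T2Space (AssociatedBundle G P F) := by
  refine ⟨fun y y' hne ↦ ?_⟩
  by_cases hp : proj pr hpr.proj_smul y = proj pr hpr.proj_smul y'
  · obtain ⟨x, f, rfl⟩ := exists_rep y
    obtain ⟨U, s, hs, hU, -⟩ := hpr.exists_localSection x
    have hy' : proj pr hpr.proj_smul y' ∈ U := hp ▸ hU
    have hne' : fibreCoord pr s (mk G x f) ≠ fibreCoord pr s y' := fun h ↦ hne (by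
      rw [← mk_fibreCoord hpr hs (y := mk G x f) hU, ← mk_fibreCoord hpr hs hy', h, hp])
    obtain ⟨V, V', hV, hV', hyV, hyV', hd⟩ := t2_separation hne'
    refine ⟨_, _, isOpen_interior, isOpen_interior,
      mem_interior_iff_mem_nhds.2 (continuousAt_fibreCoord hpr hact hs (y := mk G x f) hU (hV.mem_nhds hyV)),
      mem_interior_iff_mem_nhds.2 (continuousAt_fibreCoord hpr hact hs hy' (hV'.mem_nhds hyV')), ?_⟩
    exact (hd.preimage _).mono interior_subset interior_subset
  · obtain ⟨V, V', hV, hV', hyV, hyV', hd⟩ := t2_separation hp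
    exact ⟨_, _, hV.preimage (continuous_proj hpr), hV'.preimage (continuous_proj hpr), hyV, hyV',
      hd.preimage _⟩

variable {U : Set B} {s : B → P}

/-- The chart of the associated bundle given by a section and by charts of the base and of the
fibre. -/
def bundleChart (hs : IsLocalSection EB EP pr U s) (b : B) (f : F) :
    OpenPartialHomeomorph (AssociatedBundle G P F) (EB × EF) where
  toFun y := (chartAt EB b (proj pr hpr.proj_smul y), chartAt EF f (fibreCoord pr s y))
  invFun z := mk G (s ((chartAt EB b).symm z.1)) ((chartAt EF f).symm z.2)
  source := {y | proj pr hpr.proj_smul y ∈ U ∩ (chartAt EB b).source ∧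
    fibreCoord pr s y ∈ (chartAt EF f).source}
  target := ((chartAt EB b).target ∩ (chartAt EB b).symm ⁻¹' U) ×ˢ (chartAt EF f).target
  map_source' y hy := by
    refine ⟨⟨(chartAt EB b).map_source hy.1.2, ?_⟩, (chartAt EF f).map_source hy.2⟩
    rw [mem_preimage, (chartAt EB b).left_inv hy.1.2]
    exact hy.1.1
  map_target' z hz := by
    have h : proj pr hpr.proj_smul (mk G (s ((chartAt EB b).symm z.1)) ((chartAt EF f).symm z.2)) =
      (chartAt EB b).symm z.1 := hs.proj _ hz.1.2
    refine ⟨⟨h.symm ▸ hz.1.2, h.symm ▸ (chartAt EB b).map_target hz.1.1⟩, ?_⟩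
    rw [fibreCoord_mk_section hpr hs hz.1.2]
    exact (chartAt EF f).map_target hz.2
  left_inv' y hy := by
    simp only
    rw [(chartAt EB b).left_inv hy.1.2, (chartAt EF f).left_inv hy.2, mk_fibreCoord hpr hs hy.1.1]
  right_inv' z hz := by
    rw [fibreCoord_mk_section hpr hs hz.1.2, proj_mk, hs.proj _ hz.1.2,
      (chartAt EB b).right_inv hz.1.1, (chartAt EF f).right_inv hz.2]
  open_source := by
    rw [isOpen_iff_mem_nhds]
    intro y hy
    exact Filter.Eventually.and ((continuous_proj hpr).continuousAt
      ((hs.isOpen.inter (chartAt EB b).open_source).mem_nhds hy.1))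
      (continuousAt_fibreCoord hpr hact hs hy.1.1 ((chartAt EF f).open_source.mem_nhds hy.2))
  open_target := ((chartAt EB b).isOpen_inter_preimage_symm hs.isOpen).prod (chartAt EF f).open_target
  continuousOn_toFun y hy := by
    refine ContinuousAt.continuousWithinAt (ContinuousAt.prodMk ?_ ?_)
    · exact ((chartAt EB b).continuousAt hy.1.2).comp (continuous_proj hpr).continuousAt
    · exact ((chartAt EF f).continuousAt hy.2).comp (continuousAt_fibreCoord hpr hact hs hy.1.1)
  continuousOn_invFun := by
    refine continuous_mk.comp_continuousOn (ContinuousOn.prodMk ?_ ?_)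
    · exact hs.smooth.continuousOn.comp ((chartAt EB b).continuousOn_symm.comp continuousOn_fst
        fun z hz ↦ hz.1.1) fun z hz ↦ hz.1.2
    · exact (chartAt EF f).continuousOn_symm.comp continuousOn_snd fun z hz ↦ hz.2

include hpr hact in
-- The transition map is `(b, f) ↦ g(b) • f`, where `g(b)` is the group coordinate of `s b` with
-- respect to `s'`.
lemma contMDiffAt_transition (hs : IsLocalSection EB EP pr U s) {U' : Set B} {s' : B → P}
    (hs' : IsLocalSection EB EP pr U' s') {z : B × F} (hz : z.1 ∈ U) (hz' : z.1 ∈ U') :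
    ContMDiffAt (𝓘(ℝ, EB).prod 𝓘(ℝ, EF)) 𝓘(ℝ, EF) ∞
      (fun z : B × F ↦ fibreCoord pr s' (mk G (s z.1) z.2)) z := by
  have h1 : ContMDiffAt (𝓘(ℝ, EB).prod 𝓘(ℝ, EF)) 𝓘(ℝ, EG) ∞
      (fun z : B × F ↦ groupCoord G pr s' (s z.1)) z :=
    ContMDiffAt.comp z (g := groupCoord G pr s') (f := fun z : B × F ↦ s z.1)
      (contMDiffAt_groupCoord hpr hs' (by rwa [hs.proj _ hz]))
      (ContMDiffAt.comp z (g := s) (f := Prod.fst) (hs.contMDiffAt hz) contMDiffAt_fst)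
  refine (ContMDiffAt.comp z (g := fun y : G × F ↦ y.1 • y.2)
    (f := fun z : B × F ↦ (groupCoord G pr s' (s z.1), z.2)) hact.contMDiffAt
    (h1.prodMk contMDiffAt_snd)).congr_of_eventuallyEq ?_
  have : ∀ᶠ z in 𝓝 z, z.1 ∈ U ∩ U' :=
    continuous_fst.continuousAt ((hs.isOpen.inter hs'.isOpen).mem_nhds ⟨hz, hz'⟩)
  filter_upwards [this] with w hw
  exact fibreCoord_mk hpr hs' (by rw [hs.proj _ hw.1]; exact hw.2) _

variable (EB EP F) in
/-- The charts of the associated bundle. -/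
@[reducible] def bundleChartedSpace : ChartedSpace (EB × EF) (AssociatedBundle G P F) where
  atlas := {c | ∃ (U : Set B) (s : B → P) (hs : IsLocalSection EB EP pr U s) (b : B) (f : F),
    c = bundleChart hpr hact hs b f}
  chartAt y := bundleChart hpr hact
    (hpr.exists_localSection (Quotient.out y).1).choose_spec.choose_spec.1
    (proj pr hpr.proj_smul y)
    (fibreCoord pr (hpr.exists_localSection (Quotient.out y).1).choose_spec.choose y)
  mem_chart_source y := by
    have h := (hpr.exists_localSection (Quotient.out y).1).choose_spec.choose_spec.2.1
    have hp : proj pr hpr.proj_smul y = pr (Quotient.out y).1 := by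
      conv_lhs => rw [← Quotient.out_eq y]
      rfl
    refine ⟨⟨?_, mem_chart_source _ _⟩, mem_chart_source _ _⟩
    rw [hp]
    exact h
  chart_mem_atlas y := ⟨_, _, _, _, _, rfl⟩

include hpr hact in
lemma contDiffOn_bundleChart_symm_trans (hs : IsLocalSection EB EP pr U s) {U' : Set B} {s' : B → P}
    (hs' : IsLocalSection EB EP pr U' s') (b b' : B) (f f' : F) :
    ContDiffOn ℝ ∞ ((bundleChart hpr hact hs b f).symm.trans (bundleChart hpr hact hs' b' f'))
      ((bundleChart hpr hact hs b f).symm.trans (bundleChart hpr hact hs' b' f')).source := by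
  rintro z ⟨⟨⟨hzb, hzU⟩, hzf⟩, ⟨hzU', hzb'⟩, hzf'⟩
  have hp : proj pr hpr.proj_smul (mk G (s ((chartAt EB b).symm z.1)) ((chartAt EF f).symm z.2)) =
      (chartAt EB b).symm z.1 := hs.proj _ hzU
  replace hzU' : (chartAt EB b).symm z.1 ∈ U' := hp ▸ hzU'
  replace hzb' : (chartAt EB b).symm z.1 ∈ (chartAt EB b').source := hp ▸ hzb'
  have h1 : ContMDiffAt 𝓘(ℝ, EB × EF) 𝓘(ℝ, EB) ∞ (fun z : EB × EF ↦ (chartAt EB b).symm z.1) z :=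
    ContMDiffAt.comp z (g := (chartAt EB b).symm) (f := Prod.fst) (contMDiffOn_chart_symm.contMDiffAt
      ((chartAt EB b).open_target.mem_nhds hzb)) contDiffAt_fst.contMDiffAt
  have h2 : ContMDiffAt 𝓘(ℝ, EB × EF) 𝓘(ℝ, EF) ∞ (fun z : EB × EF ↦ (chartAt EF f).symm z.2) z :=
    ContMDiffAt.comp z (g := (chartAt EF f).symm) (f := Prod.snd) (contMDiffOn_chart_symm.contMDiffAt
      ((chartAt EF f).open_target.mem_nhds hzf)) contDiffAt_snd.contMDiffAt
  have h3 : ContMDiffAt 𝓘(ℝ, EB × EF) 𝓘(ℝ, EB) ∞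
      (fun z : EB × EF ↦ chartAt EB b' ((chartAt EB b).symm z.1)) z :=
    ContMDiffAt.comp z (g := chartAt EB b') (contMDiffOn_chart.contMDiffAt
      ((chartAt EB b').open_source.mem_nhds hzb')) h1
  have h4 : ContMDiffAt 𝓘(ℝ, EB × EF) 𝓘(ℝ, EF) ∞ (fun z : EB × EF ↦ chartAt EF f'
      (fibreCoord pr s' (mk G (s ((chartAt EB b).symm z.1)) ((chartAt EF f).symm z.2)))) z := by
    refine ContMDiffAt.comp z (g := chartAt EF f') (contMDiffOn_chart.contMDiffAt
      ((chartAt EF f').open_source.mem_nhds hzf')) ?_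
    exact ContMDiffAt.comp z (g := fun w : B × F ↦ fibreCoord pr s' (mk G (s w.1) w.2))
      (f := fun z : EB × EF ↦ ((chartAt EB b).symm z.1, (chartAt EF f).symm z.2))
      (contMDiffAt_transition hpr hact hs hs' hzU hzU') (h1.prodMk h2)
  refine ContDiffAt.contDiffWithinAt ((h3.contDiffAt.prodMk h4.contDiffAt).congr_of_eventuallyEq ?_)
  have hW : ∀ᶠ z : EB × EF in 𝓝 z, (chartAt EB b).symm z.1 ∈ U := h1.continuousAt
    (hs.isOpen.mem_nhds hzU)
  filter_upwards [hW] with w hw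
  refine Prod.ext ?_ rfl
  exact congrArg (chartAt EB b') (hs.proj _ hw)

lemma isManifold_bundle :
    @IsManifold ℝ _ (EB × EF) _ _ (EB × EF) _ 𝓘(ℝ, EB × EF) ∞ (AssociatedBundle G P F) _
      (bundleChartedSpace EB EP F hpr hact) := by
  let _ := bundleChartedSpace EB EP F hpr hact
  refine isManifold_of_contDiffOn _ _ _ ?_
  rintro _ _ ⟨U, s, hs, b, f, rfl⟩ ⟨U', s', hs', b', f', rfl⟩
  simpa using contDiffOn_bundleChart_symm_trans hpr hact hs hs' b b' f f'

end BundleManifold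

/-! ### Smooth trivializations, second countability, and the quotient map as a submersion -/

section BundleSmoothness

open Set Filter Topology AssociatedBundle

variable {EG : Type*} [NormedAddCommGroup EG] [NormedSpace ℝ EG]
  {G : Type*} [TopologicalSpace G] [ChartedSpace EG G] [Group G] [LieGroup 𝓘(ℝ, EG) ∞ G]
  {EB : Type*} [NormedAddCommGroup EB] [NormedSpace ℝ EB]
  {B : Type*} [TopologicalSpace B] [ChartedSpace EB B] [IsManifold 𝓘(ℝ, EB) ∞ B]
  {EP : Type*} [NormedAddCommGroup EP] [NormedSpace ℝ EP]
  {P : Type*} [TopologicalSpace P] [ChartedSpace EP P] [IsManifold 𝓘(ℝ, EP) ∞ P]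
  [MulAction Gᵐᵒᵖ P]
  {EF : Type*} [NormedAddCommGroup EF] [NormedSpace ℝ EF]
  {F : Type*} [TopologicalSpace F] [ChartedSpace EF F] [IsManifold 𝓘(ℝ, EF) ∞ F] [MulAction G F]
  {pr : P → B}
  {EM : Type*} [NormedAddCommGroup EM] [NormedSpace ℝ EM]
  [ChartedSpace EM (AssociatedBundle G P F)]

variable (EG EB EP EF F EM) in
/-- The local trivializations of `P ×_G F` given by the smooth sections of `P` are smooth. -/
structure IsBundleManifold (hpr : IsPrincipalBundle EG G EP EB pr) : Prop where
  smooth_proj : ContMDiff 𝓘(ℝ, EM) 𝓘(ℝ, EB) ∞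
    (proj pr hpr.proj_smul : AssociatedBundle G P F → B)
  smooth_section : ∀ (U : Set B) (s : B → P), IsLocalSection EB EP pr U s → ∀ z : B × F, z.1 ∈ U →
    ContMDiffAt (𝓘(ℝ, EB).prod 𝓘(ℝ, EF)) 𝓘(ℝ, EM) ∞ (fun z : B × F ↦ mk G (s z.1) z.2) z
  smooth_fibreCoord : ∀ (U : Set B) (s : B → P), IsLocalSection EB EP pr U s →
    ∀ y : AssociatedBundle G P F, proj pr hpr.proj_smul y ∈ U →
      ContMDiffAt 𝓘(ℝ, EM) 𝓘(ℝ, EF) ∞ (fibreCoord pr s : AssociatedBundle G P F → F) y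

variable (hpr : IsPrincipalBundle EG G EP EB pr)
  (hact : ContMDiff (𝓘(ℝ, EG).prod 𝓘(ℝ, EF)) 𝓘(ℝ, EF) ∞ (fun y : G × F ↦ y.1 • y.2))

lemma isBundleManifold :
    @IsBundleManifold EG _ _ G _ _ _ EB _ _ B _ _ EP _ _ P _ _ _ EF _ _ F _ _ _ pr (EB × EF) _ _
      (bundleChartedSpace EB EP F hpr hact) hpr := by
  let _ := bundleChartedSpace EB EP F hpr hact
  have := isManifold_bundle (F := F) hpr hact
  have hchart : ∀ y : AssociatedBundle G P F, ∃ (U : Set B) (s : B → P)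
      (hs : IsLocalSection EB EP pr U s) (b : B) (f : F), chartAt (EB × EF) y =
      bundleChart hpr hact hs b f := fun y ↦ ⟨_, _, _, _, _, rfl⟩
  have hcs : ∀ y : AssociatedBundle G P F, ContMDiffAt 𝓘(ℝ, EB × EF) 𝓘(ℝ, EB × EF) ∞
      (chartAt (EB × EF) y) y := fun y ↦
    contMDiffOn_chart.contMDiffAt ((chartAt (EB × EF) y).open_source.mem_nhds
      (mem_chart_source (EB × EF) y))
  -- The preferred chart at `y` comes from one particular section, and for this section smoothness
  -- near `y` can be read off from the chart.
  have hy : ∀ y : AssociatedBundle G P F, ∃ (U : Set B) (s : B → P), IsLocalSection EB EP pr U s ∧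
      proj pr hpr.proj_smul y ∈ U ∧ ContMDiffAt 𝓘(ℝ, EB × EF) 𝓘(ℝ, EB) ∞
        (proj pr hpr.proj_smul : AssociatedBundle G P F → B) y ∧
      ContMDiffAt 𝓘(ℝ, EB × EF) 𝓘(ℝ, EF) ∞ (fibreCoord pr s : AssociatedBundle G P F → F) y ∧
      ∀ z : B × F, mk G (s z.1) z.2 = y → z.1 ∈ U → ContMDiffAt (𝓘(ℝ, EB).prod 𝓘(ℝ, EF))
        𝓘(ℝ, EB × EF) ∞ (fun z : B × F ↦ mk G (s z.1) z.2) z := by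
    intro y
    obtain ⟨U, s, hs, b, f, hc⟩ := hchart y
    have hsrc := mem_chart_source (EB × EF) y
    have hcy := hcs y
    have hsymm : ContMDiffOn 𝓘(ℝ, EB × EF) 𝓘(ℝ, EB × EF) ∞ (chartAt (EB × EF) y).symm
      (chartAt (EB × EF) y).target := contMDiffOn_chart_symm
    rw [hc] at hsrc hcy hsymm
    obtain ⟨⟨hU, hb⟩, hf⟩ := hsrc
    have h1 := ((contMDiffAt_prod_module_iff _).1 hcy).1
    have h2 := ((contMDiffAt_prod_module_iff _).1 hcy).2
    refine ⟨U, s, hs, hU, ?_, ?_, ?_⟩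
    · refine (ContMDiffAt.comp y (g := (chartAt EB b).symm) (contMDiffOn_chart_symm.contMDiffAt
        ((chartAt EB b).open_target.mem_nhds ((chartAt EB b).map_source hb)))
        h1).congr_of_eventuallyEq ?_
      filter_upwards [(continuous_proj hpr).continuousAt
        ((chartAt EB b).open_source.mem_nhds hb)] with w hw
      exact ((chartAt EB b).left_inv hw).symm
    · refine (ContMDiffAt.comp y (g := (chartAt EF f).symm) (contMDiffOn_chart_symm.contMDiffAt
        ((chartAt EF f).open_target.mem_nhds ((chartAt EF f).map_source hf)))
        h2).congr_of_eventuallyEq ?_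
      filter_upwards [continuousAt_fibreCoord hpr hact hs hU
        ((chartAt EF f).open_source.mem_nhds hf)] with w hw
      exact ((chartAt EF f).left_inv hw).symm
    · rintro z rfl hz
      rw [proj_mk, hs.proj _ hz] at hb
      rw [fibreCoord_mk_section hpr hs hz] at hf
      have hz1 : ContMDiffAt (𝓘(ℝ, EB).prod 𝓘(ℝ, EF)) 𝓘(ℝ, EB × EF) ∞
          (fun z : B × F ↦ (chartAt EB b z.1, chartAt EF f z.2)) z := by
        refine ContMDiffAt.prodMk_space ?_ ?_
        · exact ContMDiffAt.comp z (g := chartAt EB b) (f := Prod.fst) (contMDiffOn_chart.contMDiffAt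
            ((chartAt EB b).open_source.mem_nhds hb)) contMDiffAt_fst
        · exact ContMDiffAt.comp z (g := chartAt EF f) (f := Prod.snd) (contMDiffOn_chart.contMDiffAt
            ((chartAt EF f).open_source.mem_nhds hf)) contMDiffAt_snd
      refine (ContMDiffAt.comp z (hsymm.contMDiffAt ((bundleChart hpr hact hs b f).open_target.mem_nhds
        ?_)) hz1).congr_of_eventuallyEq ?_
      · refine ⟨⟨(chartAt EB b).map_source hb, ?_⟩, (chartAt EF f).map_source hf⟩
        rw [mem_preimage, (chartAt EB b).left_inv hb]
        exact hz
      · filter_upwards [((chartAt EB b).open_source.prod (chartAt EF f).open_source).mem_nhds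
          ⟨hb, hf⟩] with w hw
        simp [bundleChart, (chartAt EB b).left_inv hw.1, (chartAt EF f).left_inv hw.2]
  -- Any other section is compared with the one of the chart by a smooth transition map.
  refine ⟨fun y ↦ ?_, fun U' s' hs' z hz ↦ ?_, fun U' s' hs' y hy' ↦ ?_⟩
  · obtain ⟨U, s, hs, hU, h, -⟩ := hy y
    exact h
  · obtain ⟨U, s, hs, hU, -, -, h⟩ := hy (mk G (s' z.1) z.2)
    rw [proj_mk, hs'.proj _ hz] at hU
    have hpz : proj pr hpr.proj_smul (mk G (s' z.1) z.2) = z.1 := hs'.proj _ hz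
    have h1 := h (z.1, fibreCoord pr s (mk G (s' z.1) z.2))
      (by have := mk_fibreCoord hpr hs (y := mk G (s' z.1) z.2) (by rwa [hpz])
          rwa [hpz] at this) hU
    refine (ContMDiffAt.comp z (f := fun w : B × F ↦ (w.1, fibreCoord pr s (mk G (s' w.1) w.2))) h1
      (contMDiffAt_fst.prodMk
      (contMDiffAt_transition hpr hact hs' hs hz hU))).congr_of_eventuallyEq ?_
    filter_upwards [continuous_fst.continuousAt ((hs'.isOpen.inter hs.isOpen).mem_nhds ⟨hz, hU⟩)]
      with w hw
    have hpw : proj pr hpr.proj_smul (mk G (s' w.1) w.2) = w.1 := hs'.proj _ hw.1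
    have := mk_fibreCoord hpr hs (y := mk G (s' w.1) w.2) (by rw [hpw]; exact hw.2)
    rw [hpw] at this
    exact this.symm
  · obtain ⟨U, s, hs, hU, hp, hf, -⟩ := hy y
    refine (ContMDiffAt.comp y (g := fun z : B × F ↦ fibreCoord pr s' (mk G (s z.1) z.2))
      (f := fun y ↦ (proj pr hpr.proj_smul y, fibreCoord pr s y))
      (contMDiffAt_transition hpr hact hs hs' hU hy') (hp.prodMk hf)).congr_of_eventuallyEq ?_
    filter_upwards [(continuous_proj hpr).continuousAt (hs.isOpen.mem_nhds hU)] with w hw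
    simp only [Function.comp_apply]
    rw [mk_fibreCoord hpr hs hw]

variable {hpr} (hM : IsBundleManifold EG EB EP EF F EM hpr)

include hact hM in
lemma IsBundleManifold.smooth_mk : ContMDiff (𝓘(ℝ, EP).prod 𝓘(ℝ, EF)) 𝓘(ℝ, EM) ∞
    (fun y : P × F ↦ AssociatedBundle.mk G y.1 y.2) := by
  intro y
  obtain ⟨U, s, hs, hU, -⟩ := hpr.exists_localSection y.1
  have h1 : ContMDiffAt (𝓘(ℝ, EP).prod 𝓘(ℝ, EF)) 𝓘(ℝ, EF) ∞
      (fun y : P × F ↦ groupCoord G pr s y.1 • y.2) y := by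
    refine ContMDiffAt.comp y (g := fun y : G × F ↦ y.1 • y.2)
      (f := fun y : P × F ↦ (groupCoord G pr s y.1, y.2)) hact.contMDiffAt
      (ContMDiffAt.prodMk ?_ contMDiffAt_snd)
    exact ContMDiffAt.comp y (g := groupCoord G pr s) (f := Prod.fst)
      (contMDiffAt_groupCoord hpr hs hU) contMDiffAt_fst
  have h2 : ContMDiffAt (𝓘(ℝ, EP).prod 𝓘(ℝ, EF)) 𝓘(ℝ, EB) ∞ (fun y : P × F ↦ pr y.1) y :=
    hpr.smooth_proj.contMDiffAt.comp y contMDiffAt_fst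
  refine (ContMDiffAt.comp y (f := fun y : P × F ↦ (pr y.1, groupCoord G pr s y.1 • y.2))
    (hM.smooth_section U s hs (pr y.1, groupCoord G pr s y.1 • y.2) hU)
    (h2.prodMk h1)).congr_of_eventuallyEq ?_
  filter_upwards [h2.continuousAt (hs.isOpen.mem_nhds hU)] with w hw
  simp only [Function.comp_apply]
  rw [← mk_smul, groupCoord_smul hpr hs hw]

include hpr hact in
-- Over the domain `U` of a section the bundle embeds in `U × F`, and countably many such domains
-- cover `B`.
lemma AssociatedBundle.secondCountableTopology [SecondCountableTopology B]
    [SecondCountableTopology F] : SecondCountableTopology (AssociatedBundle G P F) := by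
  have h : ∀ b : B, ∃ U : Set B, b ∈ U ∧ IsOpen U ∧
      SecondCountableTopology (proj pr hpr.proj_smul ⁻¹' U : Set (AssociatedBundle G P F)) := by
    intro b
    obtain ⟨e, he, -⟩ := hpr.locally_trivial b
    have hb : pr (e.toOpenPartialHomeomorph.symm (b, 1)) = b := e.proj_symm_apply (e.mem_target.2 he)
    obtain ⟨U, s, hs, hU, -⟩ := hpr.exists_localSection (e.toOpenPartialHomeomorph.symm (b, 1))
    refine ⟨U, hb ▸ hU, hs.isOpen, ?_⟩
    have hl : Function.LeftInverse
        (fun z : U × F ↦ (⟨mk G (s z.1.1) z.2, by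
          rw [mem_preimage, proj_mk, hs.proj _ z.1.2]; exact z.1.2⟩ :
          (proj pr hpr.proj_smul ⁻¹' U : Set (AssociatedBundle G P F))))
        (fun y ↦ (⟨proj pr hpr.proj_smul y.1, y.2⟩, fibreCoord pr s y.1)) :=
      fun y ↦ Subtype.ext (mk_fibreCoord hpr hs y.2)
    refine (hl.isEmbedding ?_ ?_).isInducing.secondCountableTopology
    · refine Continuous.subtype_mk (continuous_mk.comp (Continuous.prodMk ?_ continuous_snd)) _
      exact (continuousOn_iff_continuous_domRestrict.1 hs.smooth.continuousOn).comp continuous_fst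
    · refine Continuous.prodMk (((continuous_proj hpr).comp continuous_subtype_val).subtype_mk _) ?_
      exact continuous_iff_continuousAt.2 fun y ↦
        (continuousAt_fibreCoord hpr hact hs y.2).comp continuous_subtype_val.continuousAt
  choose U hbU hU hsc using h
  obtain ⟨t, ht, hcov⟩ := TopologicalSpace.countable_cover_nhds fun b ↦ (hU b).mem_nhds (hbU b)
  have := ht.to_subtype
  refine TopologicalSpace.secondCountableTopology_of_countable_cover
    (U := fun b : t ↦ proj pr hpr.proj_smul ⁻¹' U b.1) (fun b ↦ (hU _).preimage (continuous_proj hpr)) ?_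
  rw [← preimage_iUnion, ← biUnion_eq_iUnion (t := fun b _ ↦ U b), hcov, preimage_univ]

section

variable {U : Set B} {s : B → P} (hs : IsLocalSection EB EP pr U s)
include hM hs

/-- This differentiates `mk_fibreCoord`. With the next two lemmas, it says that the derivatives of
the trivialization and of the pair of base point and fibre coordinate are inverse to each other. -/
lemma IsBundleManifold.tder_section_proj_fibreCoord {y : AssociatedBundle G P F}
    (hy : proj pr hpr.proj_smul y ∈ U) (v : EM) :
    tder (𝓘(ℝ, EB).prod 𝓘(ℝ, EF)) 𝓘(ℝ, EM) (fun z : B × F ↦ AssociatedBundle.mk G (s z.1) z.2)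
      (proj pr hpr.proj_smul y, fibreCoord pr s y)
      (tder 𝓘(ℝ, EM) 𝓘(ℝ, EB) (proj pr hpr.proj_smul) y v,
        tder 𝓘(ℝ, EM) 𝓘(ℝ, EF) (fibreCoord pr s) y v) = v := by
  have hp := hM.smooth_proj.contMDiffAt (x := y) |>.mdifferentiableAt (by simp)
  have hτ := (hM.smooth_fibreCoord U s hs y hy).mdifferentiableAt (by simp)
  have hev : (fun w : AssociatedBundle G P F ↦
      AssociatedBundle.mk G (s (proj pr hpr.proj_smul w)) (fibreCoord pr s w)) =ᶠ[𝓝 y] fun w ↦ w := by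
    filter_upwards [(continuous_proj hpr).continuousAt (hs.isOpen.mem_nhds hy)] with w hw
    exact mk_fibreCoord hpr hs hw
  have h1 := tder_comp (IA := 𝓘(ℝ, EM)) (IN := 𝓘(ℝ, EB).prod 𝓘(ℝ, EF)) (IM := 𝓘(ℝ, EM))
    (g := fun z : B × F ↦ AssociatedBundle.mk G (s z.1) z.2)
    (f := fun y : AssociatedBundle G P F ↦ (proj pr hpr.proj_smul y, fibreCoord pr s y)) (a := y)
    ((hM.smooth_section U s hs _ hy).mdifferentiableAt (by simp)) (hp.prodMk hτ) v
  rw [hev.tder_eq, tder_id, tder_prodMk hp hτ] at h1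
  exact h1.symm

lemma IsBundleManifold.tder_proj_section {b : B} (hb : b ∈ U) (f : F) (w : EB × EF) :
    tder 𝓘(ℝ, EM) 𝓘(ℝ, EB) (proj pr hpr.proj_smul) (AssociatedBundle.mk G (s b) f)
      (tder (𝓘(ℝ, EB).prod 𝓘(ℝ, EF)) 𝓘(ℝ, EM)
        (fun z : B × F ↦ AssociatedBundle.mk G (s z.1) z.2) (b, f) w) = w.1 := by
  have hev : (fun z : B × F ↦ proj pr hpr.proj_smul (AssociatedBundle.mk G (s z.1) z.2))
      =ᶠ[𝓝 (b, f)] Prod.fst := by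
    filter_upwards [continuous_fst.continuousAt (hs.isOpen.mem_nhds hb)] with z hz
    exact hs.proj _ hz
  rw [← tder_comp (g := proj pr hpr.proj_smul)
    (f := fun z : B × F ↦ AssociatedBundle.mk G (s z.1) z.2) (a := (b, f))
    (hM.smooth_proj.contMDiffAt.mdifferentiableAt (by simp))
    ((hM.smooth_section U s hs (b, f) hb).mdifferentiableAt (by simp)), hev.tder_eq]
  exact congrArg (fun L : EB × EF →L[ℝ] EB ↦ L w) (mfderiv_fst (I := 𝓘(ℝ, EB)) (I' := 𝓘(ℝ, EF)))

lemma IsBundleManifold.tder_fibreCoord_section {b : B} (hb : b ∈ U) (f : F) (w : EB × EF) :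
    tder 𝓘(ℝ, EM) 𝓘(ℝ, EF) (fibreCoord pr s) (AssociatedBundle.mk G (s b) f)
      (tder (𝓘(ℝ, EB).prod 𝓘(ℝ, EF)) 𝓘(ℝ, EM)
        (fun z : B × F ↦ AssociatedBundle.mk G (s z.1) z.2) (b, f) w) = w.2 := by
  have hev : (fun z : B × F ↦ fibreCoord pr s (AssociatedBundle.mk G (s z.1) z.2))
      =ᶠ[𝓝 (b, f)] Prod.snd := by
    filter_upwards [continuous_fst.continuousAt (hs.isOpen.mem_nhds hb)] with z hz
    exact fibreCoord_mk_section hpr hs hz _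
  rw [← tder_comp (g := fibreCoord pr s)
    (f := fun z : B × F ↦ AssociatedBundle.mk G (s z.1) z.2) (a := (b, f))
    ((hM.smooth_fibreCoord U s hs _ (by rwa [proj_mk, hs.proj _ hb])).mdifferentiableAt (by simp))
    ((hM.smooth_section U s hs (b, f) hb).mdifferentiableAt (by simp)), hev.tder_eq]
  exact congrArg (fun L : EB × EF →L[ℝ] EF ↦ L w) (mfderiv_snd (I := 𝓘(ℝ, EB)) (I' := 𝓘(ℝ, EF)))

end

include hact hM in
-- The trivialization of a section through `y.1` factors through the quotient map and has surjective
-- derivative, which forces the derivative of the quotient map to be surjective.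
lemma IsBundleManifold.isQuotientManifold [IsManifold 𝓘(ℝ, EM) ∞ (AssociatedBundle G P F)] :
    IsQuotientManifold G EP P EF F EM := by
  refine ⟨hM.smooth_mk hact, fun y (v : EM) ↦ ?_⟩
  obtain ⟨U, s, hs, hU, hsy⟩ := hpr.exists_localSection y.1
  have hfy : fibreCoord pr s (AssociatedBundle.mk G y.1 y.2) = y.2 := by
    conv_lhs => rw [← hsy]
    exact fibreCoord_mk_section hpr hs hU _
  have hsd : MDifferentiableAt (𝓘(ℝ, EB).prod 𝓘(ℝ, EF)) (𝓘(ℝ, EP).prod 𝓘(ℝ, EF))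
      (fun z : B × F ↦ (s z.1, z.2)) (pr y.1, y.2) := by
    refine MDifferentiableAt.prodMk ?_ mdifferentiableAt_snd
    exact MDifferentiableAt.comp (pr y.1, y.2) (g := s) (f := Prod.fst)
      ((hs.contMDiffAt hU).mdifferentiableAt (by simp)) mdifferentiableAt_fst
  have h1 := hM.tder_section_proj_fibreCoord hs (y := AssociatedBundle.mk G y.1 y.2) hU v
  rw [hfy, proj_mk, tder_comp (IA := 𝓘(ℝ, EB).prod 𝓘(ℝ, EF)) (IN := 𝓘(ℝ, EP).prod 𝓘(ℝ, EF))
    (IM := 𝓘(ℝ, EM)) (g := fun y : P × F ↦ AssociatedBundle.mk G y.1 y.2)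
    (f := fun z : B × F ↦ (s z.1, z.2)) (a := (pr y.1, y.2))
    ((hM.smooth_mk hact).contMDiffAt.mdifferentiableAt (by simp)) hsd] at h1
  simp only [hsy] at h1
  exact ⟨_, h1⟩

end BundleSmoothness

/-! ### Infinitesimal actions and connection forms on the model spaces -/

section Generators

open Set Filter Topology AssociatedBundle

variable {EG : Type*} [NormedAddCommGroup EG] [NormedSpace ℝ EG]
  {G : Type*} [TopologicalSpace G] [ChartedSpace EG G] [Group G] [LieGroup 𝓘(ℝ, EG) ∞ G]
  {EB : Type*} [NormedAddCommGroup EB] [NormedSpace ℝ EB]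
  {B : Type*} [TopologicalSpace B] [ChartedSpace EB B] [IsManifold 𝓘(ℝ, EB) ∞ B]
  {EP : Type*} [NormedAddCommGroup EP] [NormedSpace ℝ EP]
  {P : Type*} [TopologicalSpace P] [ChartedSpace EP P] [IsManifold 𝓘(ℝ, EP) ∞ P]
  [MulAction Gᵐᵒᵖ P]
  {EF : Type*} [NormedAddCommGroup EF] [NormedSpace ℝ EF]
  {F : Type*} [TopologicalSpace F] [ChartedSpace EF F] [IsManifold 𝓘(ℝ, EF) ∞ F] [MulAction G F]
  {pr : P → B}

variable (G) in
/-- The infinitesimal left action at a point, as a linear map of the model spaces. -/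
def leftGen (f : F) : EG →L[ℝ] EF := tder 𝓘(ℝ, EG) 𝓘(ℝ, EF) (fun g : G ↦ g • f) 1

variable (G) in
/-- The infinitesimal right action at a point, as a linear map of the model spaces. -/
def rightGen (x : P) : EG →L[ℝ] EP := tder 𝓘(ℝ, EG) 𝓘(ℝ, EP) (fun g : G ↦ op g • x) 1

/-- The value of a principal connection at a point, as a linear map of the model spaces. -/
def PrincipalConnection.form (θ : PrincipalConnection EG G EP P) (x : P) : EP →L[ℝ] EG := θ.toFun x

/-- The pullback of a principal connection by a section, as a linear map of the model spaces. -/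
def PrincipalConnection.pullback (θ : PrincipalConnection EG G EP P) (s : B → P) (b : B) :
    EB →L[ℝ] EG :=
  (θ.form (s b)).comp (tder 𝓘(ℝ, EB) 𝓘(ℝ, EP) s b)

lemma PrincipalConnection.form_rightGen (θ : PrincipalConnection EG G EP P) (x : P) (ξ : EG) :
    θ.form x (rightGen G x ξ) = ξ :=
  θ.fundamental x ξ

lemma PrincipalConnection.form_smul_eq_zero (θ : PrincipalConnection EG G EP P) {x : P} {v : EP}
    (g : G) (hv : θ.form x v = 0) :
    θ.form (op g • x) (tder 𝓘(ℝ, EP) 𝓘(ℝ, EP) (fun y : P ↦ op g • y) x v) = 0 := by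
  refine (θ.equivariant x g v).trans ?_
  have : θ.toFun x v = 0 := hv
  rw [this]
  exact map_zero (tder 𝓘(ℝ, EG) 𝓘(ℝ, EG) (fun k : G ↦ g⁻¹ * k * g⁻¹⁻¹) (1 : G))

section

variable {EA HA : Type*} [NormedAddCommGroup EA] [NormedSpace ℝ EA] [TopologicalSpace HA]
  {IA : ModelWithCorners ℝ EA HA} {A : Type*} [TopologicalSpace A] [ChartedSpace HA A]

/-- The generator of `ξ` at `f` is the derivative of the action map at `(1, f)` applied to `(ξ, 0)`,
so its smoothness is that of a derivative along a map. -/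
lemma SmoothAlongAt.leftGen
    (hact : ContMDiff (𝓘(ℝ, EG).prod 𝓘(ℝ, EF)) 𝓘(ℝ, EF) ∞ (fun y : G × F ↦ y.1 • y.2))
    {f : A → F} {ξ : A → EG} {a₀ : A} (hf : ContMDiffAt IA 𝓘(ℝ, EF) ∞ f a₀)
    (hξ : ContMDiffAt IA 𝓘(ℝ, EG) ∞ ξ a₀) :
    SmoothAlongAt IA 𝓘(ℝ, EF) f (fun a ↦ _root_.leftGen G (f a) (ξ a)) a₀ := by
  have h := ((smoothAlongAt_const (n := (1 : G)).2 hξ).prod (SmoothAlongAt.zero hf)).tder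
    (hact.contMDiffAt (x := ((1 : G), f a₀)))
  refine h.congr (Eventually.of_forall fun a ↦ (one_smul G (f a)).symm)
    (Eventually.of_forall fun a ↦ ?_)
  exact (tder_prod_left (p := ((1 : G), f a)) (hact.contMDiffAt.mdifferentiableAt (by simp))
    (ξ a)).symm

lemma SmoothAlongAt.form (θ : PrincipalConnection EG G EP P) {x : A → P} {v : A → EP} {a₀ : A}
    (hv : SmoothAlongAt IA 𝓘(ℝ, EP) x v a₀) :
    ContMDiffAt IA 𝓘(ℝ, EG) ∞ (fun a ↦ θ.form (x a) (v a)) a₀ :=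
  ContMDiffAt.comp a₀ (θ.smooth.contMDiffAt (x := (⟨x a₀, v a₀⟩ : TangentBundle 𝓘(ℝ, EP) P))) hv

lemma SmoothAlongAt.pullback (θ : PrincipalConnection EG G EP P) {U : Set B} {s : B → P}
    (hs : IsLocalSection EB EP pr U s) {b : A → B} {u : A → EB} {a₀ : A}
    (hu : SmoothAlongAt IA 𝓘(ℝ, EB) b u a₀) (hb : b a₀ ∈ U) :
    ContMDiffAt IA 𝓘(ℝ, EG) ∞ (fun a ↦ θ.pullback s (b a) (u a)) a₀ :=
  (hu.tder (hs.contMDiffAt hb)).form θ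

end

variable (hpr : IsPrincipalBundle EG G EP EB pr)
  (hact : ContMDiff (𝓘(ℝ, EG).prod 𝓘(ℝ, EF)) 𝓘(ℝ, EF) ∞ (fun y : G × F ↦ y.1 • y.2))

include hact in
lemma contMDiff_smul_right (f : F) : ContMDiff 𝓘(ℝ, EG) 𝓘(ℝ, EF) ∞ (fun g : G ↦ g • f) :=
  hact.comp (contMDiff_id.prodMk contMDiff_const)

include hpr

lemma IsPrincipalBundle.contMDiff_op_smul (g : G) :
    ContMDiff 𝓘(ℝ, EP) 𝓘(ℝ, EP) ∞ (fun x : P ↦ op g • x) :=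
  hpr.smooth_action.comp (contMDiff_id.prodMk contMDiff_const)

lemma IsPrincipalBundle.contMDiff_orbit (x : P) :
    ContMDiff 𝓘(ℝ, EG) 𝓘(ℝ, EP) ∞ (fun g : G ↦ op g • x) :=
  hpr.smooth_action.comp (contMDiff_const.prodMk contMDiff_id)

lemma IsPrincipalBundle.tder_proj_op_smul (g : G) (x : P) (v : EP) :
    tder 𝓘(ℝ, EP) 𝓘(ℝ, EB) pr (op g • x)
      (tder 𝓘(ℝ, EP) 𝓘(ℝ, EP) (fun y : P ↦ op g • y) x v) = tder 𝓘(ℝ, EP) 𝓘(ℝ, EB) pr x v := by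
  rw [← tder_comp (g := pr) (f := fun y : P ↦ op g • y)
    (hpr.smooth_proj.contMDiffAt.mdifferentiableAt (by simp))
    ((hpr.contMDiff_op_smul g).contMDiffAt.mdifferentiableAt (by simp))]
  simp only [hpr.proj_smul]

lemma IsPrincipalBundle.tder_proj_rightGen (x : P) (ξ : EG) :
    tder 𝓘(ℝ, EP) 𝓘(ℝ, EB) pr x (rightGen G x ξ) = 0 := by
  have h := tder_comp (g := pr) (f := fun g : G ↦ op g • x) (a := 1)
    (hpr.smooth_proj.contMDiffAt.mdifferentiableAt (by simp))
    ((hpr.contMDiff_orbit x).contMDiffAt.mdifferentiableAt (by simp)) ξ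
  simp only [op_one, one_smul, hpr.proj_smul, tder_const] at h
  exact h.symm

lemma IsLocalSection.tder_proj {U : Set B} {s : B → P} (hs : IsLocalSection EB EP pr U s)
    {b : B} (hb : b ∈ U) (u : EB) :
    tder 𝓘(ℝ, EP) 𝓘(ℝ, EB) pr (s b) (tder 𝓘(ℝ, EB) 𝓘(ℝ, EP) s b u) = u := by
  have hev : (fun b ↦ pr (s b)) =ᶠ[𝓝 b] fun b ↦ b := by
    filter_upwards [hs.isOpen.mem_nhds hb] with b hb using hs.proj b hb
  rw [← tder_comp (g := pr) (f := s) (hpr.smooth_proj.contMDiffAt.mdifferentiableAt (by simp))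
    ((hs.contMDiffAt hb).mdifferentiableAt (by simp)), hev.tder_eq, tder_id]

/-- The splitting of the tangent space of `P` at a point of a section. -/
lemma IsLocalSection.tder_section_add_rightGen {U : Set B} {s : B → P}
    (hs : IsLocalSection EB EP pr U s) {b : B} (hb : b ∈ U) (v : EP) :
    tder 𝓘(ℝ, EB) 𝓘(ℝ, EP) s b (tder 𝓘(ℝ, EP) 𝓘(ℝ, EB) pr (s b) v) +
      rightGen G (s b) (tder 𝓘(ℝ, EP) 𝓘(ℝ, EG) (groupCoord G pr s) (s b) v) = v := by
  have hpb : pr (s b) = b := hs.proj b hb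
  have hγ1 : groupCoord G pr s (s b) = 1 := groupCoord_section hpr hs hb
  have hp : MDifferentiableAt 𝓘(ℝ, EP) 𝓘(ℝ, EB) pr (s b) :=
    hpr.smooth_proj.contMDiffAt.mdifferentiableAt (by simp)
  have hsd : MDifferentiableAt 𝓘(ℝ, EB) 𝓘(ℝ, EP) s (pr (s b)) := by
    rw [hpb]; exact (hs.contMDiffAt hb).mdifferentiableAt (by simp)
  have hγ : MDifferentiableAt 𝓘(ℝ, EP) 𝓘(ℝ, EG) (groupCoord G pr s) (s b) :=
    (contMDiffAt_groupCoord hpr hs (by rwa [hpb])).mdifferentiableAt (by simp)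
  have hsp : MDifferentiableAt 𝓘(ℝ, EP) 𝓘(ℝ, EP) (fun x ↦ s (pr x)) (s b) := hsd.comp (s b) hp
  -- The splitting is the derivative of the identity `x = s (pr x) · g(x)` at `s b`, where `g = 1`.
  have hev : (fun x ↦ op (groupCoord G pr s x) • s (pr x)) =ᶠ[𝓝 (s b)] fun x ↦ x := by
    filter_upwards [hpr.smooth_proj.continuous.continuousAt
      (hs.isOpen.mem_nhds (by rwa [hpb]))] with x hx
    exact groupCoord_smul hpr hs hx
  have h := tder_comp (g := fun y : P × G ↦ op y.2 • y.1)
    (f := fun x ↦ (s (pr x), groupCoord G pr s x)) (a := s b)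
    (hpr.smooth_action.contMDiffAt.mdifferentiableAt (by simp)) (hsp.prodMk hγ) v
  rw [hev.tder_eq, tder_id, tder_prodMk hsp hγ, tder_prod
    (hpr.smooth_action.contMDiffAt.mdifferentiableAt (by simp)), tder_comp hsd hp] at h
  simp only [hγ1, hpb, op_one, one_smul, tder_id] at h
  exact h.symm

end Generators

/-! ### Horizontal lifts and vertical projections in a trivialization -/

section Splitting

open Set Filter Topology AssociatedBundle

variable {EG : Type*} [NormedAddCommGroup EG] [NormedSpace ℝ EG]
  {G : Type*} [TopologicalSpace G] [ChartedSpace EG G] [Group G] [LieGroup 𝓘(ℝ, EG) ∞ G]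
  {EB : Type*} [NormedAddCommGroup EB] [NormedSpace ℝ EB]
  {B : Type*} [TopologicalSpace B] [ChartedSpace EB B] [IsManifold 𝓘(ℝ, EB) ∞ B]
  {EP : Type*} [NormedAddCommGroup EP] [NormedSpace ℝ EP]
  {P : Type*} [TopologicalSpace P] [ChartedSpace EP P] [IsManifold 𝓘(ℝ, EP) ∞ P]
  [MulAction Gᵐᵒᵖ P]
  {EF : Type*} [NormedAddCommGroup EF] [NormedSpace ℝ EF]
  {F : Type*} [TopologicalSpace F] [ChartedSpace EF F] [IsManifold 𝓘(ℝ, EF) ∞ F] [MulAction G F]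
  {pr : P → B}
variable {EM : Type*} [NormedAddCommGroup EM] [NormedSpace ℝ EM]
  [ChartedSpace EM (AssociatedBundle G P F)]

variable (EF F EM) in
/-- The horizontal lift to the associated bundle, in the trivialization given by a section. -/
def horLift (hpr : IsPrincipalBundle EG G EP EB pr) (θ : PrincipalConnection EG G EP P) (s : B → P)
    (y : AssociatedBundle G P F) : EB →L[ℝ] EM :=
  (tder (𝓘(ℝ, EB).prod 𝓘(ℝ, EF)) 𝓘(ℝ, EM) (fun z : B × F ↦ AssociatedBundle.mk G (s z.1) z.2)
    (proj pr hpr.proj_smul y, fibreCoord pr s y)).comp ((ContinuousLinearMap.id ℝ EB).prod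
      (-((leftGen G (fibreCoord pr s y)).comp (θ.pullback s (proj pr hpr.proj_smul y)))))

variable (EF F EM) in
/-- The vertical projection, in the trivialization given by a section. -/
def vertProj (hpr : IsPrincipalBundle EG G EP EB pr) (θ : PrincipalConnection EG G EP P) (s : B → P)
    (y : AssociatedBundle G P F) : EM →L[ℝ] EF :=
  tder 𝓘(ℝ, EM) 𝓘(ℝ, EF) (fibreCoord pr s) y + (leftGen G (fibreCoord pr s y)).comp
    ((θ.pullback s (proj pr hpr.proj_smul y)).comp (tder 𝓘(ℝ, EM) 𝓘(ℝ, EB)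
      (proj pr hpr.proj_smul) y))

variable {hpr : IsPrincipalBundle EG G EP EB pr}
  (hact : ContMDiff (𝓘(ℝ, EG).prod 𝓘(ℝ, EF)) 𝓘(ℝ, EF) ∞ (fun y : G × F ↦ y.1 • y.2))
  (hM : IsBundleManifold EG EB EP EF F EM hpr) (θ : PrincipalConnection EG G EP P)

lemma horLift_apply (s : B → P) (y : AssociatedBundle G P F) (u : EB) :
    horLift EF F EM hpr θ s y u = tder (𝓘(ℝ, EB).prod 𝓘(ℝ, EF)) 𝓘(ℝ, EM)
      (fun z : B × F ↦ AssociatedBundle.mk G (s z.1) z.2)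
      (proj pr hpr.proj_smul y, fibreCoord pr s y)
      (u, -leftGen G (fibreCoord pr s y) (θ.pullback s (proj pr hpr.proj_smul y) u)) := rfl

lemma vertProj_apply (s : B → P) (y : AssociatedBundle G P F) (v : EM) :
    vertProj EF F EM hpr θ s y v = tder 𝓘(ℝ, EM) 𝓘(ℝ, EF) (fibreCoord pr s) y v +
      leftGen G (fibreCoord pr s y) (θ.pullback s (proj pr hpr.proj_smul y)
        (tder 𝓘(ℝ, EM) 𝓘(ℝ, EB) (proj pr hpr.proj_smul) y v)) := rfl

include hact hM in
lemma IsBundleManifold.contMDiff_mk_left (f : F) :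
    ContMDiff 𝓘(ℝ, EP) 𝓘(ℝ, EM) ∞ (fun x : P ↦ AssociatedBundle.mk G x f) :=
  (hM.smooth_mk hact).comp (contMDiff_id.prodMk contMDiff_const)

include hact hM in
lemma IsBundleManifold.contMDiff_mk_right (x : P) :
    ContMDiff 𝓘(ℝ, EF) 𝓘(ℝ, EM) ∞ (fun f : F ↦ AssociatedBundle.mk G x f) :=
  (hM.smooth_mk hact).comp (contMDiff_const.prodMk contMDiff_id)

variable {U : Set B} {s : B → P} (hs : IsLocalSection EB EP pr U s)
include hM hs

lemma IsBundleManifold.tder_section_apply {b : B} (hb : b ∈ U) (f : F) (w : EF) :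
    tder (𝓘(ℝ, EB).prod 𝓘(ℝ, EF)) 𝓘(ℝ, EM) (fun z : B × F ↦ AssociatedBundle.mk G (s z.1) z.2)
      (b, f) (0, w) = tder 𝓘(ℝ, EF) 𝓘(ℝ, EM) (fun f : F ↦ AssociatedBundle.mk G (s b) f) f w :=
  tder_prod_right ((hM.smooth_section U s hs (b, f) hb).mdifferentiableAt (by simp)) w

omit hs in
include hact in
/-- The maps `x ↦ [x, f]` send horizontal vectors to horizontal lifts. -/
lemma IsBundleManifold.tder_mk_eq_horLift (hs : IsLocalSection EB EP pr U s) {x : P}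
    (hx : pr x ∈ U) (f : F) {v : EP}
    (hv : θ.form x v = 0) :
    tder 𝓘(ℝ, EP) 𝓘(ℝ, EM) (fun x : P ↦ AssociatedBundle.mk G x f) x v =
      horLift EF F EM hpr θ s (AssociatedBundle.mk G x f) (tder 𝓘(ℝ, EP) 𝓘(ℝ, EB) pr x v) := by
  obtain ⟨b, hb, hxb⟩ : ∃ b, b ∈ U ∧ pr x = b := ⟨_, hx, rfl⟩
  -- The claim at the points of the section, where `[x, f] = [s (pr x), g(x) • f]` is differentiated
  -- at `g = 1`.
  have key : ∀ (f : F) (v : EP), θ.form (s b) v = 0 →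
      tder 𝓘(ℝ, EP) 𝓘(ℝ, EM) (fun x : P ↦ AssociatedBundle.mk G x f) (s b) v =
        horLift EF F EM hpr θ s (AssociatedBundle.mk G (s b) f)
          (tder 𝓘(ℝ, EP) 𝓘(ℝ, EB) pr (s b) v) := by
    intro f v hv
    have hpb : pr (s b) = b := hs.proj b hb
    have hγ1 : groupCoord G pr s (s b) = 1 := groupCoord_section hpr hs hb
    have hp : MDifferentiableAt 𝓘(ℝ, EP) 𝓘(ℝ, EB) pr (s b) :=
      hpr.smooth_proj.contMDiffAt.mdifferentiableAt (by simp)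
    have hγ : MDifferentiableAt 𝓘(ℝ, EP) 𝓘(ℝ, EG) (groupCoord G pr s) (s b) :=
      (contMDiffAt_groupCoord hpr hs (by rwa [hpb])).mdifferentiableAt (by simp)
    have hg : MDifferentiableAt 𝓘(ℝ, EG) 𝓘(ℝ, EF) (fun g : G ↦ g • f)
        (groupCoord G pr s (s b)) :=
      (contMDiff_smul_right hact f).contMDiffAt.mdifferentiableAt (by simp)
    have hγf : MDifferentiableAt 𝓘(ℝ, EP) 𝓘(ℝ, EF) (fun x ↦ groupCoord G pr s x • f) (s b) :=
      MDifferentiableAt.comp (s b) (g := fun g : G ↦ g • f) hg hγ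
    have hev : (fun x : P ↦ AssociatedBundle.mk G x f) =ᶠ[𝓝 (s b)]
        fun x ↦ AssociatedBundle.mk G (s (pr x)) (groupCoord G pr s x • f) := by
      filter_upwards [hpr.smooth_proj.continuous.continuousAt
        (hs.isOpen.mem_nhds (by rwa [hpb]))] with x hx
      rw [← mk_smul, groupCoord_smul hpr hs hx]
    -- Apply `θ` to the splitting of the horizontal vector `v`: its component along the group is
    -- minus the local connection form of its projection.
    have ha : tder 𝓘(ℝ, EP) 𝓘(ℝ, EG) (groupCoord G pr s) (s b) v =
        -θ.pullback s b (tder 𝓘(ℝ, EP) 𝓘(ℝ, EB) pr (s b) v) := by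
      have := congrArg (θ.form (s b)) (hs.tder_section_add_rightGen hpr hb v)
      rw [map_add, θ.form_rightGen, hv] at this
      exact eq_neg_of_add_eq_zero_right this
    rw [hev.tder_eq, tder_comp (g := fun z : B × F ↦ AssociatedBundle.mk G (s z.1) z.2)
      (f := fun x ↦ (pr x, groupCoord G pr s x • f)) ((hM.smooth_section U s hs _
      (by rwa [hpb])).mdifferentiableAt (by simp)) (hp.prodMk hγf), tder_prodMk hp hγf,
      tder_comp (g := fun g : G ↦ g • f) hg hγ, ha, horLift_apply]
    simp only [hγ1, one_smul, hpb, proj_mk, fibreCoord_mk_section hpr hs hb]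
    rw [map_neg]
    rfl
  -- A general point is moved into the section by `g`. This replaces `f` by `g⁻¹ • f`, and it keeps
  -- horizontal vectors horizontal and their projections unchanged.
  obtain ⟨g, hg⟩ := hpr.exists_smul_eq (x := x) (x' := s b) (by rw [hs.proj b hb, hxb])
  have hmk : ∀ x : P, AssociatedBundle.mk G x f = AssociatedBundle.mk G (op g • x) (g⁻¹ • f) :=
    fun x ↦ by rw [mk_smul, smul_inv_smul]
  have h := key (g⁻¹ • f) _ (by rw [← hg]; exact θ.form_smul_eq_zero g hv)
  rw [← hg, hpr.tder_proj_op_smul, ← hmk, ← tder_comp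
    (g := fun x : P ↦ AssociatedBundle.mk G x (g⁻¹ • f)) (f := fun y : P ↦ op g • y)
    ((hM.contMDiff_mk_left hact _).contMDiffAt.mdifferentiableAt (by simp))
    ((hpr.contMDiff_op_smul g).contMDiffAt.mdifferentiableAt (by simp))] at h
  simp only [← hmk] at h
  exact h

include hact in
-- Both sides are the image, under `x ↦ [x, f]`, of the same horizontal vector of `P`.
lemma IsBundleManifold.horLift_eq {U' : Set B} {s' : B → P} (hs' : IsLocalSection EB EP pr U' s')
    {y : AssociatedBundle G P F} (hy : proj pr hpr.proj_smul y ∈ U)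
    (hy' : proj pr hpr.proj_smul y ∈ U') :
    horLift EF F EM hpr θ s y = horLift EF F EM hpr θ s' y := by
  ext u
  set b := proj pr hpr.proj_smul y
  -- The horizontal lift of `u` to `s b`: the derivative of the section minus its vertical part.
  set v : EP := tder 𝓘(ℝ, EB) 𝓘(ℝ, EP) s b u - rightGen G (s b) (θ.pullback s b u)
  have hv : θ.form (s b) v = 0 := by
    rw [map_sub, θ.form_rightGen]
    exact sub_self _
  have hpv : tder 𝓘(ℝ, EP) 𝓘(ℝ, EB) pr (s b) v = u := by
    rw [map_sub, hs.tder_proj hpr hy, hpr.tder_proj_rightGen, sub_zero]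
  have hyb : pr (s b) = b := hs.proj b hy
  have h1 := hM.tder_mk_eq_horLift hact θ hs (x := s b) (by rwa [hyb]) (fibreCoord pr s y) hv
  have h2 := hM.tder_mk_eq_horLift hact θ hs' (x := s b) (by rwa [hyb]) (fibreCoord pr s y) hv
  rw [h1, hpv, mk_fibreCoord hpr hs hy] at h2
  exact h2

variable {y : AssociatedBundle G P F} (hy : proj pr hpr.proj_smul y ∈ U)
include hy

lemma IsBundleManifold.tder_proj_horLift (u : EB) :
    tder 𝓘(ℝ, EM) 𝓘(ℝ, EB) (proj pr hpr.proj_smul) y (horLift EF F EM hpr θ s y u) = u := by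
  have h := hM.tder_proj_section hs hy (fibreCoord pr s y)
    (u, -leftGen G (fibreCoord pr s y) (θ.pullback s (proj pr hpr.proj_smul y) u))
  rw [mk_fibreCoord hpr hs hy] at h
  exact h

lemma IsBundleManifold.tder_fibreCoord_horLift (u : EB) :
    tder 𝓘(ℝ, EM) 𝓘(ℝ, EF) (fibreCoord pr s) y (horLift EF F EM hpr θ s y u) =
      -leftGen G (fibreCoord pr s y) (θ.pullback s (proj pr hpr.proj_smul y) u) := by
  have h := hM.tder_fibreCoord_section hs hy (fibreCoord pr s y)
    (u, -leftGen G (fibreCoord pr s y) (θ.pullback s (proj pr hpr.proj_smul y) u))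
  rw [mk_fibreCoord hpr hs hy] at h
  exact h

lemma IsBundleManifold.vertProj_horLift (u : EB) :
    vertProj EF F EM hpr θ s y (horLift EF F EM hpr θ s y u) = 0 := by
  rw [vertProj_apply, hM.tder_proj_horLift θ hs hy, hM.tder_fibreCoord_horLift θ hs hy,
    neg_add_cancel]

/-- The splitting of a tangent vector into a vertical and a horizontal part; the generator terms of
`vertProj` and `horLift` have opposite signs and cancel. -/
lemma IsBundleManifold.vertProj_add_horLift (v : EM) :
    tder 𝓘(ℝ, EF) 𝓘(ℝ, EM)
        (fun f : F ↦ AssociatedBundle.mk G (s (proj pr hpr.proj_smul y)) f)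
        (fibreCoord pr s y) (vertProj EF F EM hpr θ s y v) +
      horLift EF F EM hpr θ s y (tder 𝓘(ℝ, EM) 𝓘(ℝ, EB) (proj pr hpr.proj_smul) y v) = v := by
  rw [← hM.tder_section_apply hs hy, horLift_apply, ← map_add]
  conv_rhs => rw [← hM.tder_section_proj_fibreCoord hs hy v]
  rw [vertProj_apply, Prod.mk_add_mk]
  simp

end Splitting

/-! ### Smoothness criteria for fields of bilinear forms -/

section FormSmoothness

open Set Filter Topology

variable {E : Type*} [NormedAddCommGroup E] [NormedSpace ℝ E]
  {N : Type*} [TopologicalSpace N] [ChartedSpace E N] [IsManifold 𝓘(ℝ, E) ∞ N]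
  {EA HA : Type*} [NormedAddCommGroup EA] [NormedSpace ℝ EA] [TopologicalSpace HA]
  {IA : ModelWithCorners ℝ EA HA} {A : Type*} [TopologicalSpace A] [ChartedSpace HA A]

/-- The value of a 2-form at a point, as a bilinear map on the model space. -/
def TwoForm.form (α : TwoForm E N) (n : N) : E →L[ℝ] E →L[ℝ] ℝ := α.toFun n

lemma SmoothAlongAt.form₂ (α : TwoForm E N) {g : A → N} {v w : A → E} {a₀ : A}
    (hv : SmoothAlongAt IA 𝓘(ℝ, E) g v a₀) (hw : SmoothAlongAt IA 𝓘(ℝ, E) g w a₀) :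
    ContMDiffAt IA 𝓘(ℝ, ℝ) ∞ (fun a ↦ α.form (g a) (v a) (w a)) a₀ := by
  have : ContMDiffAt IA (𝓘(ℝ, E).prod 𝓘(ℝ, ℝ)) ∞
      (fun a ↦ TotalSpace.mk' ℝ (E := Bundle.Trivial N ℝ) (g a) (α.toFun (g a) (v a) (w a))) a₀ := by
    apply ContMDiffAt.clm_bundle_apply₂ (F₁ := E) (F₂ := E)
      (E₁ := (TangentSpace 𝓘(ℝ, E) : N → Type _)) (E₂ := (TangentSpace 𝓘(ℝ, E) : N → Type _))
    · exact ContMDiffAt.comp a₀ α.smooth.contMDiffAt hv.contMDiffAt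
    · exact hv
    · exact hw
  exact (contMDiffAt_totalSpace.1 this).2

/-- A linear map on a finite-dimensional space is the sum of its values on a basis, multiplied by
the coordinate functionals. -/
lemma contMDiffAt_of_forall_apply [FiniteDimensional ℝ E] {E' : Type*} [NormedAddCommGroup E']
    [NormedSpace ℝ E'] {L : A → E →L[ℝ] E'} {a₀ : A}
    (h : ∀ v, ContMDiffAt IA 𝓘(ℝ, E') ∞ (fun a ↦ L a v) a₀) :
    ContMDiffAt IA 𝓘(ℝ, E →L[ℝ] E') ∞ L a₀ := by
  set e := Module.finBasis ℝ E
  set c : ∀ i, E →L[ℝ] ℝ := fun i ↦ LinearMap.toContinuousLinearMap (e.coord i)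
  have hL : L = fun a ↦ ∑ i, ContinuousLinearMap.smulRightL ℝ E E' (c i) (L a (e i)) := by
    ext a v
    conv_lhs => rw [← e.sum_repr v, map_sum]
    simp [c]
  rw [hL]
  exact contMDiffAt_finsetSum fun i _ ↦ ContMDiffAt.comp a₀
    (ContinuousLinearMap.smulRightL ℝ E E' (c i)).contMDiff.contMDiffAt (h (e i))

/-- A field of bilinear forms is smooth if its values on smooth vector fields are smooth. -/
lemma contMDiffAt_form [FiniteDimensional ℝ E] {α : N → E →L[ℝ] E →L[ℝ] ℝ} {n₀ : N}
    (h : ∀ V W : N → E, SmoothAlongAt 𝓘(ℝ, E) 𝓘(ℝ, E) (fun n ↦ n) V n₀ →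
      SmoothAlongAt 𝓘(ℝ, E) 𝓘(ℝ, E) (fun n ↦ n) W n₀ →
      ContMDiffAt 𝓘(ℝ, E) 𝓘(ℝ, ℝ) ∞ (fun n ↦ α n (V n) (W n)) n₀) :
    ContMDiffAt 𝓘(ℝ, E) (𝓘(ℝ, E).prod 𝓘(ℝ, E →L[ℝ] E →L[ℝ] ℝ)) ∞
      (fun n ↦ TotalSpace.mk' (E →L[ℝ] E →L[ℝ] ℝ)
        (E := fun n : N ↦ TangentSpace 𝓘(ℝ, E) n →L[ℝ] TangentSpace 𝓘(ℝ, E) n →L[ℝ] ℝ) n (α n))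
      n₀ := by
  refine contMDiffAt_totalSpace.2 ⟨contMDiffAt_id, ?_⟩
  set t := trivializationAt E (TangentSpace 𝓘(ℝ, E) : N → Type _) n₀
  have ht : n₀ ∈ t.baseSet := FiberBundle.mem_baseSet_trivializationAt E _ n₀
  -- Vectors which are constant in the trivialization extend to smooth local fields, and the values
  -- of `α` on such fields are its components in the trivialization.
  have hframe : ∀ v : E, SmoothAlongAt 𝓘(ℝ, E) 𝓘(ℝ, E) (fun n : N ↦ n)
      (fun n ↦ (t.symm n v : TangentSpace 𝓘(ℝ, E) n)) n₀ := by
    intro v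
    have h1 : ContMDiffAt 𝓘(ℝ, E) 𝓘(ℝ, E).tangent ∞
        (fun n ↦ t.toOpenPartialHomeomorph.symm (n, v)) n₀ :=
      ContMDiffAt.comp n₀ (f := fun n : N ↦ (n, v))
        ((t.contMDiffOn_symm (n := ∞) (IB := 𝓘(ℝ, E))).contMDiffAt
          (t.open_target.mem_nhds (t.mem_target.2 ht)))
        (contMDiffAt_id.prodMk contMDiffAt_const)
    refine h1.congr_of_eventuallyEq ?_
    filter_upwards [t.open_baseSet.mem_nhds ht] with n hn
    exact t.mk_symm hn v
  refine contMDiffAt_of_forall_apply fun v ↦ contMDiffAt_of_forall_apply fun w ↦ ?_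
  refine (h _ _ (hframe v) (hframe w)).congr_of_eventuallyEq ?_
  filter_upwards [t.open_baseSet.mem_nhds ht] with n hn
  refine (inCoordinates_apply_eq₂ (F₃ := ℝ) (E₃ := Bundle.Trivial N ℝ) (ϕ := α n)
    hn hn ?_).trans ?_
  · exact mem_univ n
  · simp
    rfl

end FormSmoothness

/-! ### The induced connection and the vertical form -/

section BundleForm

open Set Filter Topology AssociatedBundle

variable {EG : Type*} [NormedAddCommGroup EG] [NormedSpace ℝ EG]
  {G : Type*} [TopologicalSpace G] [ChartedSpace EG G] [Group G] [LieGroup 𝓘(ℝ, EG) ∞ G]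
  {EB : Type*} [NormedAddCommGroup EB] [NormedSpace ℝ EB]
  {B : Type*} [TopologicalSpace B] [ChartedSpace EB B] [IsManifold 𝓘(ℝ, EB) ∞ B]
  {EP : Type*} [NormedAddCommGroup EP] [NormedSpace ℝ EP]
  {P : Type*} [TopologicalSpace P] [ChartedSpace EP P] [IsManifold 𝓘(ℝ, EP) ∞ P]
  [MulAction Gᵐᵒᵖ P]
  {EF : Type*} [NormedAddCommGroup EF] [NormedSpace ℝ EF]
  {F : Type*} [TopologicalSpace F] [ChartedSpace EF F] [IsManifold 𝓘(ℝ, EF) ∞ F] [MulAction G F]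
  {pr : P → B}
variable {EM : Type*} [NormedAddCommGroup EM] [NormedSpace ℝ EM]
  [ChartedSpace EM (AssociatedBundle G P F)] [IsManifold 𝓘(ℝ, EM) ∞ (AssociatedBundle G P F)]
  {EA HA : Type*} [NormedAddCommGroup EA] [NormedSpace ℝ EA] [TopologicalSpace HA]
  {IA : ModelWithCorners ℝ EA HA} {A : Type*} [TopologicalSpace A] [ChartedSpace HA A]

section

variable {hpr : IsPrincipalBundle EG G EP EB pr}
  (hact : ContMDiff (𝓘(ℝ, EG).prod 𝓘(ℝ, EF)) 𝓘(ℝ, EF) ∞ (fun y : G × F ↦ y.1 • y.2))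
  (hM : IsBundleManifold EG EB EP EF F EM hpr) (θ : PrincipalConnection EG G EP P)
  {U : Set B} {s : B → P} (hs : IsLocalSection EB EP pr U s)

include hact hM hs

lemma SmoothAlongAt.horLift {g : A → AssociatedBundle G P F} {u : A → EB} {a₀ : A}
    (hg : ContMDiffAt IA 𝓘(ℝ, EM) ∞ g a₀)
    (hu : SmoothAlongAt IA 𝓘(ℝ, EB) (fun a ↦ proj pr hpr.proj_smul (g a)) u a₀)
    (ha : proj pr hpr.proj_smul (g a₀) ∈ U) :
    SmoothAlongAt IA 𝓘(ℝ, EM) g (fun a ↦ _root_.horLift EF F EM hpr θ s (g a) (u a)) a₀ := by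
  have hτ : ContMDiffAt IA 𝓘(ℝ, EF) ∞ (fun a ↦ fibreCoord pr s (g a)) a₀ :=
    ContMDiffAt.comp a₀ (hM.smooth_fibreCoord U s hs _ ha) hg
  have h1 : SmoothAlongAt IA 𝓘(ℝ, EF) (fun a ↦ fibreCoord pr s (g a))
      (fun a ↦ -_root_.leftGen G (fibreCoord pr s (g a))
        (θ.pullback s (proj pr hpr.proj_smul (g a)) (u a))) a₀ := by
    simp only [← map_neg]
    exact SmoothAlongAt.leftGen hact hτ (by simpa only [map_neg] using (hu.pullback θ hs ha).neg)
  have h2 := (hu.prod h1).tder (Φ := fun z : B × F ↦ AssociatedBundle.mk G (s z.1) z.2)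
    (hM.smooth_section U s hs _ ha)
  refine h2.congr ?_ (Eventually.of_forall fun a ↦ rfl)
  filter_upwards [hg.continuousAt ((hs.isOpen.preimage (continuous_proj hpr)).mem_nhds ha)]
    with a ha
  exact (mk_fibreCoord hpr hs ha).symm

lemma SmoothAlongAt.vertProj {g : A → AssociatedBundle G P F} {v : A → EM} {a₀ : A}
    (hv : SmoothAlongAt IA 𝓘(ℝ, EM) g v a₀) (ha : proj pr hpr.proj_smul (g a₀) ∈ U) :
    SmoothAlongAt IA 𝓘(ℝ, EF) (fun a ↦ fibreCoord pr s (g a))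
      (fun a ↦ _root_.vertProj EF F EM hpr θ s (g a) (v a)) a₀ := by
  have h1 := hv.tder (hM.smooth_fibreCoord U s hs _ ha)
  have h2 := (hv.tder (hM.smooth_proj.contMDiffAt (x := g a₀))).pullback θ hs ha
  -- The two summands of `vertProj` are the two partial derivatives of the action map at `(1, τ)`,
  -- with `τ` the fibre coordinate; so their sum is one derivative along a map.
  have h3 := ((smoothAlongAt_const (n := (1 : G)).2 h2).prod h1).tder
    (hact.contMDiffAt (x := ((1 : G), fibreCoord pr s (g a₀))))
  refine h3.congr (Eventually.of_forall fun a ↦ (one_smul G _).symm)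
    (Eventually.of_forall fun a ↦ ?_)
  have h4 := tder_prod (p := ((1 : G), fibreCoord pr s (g a))) (f := fun y : G × F ↦ y.1 • y.2)
    (hact.contMDiffAt.mdifferentiableAt (by simp)) (θ.pullback s (proj pr hpr.proj_smul (g a))
      (_root_.tder 𝓘(ℝ, EM) 𝓘(ℝ, EB) (proj pr hpr.proj_smul) (g a) (v a)))
      (_root_.tder 𝓘(ℝ, EM) 𝓘(ℝ, EF) (fibreCoord pr s) (g a) (v a))
  simp only [one_smul, tder_id] at h4
  refine Eq.trans ?_ h4.symm
  exact (vertProj_apply θ s (g a) (v a)).trans (add_comm _ _)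

/-- Two local sections differ by an element of the group, and so do the vertical projections. -/
lemma IsBundleManifold.vertProj_eq_smul {U' : Set B} {s' : B → P}
    (hs' : IsLocalSection EB EP pr U' s') {y : AssociatedBundle G P F}
    (hy : proj pr hpr.proj_smul y ∈ U) (hy' : proj pr hpr.proj_smul y ∈ U') :
    ∃ g : G, fibreCoord pr s' y = g • fibreCoord pr s y ∧ ∀ v,
      _root_.vertProj EF F EM hpr θ s' y v = tder 𝓘(ℝ, EF) 𝓘(ℝ, EF) (fun f : F ↦ g • f)
        (fibreCoord pr s y) (_root_.vertProj EF F EM hpr θ s y v) := by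
  set b := proj pr hpr.proj_smul y with hb
  have hτ : ∀ f : F, fibreCoord pr s' (AssociatedBundle.mk G (s b) f) = groupCoord G pr s' (s b) • f :=
    fun f ↦ fibreCoord_mk hpr hs' (by rwa [hs.proj b hy]) f
  have hmk := mk_fibreCoord hpr hs hy
  have hg : fibreCoord pr s' y = groupCoord G pr s' (s b) • fibreCoord pr s y := by
    rw [← hτ, hmk]
  refine ⟨_, hg, fun v ↦ ?_⟩
  -- The horizontal part of `v` is the same for both sections and has no vertical projection. On
  -- vectors tangent to the fibre, the change of section is the derivative of `f ↦ g • f`.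
  conv_lhs => rw [← hM.vertProj_add_horLift θ hs hy v]
  rw [map_add, hM.horLift_eq hact θ hs hs' hy hy', hM.vertProj_horLift θ hs' hy', add_zero]
  set w := _root_.vertProj EF F EM hpr θ s y v
  have hι : MDifferentiableAt 𝓘(ℝ, EF) 𝓘(ℝ, EM) (fun f ↦ AssociatedBundle.mk G (s b) f)
      (fibreCoord pr s y) := (hM.contMDiff_mk_right hact (s b)).contMDiffAt.mdifferentiableAt (by simp)
  have h1 : tder 𝓘(ℝ, EM) 𝓘(ℝ, EB) (proj pr hpr.proj_smul) y
      (tder 𝓘(ℝ, EF) 𝓘(ℝ, EM) (fun f ↦ AssociatedBundle.mk G (s b) f) (fibreCoord pr s y) w) = 0 := by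
    have := tder_comp (g := proj pr hpr.proj_smul) (f := fun f ↦ AssociatedBundle.mk G (s b) f)
      (a := fibreCoord pr s y) (hM.smooth_proj.contMDiffAt.mdifferentiableAt (by simp)) hι w
    rw [hmk] at this
    rw [← this]
    simp only [proj_mk, tder_const]
    rfl
  have h2 := tder_comp (g := (fibreCoord pr s' : AssociatedBundle G P F → F))
    (f := fun f ↦ AssociatedBundle.mk G (s b) f)
    (a := fibreCoord pr s y) ((hM.smooth_fibreCoord U' s' hs' _
      (by rw [hmk]; exact hy')).mdifferentiableAt (by simp)) hι w
  simp only [hτ] at h2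
  rw [hmk] at h2
  rw [vertProj_apply, h1, h2, map_zero, map_zero, add_zero]

end

variable (hpr : IsPrincipalBundle EG G EP EB pr) (θ : PrincipalConnection EG G EP P)

include hpr in
lemma IsPrincipalBundle.exists_localSection_at (b : B) :
    ∃ (U : Set B) (s : B → P), IsLocalSection EB EP pr U s ∧ b ∈ U := by
  obtain ⟨e, he, -⟩ := hpr.locally_trivial b
  have hb : pr (e.toOpenPartialHomeomorph.symm (b, 1)) = b := e.proj_symm_apply (e.mem_target.2 he)
  obtain ⟨U, s, hs, hU, -⟩ := hpr.exists_localSection (e.toOpenPartialHomeomorph.symm (b, 1))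
  exact ⟨U, s, hs, hb ▸ hU⟩

/-- The domain of a smooth section near a point. -/
def IsPrincipalBundle.sectionDomain (b : B) : Set B := (hpr.exists_localSection_at b).choose

/-- A smooth section near a point. -/
def IsPrincipalBundle.sectionAt (b : B) : B → P := (hpr.exists_localSection_at b).choose_spec.choose

lemma IsPrincipalBundle.isLocalSection_sectionAt (b : B) :
    IsLocalSection EB EP pr (hpr.sectionDomain b) (hpr.sectionAt b) :=
  (hpr.exists_localSection_at b).choose_spec.choose_spec.1

lemma IsPrincipalBundle.mem_sectionDomain (b : B) : b ∈ hpr.sectionDomain b :=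
  (hpr.exists_localSection_at b).choose_spec.choose_spec.2

variable (EF F EM) in
/-- The horizontal lift to the associated bundle. -/
def bundleLift (y : AssociatedBundle G P F) : EB →L[ℝ] EM :=
  horLift EF F EM hpr θ (hpr.sectionAt (proj pr hpr.proj_smul y)) y

variable (EM) in
/-- The vertical form of the associated bundle, which vanishes on horizontal vectors. -/
def bundleForm (ωF : TwoForm EF F) (y : AssociatedBundle G P F) : EM →L[ℝ] EM →L[ℝ] ℝ :=
  (ωF.form (fibreCoord pr (hpr.sectionAt (proj pr hpr.proj_smul y)) y)).bilinearComp
    (vertProj EF F EM hpr θ (hpr.sectionAt (proj pr hpr.proj_smul y)) y)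
    (vertProj EF F EM hpr θ (hpr.sectionAt (proj pr hpr.proj_smul y)) y)

variable {hpr} (hM : IsBundleManifold EG EB EP EF F EM hpr) {U : Set B} {s : B → P}
  (hs : IsLocalSection EB EP pr U s)

include hM hs in
lemma IsBundleManifold.bundleLift_eq
    (hact : ContMDiff (𝓘(ℝ, EG).prod 𝓘(ℝ, EF)) 𝓘(ℝ, EF) ∞ (fun y : G × F ↦ y.1 • y.2))
    {y : AssociatedBundle G P F} (hy : proj pr hpr.proj_smul y ∈ U) :
    bundleLift EF F EM hpr θ y = horLift EF F EM hpr θ s y :=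
  hM.horLift_eq hact θ (hpr.isLocalSection_sectionAt _) hs (hpr.mem_sectionDomain _) hy

include hM hs in
-- A change of section moves the fibre coordinate and both vertical projections by one element of
-- `G`, and `G` preserves `ωF`. So the chosen section can be replaced by any other near a point.
lemma IsBundleManifold.bundleForm_eq {ωF : TwoForm EF F} (hω : IsSymplecticAction EG G ωF)
    {y : AssociatedBundle G P F} (hy : proj pr hpr.proj_smul y ∈ U) (v w : EM) :
    bundleForm EM hpr θ ωF y v w = ωF.form (fibreCoord pr s y)
      (vertProj EF F EM hpr θ s y v) (vertProj EF F EM hpr θ s y w) := by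
  obtain ⟨g, hg, hv⟩ := hM.vertProj_eq_smul hω.smooth_action θ hs
    (hpr.isLocalSection_sectionAt (proj pr hpr.proj_smul y)) hy (hpr.mem_sectionDomain _)
  rw [bundleForm, ContinuousLinearMap.bilinearComp_apply, hg, hv, hv]
  exact hω.invariant g _ _ _

/-- The connection of the associated bundle induced by a principal connection. -/
def bundleConnection
    (hact : ContMDiff (𝓘(ℝ, EG).prod 𝓘(ℝ, EF)) 𝓘(ℝ, EF) ∞ (fun y : G × F ↦ y.1 • y.2)) :
    EhresmannConnection EM EB (proj pr hpr.proj_smul : AssociatedBundle G P F → B) where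
  lift := bundleLift EF F EM hpr θ
  proj_lift y u := hM.tder_proj_horLift θ (hpr.isLocalSection_sectionAt _)
    (hpr.mem_sectionDomain _) u
  smooth_lift u hu := by
    intro y
    set b := proj pr hpr.proj_smul y
    have hs := hpr.isLocalSection_sectionAt b
    have hb := hpr.mem_sectionDomain b
    have h := SmoothAlongAt.horLift (IA := 𝓘(ℝ, EM)) (g := fun y ↦ y) (a₀ := y) hact hM θ hs
      (u := fun y ↦ u (proj pr hpr.proj_smul y)) contMDiffAt_id
      (ContMDiffAt.comp y hu.contMDiffAt hM.smooth_proj.contMDiffAt) hb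
    refine h.congr (Eventually.of_forall fun _ ↦ rfl) ?_
    filter_upwards [(hs.isOpen.preimage (continuous_proj hpr)).mem_nhds hb] with z hz
    exact DFunLike.congr_fun (hM.bundleLift_eq θ hs hact hz) _

lemma bundleConnection_isInduced
    (hact : ContMDiff (𝓘(ℝ, EG).prod 𝓘(ℝ, EF)) 𝓘(ℝ, EF) ∞ (fun y : G × F ↦ y.1 • y.2)) :
    IsInducedConnection (bundleConnection θ hM hact) θ := by
  intro x f v hv
  exact ⟨_, (hM.tder_mk_eq_horLift hact θ (hpr.isLocalSection_sectionAt _)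
    (hpr.mem_sectionDomain _) f hv).symm⟩

variable [FiniteDimensional ℝ EM] {ωF : TwoForm EF F} (hω : IsSymplecticAction EG G ωF)

/-- The vertical form, as a 2-form on the associated bundle. -/
def bundleTwoForm : TwoForm EM (AssociatedBundle G P F) where
  toFun := bundleForm EM hpr θ ωF
  alternating y v := ωF.alternating _ _
  smooth := by
    intro y
    set b := proj pr hpr.proj_smul y
    have hs := hpr.isLocalSection_sectionAt b
    have hb := hpr.mem_sectionDomain b
    refine contMDiffAt_form fun V W hV hW ↦ ?_
    refine (SmoothAlongAt.form₂ ωF (SmoothAlongAt.vertProj hω.smooth_action hM θ hs hV hb)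
      (SmoothAlongAt.vertProj hω.smooth_action hM θ hs hW hb)).congr_of_eventuallyEq ?_
    filter_upwards [(hs.isOpen.preimage (continuous_proj hpr)).mem_nhds hb] with z hz
    exact hM.bundleForm_eq θ hs hω hz _ _

include hs in
lemma bundleTwoForm_apply {y : AssociatedBundle G P F} (hy : proj pr hpr.proj_smul y ∈ U)
    (v w : EM) :
    (bundleTwoForm θ hM hω).form y v w = ωF.form (fibreCoord pr s y)
      (vertProj EF F EM hpr θ s y v) (vertProj EF F EM hpr θ s y w) :=
  hM.bundleForm_eq θ hs hω hy v w

end BundleForm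

/-! ### Exterior and Lie derivatives of 2-forms on the model spaces -/

section FormFormulas

variable {E : Type*} [NormedAddCommGroup E] [NormedSpace ℝ E]
  {N : Type*} [TopologicalSpace N] [ChartedSpace E N] [IsManifold 𝓘(ℝ, E) ∞ N]

lemma TwoForm.extDeriv_eq (α : TwoForm E N) (X Y Z : N → E) (n : N) :
    α.extDeriv X Y Z n =
      tder 𝓘(ℝ, E) 𝓘(ℝ, ℝ) (fun n ↦ α.form n (Y n) (Z n)) n (X n)
      - tder 𝓘(ℝ, E) 𝓘(ℝ, ℝ) (fun n ↦ α.form n (X n) (Z n)) n (Y n)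
      + tder 𝓘(ℝ, E) 𝓘(ℝ, ℝ) (fun n ↦ α.form n (X n) (Y n)) n (Z n)
      - α.form n (mBracket X Y n) (Z n) + α.form n (mBracket X Z n) (Y n)
      - α.form n (mBracket Y Z n) (X n) := rfl

lemma TwoForm.lieDeriv_eq (α : TwoForm E N) (X Y Z : N → E) (n : N) :
    α.lieDeriv X Y Z n =
      tder 𝓘(ℝ, E) 𝓘(ℝ, ℝ) (fun n ↦ α.form n (Y n) (Z n)) n (X n)
      - α.form n (mBracket X Y n) (Z n) - α.form n (Y n) (mBracket X Z n) := rfl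

end FormFormulas

/-! ### Restriction of the vertical form to the fibres: nondegeneracy and closedness -/

section VerticalForm

open Set Filter Topology AssociatedBundle

variable {EG : Type*} [NormedAddCommGroup EG] [NormedSpace ℝ EG]
  {G : Type*} [TopologicalSpace G] [ChartedSpace EG G] [Group G] [LieGroup 𝓘(ℝ, EG) ∞ G]
  {EB : Type*} [NormedAddCommGroup EB] [NormedSpace ℝ EB]
  {B : Type*} [TopologicalSpace B] [ChartedSpace EB B] [IsManifold 𝓘(ℝ, EB) ∞ B]
  {EP : Type*} [NormedAddCommGroup EP] [NormedSpace ℝ EP]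
  {P : Type*} [TopologicalSpace P] [ChartedSpace EP P] [IsManifold 𝓘(ℝ, EP) ∞ P]
  [MulAction Gᵐᵒᵖ P]
  {EF : Type*} [NormedAddCommGroup EF] [NormedSpace ℝ EF]
  {F : Type*} [TopologicalSpace F] [ChartedSpace EF F] [IsManifold 𝓘(ℝ, EF) ∞ F] [MulAction G F]
  {pr : P → B}
variable {EM : Type*} [NormedAddCommGroup EM] [NormedSpace ℝ EM]
  [ChartedSpace EM (AssociatedBundle G P F)] [IsManifold 𝓘(ℝ, EM) ∞ (AssociatedBundle G P F)]

variable {hpr : IsPrincipalBundle EG G EP EB pr}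
  (hM : IsBundleManifold EG EB EP EF F EM hpr) (θ : PrincipalConnection EG G EP P)
  {U : Set B} {s : B → P} (hs : IsLocalSection EB EP pr U s)

include hM hs in
lemma IsBundleManifold.tder_proj_tder_mk {b : B} (hb : b ∈ U) (f : F) (w : EF) :
    tder 𝓘(ℝ, EM) 𝓘(ℝ, EB) (proj pr hpr.proj_smul) (AssociatedBundle.mk G (s b) f)
      (tder 𝓘(ℝ, EF) 𝓘(ℝ, EM) (fun f ↦ AssociatedBundle.mk G (s b) f) f w) = 0 := by
  rw [← hM.tder_section_apply hs hb, hM.tder_proj_section hs hb]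

include hM hs in
lemma IsBundleManifold.vertProj_tder_mk {b : B} (hb : b ∈ U) (f : F) (w : EF) :
    vertProj EF F EM hpr θ s (AssociatedBundle.mk G (s b) f)
      (tder 𝓘(ℝ, EF) 𝓘(ℝ, EM) (fun f ↦ AssociatedBundle.mk G (s b) f) f w) = w := by
  rw [vertProj_apply, hM.tder_proj_tder_mk hs hb, map_zero, map_zero, add_zero,
    ← hM.tder_section_apply hs hb, hM.tder_fibreCoord_section hs hb]

include hM hs in
/-- A vertical vector comes from the fibre. -/
lemma IsBundleManifold.tder_mk_vertProj {b : B} (hb : b ∈ U) (f : F) {v : EM}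
    (hv : tder 𝓘(ℝ, EM) 𝓘(ℝ, EB) (proj pr hpr.proj_smul) (AssociatedBundle.mk G (s b) f) v = 0) :
    tder 𝓘(ℝ, EF) 𝓘(ℝ, EM) (fun f ↦ AssociatedBundle.mk G (s b) f) f
      (vertProj EF F EM hpr θ s (AssociatedBundle.mk G (s b) f) v) = v := by
  have hy : proj pr hpr.proj_smul (AssociatedBundle.mk G (s b) f) = b := hs.proj b hb
  have h := hM.vertProj_add_horLift θ hs (y := AssociatedBundle.mk G (s b) f) (by rwa [hy]) v
  rw [hv, map_zero, add_zero, hy, fibreCoord_mk_section hpr hs hb] at h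
  exact h

section

variable (hact : ContMDiff (𝓘(ℝ, EG).prod 𝓘(ℝ, EF)) 𝓘(ℝ, EF) ∞ (fun y : G × F ↦ y.1 • y.2))

include hpr in
lemma IsPrincipalBundle.exists_mk_section (y : AssociatedBundle G P F) :
    ∃ (U : Set B) (s : B → P) (b : B) (f : F), IsLocalSection EB EP pr U s ∧ b ∈ U ∧
      AssociatedBundle.mk G (s b) f = y := by
  obtain ⟨U, s, hs, hb⟩ := hpr.exists_localSection_at (proj pr hpr.proj_smul y)
  exact ⟨U, s, _, _, hs, hb, mk_fibreCoord hpr hs hb⟩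

include hM hs hact in
-- For a vertical field `X` this is its restriction to the fibre over `b`, carried over to `F`.
lemma IsBundleManifold.smoothAlongAt_fibreField {b : B} (hb : b ∈ U) {X : AssociatedBundle G P F → EM}
    {f : F} (hX : SmoothAlongAt 𝓘(ℝ, EM) 𝓘(ℝ, EM) (fun y : AssociatedBundle G P F ↦ y) X
      (AssociatedBundle.mk G (s b) f)) :
    SmoothAlongAt 𝓘(ℝ, EF) 𝓘(ℝ, EF) (fun f : F ↦ f) (fun f ↦ vertProj EF F EM hpr θ s
      (AssociatedBundle.mk G (s b) f) (X (AssociatedBundle.mk G (s b) f))) f := by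
  have h := SmoothAlongAt.vertProj hact hM θ hs (hX.comp (k := fun f ↦ AssociatedBundle.mk G (s b) f)
    (hM.contMDiff_mk_right hact (s b)).contMDiffAt) (a₀ := f) (by rwa [proj_mk, hs.proj b hb])
  exact h.congr (Eventually.of_forall fun f ↦ (fibreCoord_mk_section hpr hs hb f).symm)
    (Eventually.of_forall fun f ↦ rfl)

include hM hs hact in
/-- The bracket of vertical fields is computed on the fibres. -/
lemma IsBundleManifold.vertProj_mBracket {b : B} (hb : b ∈ U) {X Y : AssociatedBundle G P F → EM}
    {f : F} (hX : SmoothAlongAt 𝓘(ℝ, EM) 𝓘(ℝ, EM) (fun y : AssociatedBundle G P F ↦ y) X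
      (AssociatedBundle.mk G (s b) f))
    (hY : SmoothAlongAt 𝓘(ℝ, EM) 𝓘(ℝ, EM) (fun y : AssociatedBundle G P F ↦ y) Y
      (AssociatedBundle.mk G (s b) f))
    (hXv : ∀ y, tder 𝓘(ℝ, EM) 𝓘(ℝ, EB) (proj pr hpr.proj_smul) y (X y) = 0)
    (hYv : ∀ y, tder 𝓘(ℝ, EM) 𝓘(ℝ, EB) (proj pr hpr.proj_smul) y (Y y) = 0) :
    vertProj EF F EM hpr θ s (AssociatedBundle.mk G (s b) f)
      (mBracket X Y (AssociatedBundle.mk G (s b) f)) =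
    mBracket
      (fun f ↦ vertProj EF F EM hpr θ s
        (AssociatedBundle.mk G (s b) f) (X (AssociatedBundle.mk G (s b) f)))
      (fun f ↦ vertProj EF F EM hpr θ s
        (AssociatedBundle.mk G (s b) f) (Y (AssociatedBundle.mk G (s b) f))) f := by
  rw [← tder_mBracket_of_related (ψ := fun f ↦ AssociatedBundle.mk G (s b) f) (n₀ := f)
    (hM.contMDiff_mk_right hact (s b)).contMDiffAt
    (hM.smoothAlongAt_fibreField θ hs hact hb hX) (hM.smoothAlongAt_fibreField θ hs hact hb hY) hX hY
    (Eventually.of_forall fun f ↦ hM.tder_mk_vertProj θ hs hb f (hXv _))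
    (Eventually.of_forall fun f ↦ hM.tder_mk_vertProj θ hs hb f (hYv _)),
    hM.vertProj_tder_mk θ hs hb]

end

variable [FiniteDimensional ℝ EM] {ωF : TwoForm EF F} (hω : IsSymplecticAction EG G ωF)

lemma bundleTwoForm_isInduced : IsInducedForm (bundleTwoForm θ hM hω) ωF := by
  intro x f (v : EF) (w : EF)
  obtain ⟨U, s, hs, hU, hsx⟩ := hpr.exists_localSection x
  have h := bundleTwoForm_apply θ hM hs hω (y := AssociatedBundle.mk G (s (pr x)) f)
    (by rwa [proj_mk, hsx])
    (tder 𝓘(ℝ, EF) 𝓘(ℝ, EM) (fun f ↦ AssociatedBundle.mk G (s (pr x)) f) f v)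
    (tder 𝓘(ℝ, EF) 𝓘(ℝ, EM) (fun f ↦ AssociatedBundle.mk G (s (pr x)) f) f w)
  rw [hM.vertProj_tder_mk θ hs hU, hM.vertProj_tder_mk θ hs hU, fibreCoord_mk_section hpr hs hU,
    hsx] at h
  exact h

lemma bundleTwoForm_horizontal (y : AssociatedBundle G P F) (v : EM)
    (hv : v ∈ (bundleConnection θ hM hω.smooth_action).Hor y) (w : EM) :
    (bundleTwoForm θ hM hω).form y v w = 0 := by
  obtain ⟨u, rfl⟩ := hv
  have hs := hpr.isLocalSection_sectionAt (proj pr hpr.proj_smul y)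
  have hb := hpr.mem_sectionDomain (proj pr hpr.proj_smul y)
  refine (bundleTwoForm_apply θ hM hs hω hb _ _).trans ?_
  have h0 := hM.vertProj_horLift θ hs hb u
  refine (congrArg (fun z ↦ ωF.form _ z _) h0).trans ?_
  rw [map_zero]
  rfl

lemma bundleTwoForm_nondegenerate (y : AssociatedBundle G P F) (v : EM)
    (hv : tder 𝓘(ℝ, EM) 𝓘(ℝ, EB) (proj pr hpr.proj_smul) y v = 0)
    (h : ∀ w : EM, tder 𝓘(ℝ, EM) 𝓘(ℝ, EB) (proj pr hpr.proj_smul) y w = 0 →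
      (bundleTwoForm θ hM hω).form y v w = 0) : v = 0 := by
  obtain ⟨U, s, b, f, hs, hb, rfl⟩ := hpr.exists_mk_section y
  rw [← hM.tder_mk_vertProj θ hs hb f hv]
  have h0 : vertProj EF F EM hpr θ s (AssociatedBundle.mk G (s b) f) v
      = 0 := by
    refine hω.symplectic.nondegenerate f _ fun (w : EF) ↦ ?_
    have h1 := h _ (hM.tder_proj_tder_mk hs hb f w)
    rw [bundleTwoForm_apply θ hM hs hω (by rwa [proj_mk, hs.proj b hb]), hM.vertProj_tder_mk θ hs hb,
      fibreCoord_mk_section hpr hs hb] at h1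
    exact h1
  rw [h0, map_zero]

/-- Derivatives along vertical vectors and brackets of vertical fields can be computed on the fibre.
So the six terms of the invariant formula become those of `dωF` for the fields `r X`, `r Y`, `r Z`
on `F`. -/
lemma bundleTwoForm_verticallyClosed {X Y Z : AssociatedBundle G P F → EM}
    (hX : IsVerticalField EB (proj pr hpr.proj_smul) X)
    (hY : IsVerticalField EB (proj pr hpr.proj_smul) Y)
    (hZ : IsVerticalField EB (proj pr hpr.proj_smul) Z) (y : AssociatedBundle G P F) :
    (bundleTwoForm θ hM hω).extDeriv X Y Z y = 0 := by
  have hact := hω.smooth_action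
  obtain ⟨U, s, b, f, hs, hb, rfl⟩ := hpr.exists_mk_section y
  set r : (AssociatedBundle G P F → EM) → F → EF := fun X f ↦ vertProj EF F EM hpr θ s
    (AssociatedBundle.mk G (s b) f) (X (AssociatedBundle.mk G (s b) f))
  have hb' : ∀ f : F, proj pr hpr.proj_smul (AssociatedBundle.mk G (s b) f) ∈ U :=
    fun f ↦ by rwa [proj_mk, hs.proj b hb]
  have hd : ∀ {X Y Z : AssociatedBundle G P F → EM}, IsVerticalField EB (proj pr hpr.proj_smul) X →
      IsVerticalField EB (proj pr hpr.proj_smul) Y → IsVerticalField EB (proj pr hpr.proj_smul) Z →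
      tder 𝓘(ℝ, EM) 𝓘(ℝ, ℝ) (fun y ↦ (bundleTwoForm θ hM hω).form y (Y y) (Z y))
        (AssociatedBundle.mk G (s b) f) (X (AssociatedBundle.mk G (s b) f)) =
      tder 𝓘(ℝ, EF) 𝓘(ℝ, ℝ) (fun f ↦ ωF.form f (r Y f) (r Z f)) f (r X f) := by
    intro X Y Z hX hY hZ
    have h1 : (fun f ↦ ωF.form f (r Y f) (r Z f)) = fun f ↦ (fun y ↦
        (bundleTwoForm θ hM hω).form y (Y y) (Z y)) (AssociatedBundle.mk G (s b) f) := by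
      ext f
      refine Eq.trans ?_ (bundleTwoForm_apply θ hM hs hω (hb' f) _ _).symm
      rw [fibreCoord_mk_section hpr hs hb]
    rw [h1, tder_comp (IN := 𝓘(ℝ, EM)) (g := fun y ↦ (bundleTwoForm θ hM hω).form y (Y y) (Z y))
      (f := fun f ↦ AssociatedBundle.mk G (s b) f) ?_
      ((hM.contMDiff_mk_right hact (s b)).contMDiffAt.mdifferentiableAt (by simp)),
      hM.tder_mk_vertProj θ hs hb f (hX.2 _)]
    exact (SmoothAlongAt.form₂ (IA := 𝓘(ℝ, EM)) (bundleTwoForm θ hM hω)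
      (hY.1.contMDiffAt (x := AssociatedBundle.mk G (s b) f))
      (hZ.1.contMDiffAt (x := AssociatedBundle.mk G (s b) f))).mdifferentiableAt (by simp)
  have hbr : ∀ {X Y Z : AssociatedBundle G P F → EM}, IsVerticalField EB (proj pr hpr.proj_smul) X →
      IsVerticalField EB (proj pr hpr.proj_smul) Y → IsVerticalField EB (proj pr hpr.proj_smul) Z →
      (bundleTwoForm θ hM hω).form (AssociatedBundle.mk G (s b) f)
        (mBracket X Y (AssociatedBundle.mk G (s b) f)) (Z (AssociatedBundle.mk G (s b) f)) =
      ωF.form f (mBracket (r X) (r Y) f) (r Z f) := by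
    intro X Y Z hX hY hZ
    rw [bundleTwoForm_apply θ hM hs hω (hb' f), hM.vertProj_mBracket θ hs hact hb
      hX.1.contMDiffAt hY.1.contMDiffAt hX.2 hY.2, fibreCoord_mk_section hpr hs hb]
  have hr : ∀ {X : AssociatedBundle G P F → EM}, IsVerticalField EB (proj pr hpr.proj_smul) X →
      IsSmoothVectorField (r X) := fun {X} hX f ↦
    hM.smoothAlongAt_fibreField θ hs hact hb hX.1.contMDiffAt
  rw [TwoForm.extDeriv_eq, hd hX hY hZ, hd hY hX hZ, hd hZ hX hY, hbr hX hY hZ, hbr hX hZ hY,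
    hbr hY hZ hX]
  exact hω.symplectic.closed (r X) (r Y) (r Z) (hr hX) (hr hY) (hr hZ) f

end VerticalForm

/-! ### Elementary properties of the bracket -/

section BracketLemmas

open Set Filter Topology

variable {E : Type*} [NormedAddCommGroup E] [NormedSpace ℝ E]
  {N : Type*} [TopologicalSpace N] [ChartedSpace E N] [IsManifold 𝓘(ℝ, E) ∞ N]

lemma tder_chartAt_self (n : N) (v : E) : tder 𝓘(ℝ, E) 𝓘(ℝ, E) (chartAt E n) n v = v := by
  have h : mfderiv 𝓘(ℝ, E) 𝓘(ℝ, E) (extChartAt 𝓘(ℝ, E) n) n = ContinuousLinearMap.id ℝ E :=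
    mfderiv_extChartAt_self (I := 𝓘(ℝ, E)) (x := n)
  have h2 : ⇑(extChartAt 𝓘(ℝ, E) n) = chartAt E n := by simp [mfld_simps]
  rw [h2] at h
  exact congrArg (fun L : E →L[ℝ] E ↦ L v) h

lemma chartField_self (n : N) (V : N → E) : chartField n V (chartAt E n n) = V n := by
  rw [chartField, (chartAt E n).left_inv (mem_chart_source E n), tder_chartAt_self]

lemma mBracket_neg_neg (V W : N → E) (n : N) :
    mBracket (fun n ↦ -V n) (fun n ↦ -W n) n = mBracket V W n := by
  have h : ∀ V : N → E, chartField n (fun n ↦ -V n) = fun z ↦ -chartField n V z := fun V ↦ by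
    ext z
    simp [chartField]
  rw [mBracket_eq_lieBracket, mBracket_eq_lieBracket, h, h, lieBracket_eq, lieBracket_eq]
  simp [fderiv_fun_neg]

lemma mBracket_vectorSpace (V W : E → E) (z : E) : mBracket V W z = lieBracket ℝ V W z := by
  have h : ∀ V : E → E, chartField z V = V := fun V ↦ by
    ext y
    simp [chartField]
    exact tder_id _ _
  rw [mBracket_eq_lieBracket, h, h]
  rfl

end BracketLemmas

/-! ### The bracket of fundamental vector fields of a left action -/

section GeneratorBracket

open Set Filter Topology AssociatedBundle

variable {EG : Type*} [NormedAddCommGroup EG] [NormedSpace ℝ EG]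
  {G : Type*} [TopologicalSpace G] [ChartedSpace EG G] [Group G] [LieGroup 𝓘(ℝ, EG) ∞ G]
  {EB : Type*} [NormedAddCommGroup EB] [NormedSpace ℝ EB]
  {B : Type*} [TopologicalSpace B] [ChartedSpace EB B] [IsManifold 𝓘(ℝ, EB) ∞ B]
  {EP : Type*} [NormedAddCommGroup EP] [NormedSpace ℝ EP]
  {P : Type*} [TopologicalSpace P] [ChartedSpace EP P] [IsManifold 𝓘(ℝ, EP) ∞ P]
  [MulAction Gᵐᵒᵖ P]
  {EF : Type*} [NormedAddCommGroup EF] [NormedSpace ℝ EF]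
  {F : Type*} [TopologicalSpace F] [ChartedSpace EF F] [IsManifold 𝓘(ℝ, EF) ∞ F] [MulAction G F]
  {pr : P → B}

variable (G) in
/-- The left invariant vector field of an element of the Lie algebra. -/
def leftInvariantField (ξ : EG) (g : G) : EG := tder 𝓘(ℝ, EG) 𝓘(ℝ, EG) (fun k : G ↦ g * k) 1 ξ

lemma smoothAlongAt_leftInvariantField (ξ : EG) (g : G) :
    SmoothAlongAt 𝓘(ℝ, EG) 𝓘(ℝ, EG) (fun g : G ↦ g) (leftInvariantField G ξ) g := by
  have hm : ContMDiff (𝓘(ℝ, EG).prod 𝓘(ℝ, EG)) 𝓘(ℝ, EG) ∞ (fun p : G × G ↦ p.1 * p.2) :=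
    contMDiff_mul 𝓘(ℝ, EG) ∞
  have h := ((SmoothAlongAt.zero (IA := 𝓘(ℝ, EG)) (IN := 𝓘(ℝ, EG)) (g := fun g : G ↦ g) (a₀ := g)
    contMDiffAt_id).prod (smoothAlongAt_const (n := (1 : G)) (v := fun _ : G ↦ ξ) (a₀ := g)
    (IA := 𝓘(ℝ, EG)) |>.2 contMDiffAt_const)).tder (hm.contMDiffAt (x := (g, (1 : G))))
  refine h.congr (Eventually.of_forall fun g ↦ (mul_one g).symm) (Eventually.of_forall fun g ↦ ?_)
  exact (tder_prod_right (p := (g, (1 : G))) (hm.contMDiffAt.mdifferentiableAt (by simp)) ξ).symm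

variable (hact : ContMDiff (𝓘(ℝ, EG).prod 𝓘(ℝ, EF)) 𝓘(ℝ, EF) ∞ (fun y : G × F ↦ y.1 • y.2))

include hact

lemma smoothAlongAt_leftGen (ξ : EG) (f : F) :
    SmoothAlongAt 𝓘(ℝ, EF) 𝓘(ℝ, EF) (fun f : F ↦ f) (fun f ↦ leftGen G f ξ) f :=
  SmoothAlongAt.leftGen hact contMDiffAt_id contMDiffAt_const

lemma contMDiff_inv_smul (f : F) : ContMDiff 𝓘(ℝ, EG) 𝓘(ℝ, EF) ∞ (fun g : G ↦ g⁻¹ • f) :=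
  (contMDiff_smul_right hact f).comp (contMDiff_inv 𝓘(ℝ, EG) ∞)

/-- This differentiates `g • (g⁻¹ • f) = f` at `g = 1`. -/
lemma tder_inv_smul_one (f : F) (ξ : EG) :
    tder 𝓘(ℝ, EG) 𝓘(ℝ, EF) (fun g : G ↦ g⁻¹ • f) 1 ξ = -leftGen G f ξ := by
  have h := tder_comp (g := fun y : G × F ↦ y.1 • y.2) (f := fun g : G ↦ (g, g⁻¹ • f)) (a := 1)
    (hact.contMDiffAt.mdifferentiableAt (by simp)) (mdifferentiableAt_id.prodMk
      ((contMDiff_inv_smul hact f).contMDiffAt.mdifferentiableAt (by simp))) ξ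
  rw [tder_prodMk (f := fun g : G ↦ g) mdifferentiableAt_id
    ((contMDiff_inv_smul hact f).contMDiffAt.mdifferentiableAt (by simp)),
    tder_prod (hact.contMDiffAt.mdifferentiableAt (by simp))] at h
  simp only [smul_inv_smul, tder_const, inv_one, one_smul, tder_id] at h
  exact (neg_eq_of_add_eq_zero_right h.symm).symm

/-- As `(g * k)⁻¹ • f = k⁻¹ • (g⁻¹ • f)`, the map `g ↦ g⁻¹ • f` relates left invariant fields to
negatives of fundamental fields. -/
lemma tder_inv_smul_leftInvariantField (f : F) (ξ : EG) (g : G) :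
    tder 𝓘(ℝ, EG) 𝓘(ℝ, EF) (fun g : G ↦ g⁻¹ • f) g (leftInvariantField G ξ g) =
      -leftGen G (g⁻¹ • f) ξ := by
  have hm : MDifferentiableAt 𝓘(ℝ, EG) 𝓘(ℝ, EG) (fun k : G ↦ g * k) 1 :=
    (contMDiff_mul_left (I := 𝓘(ℝ, EG)) (n := ∞) (a := g)).contMDiffAt.mdifferentiableAt (by simp)
  have h := tder_comp (g := fun g : G ↦ g⁻¹ • f) (f := fun k : G ↦ g * k) (a := 1)
    ((contMDiff_inv_smul hact f).contMDiffAt.mdifferentiableAt (by simp)) hm ξ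
  rw [mul_one] at h
  rw [leftInvariantField, ← h, ← tder_inv_smul_one hact]
  simp only [mul_inv_rev, mul_smul]

omit hact in
variable (G) in
/-- The bracket of the Lie algebra of `G`, on the model space. -/
def lieAlgebraBracket (ξ η : EG) : EG :=
  Bracket.bracket (L := GroupLieAlgebra 𝓘(ℝ, EG) G) (M := GroupLieAlgebra 𝓘(ℝ, EG) G) ξ η

/-- The fundamental vector fields of a left action form an anti-homomorphism. -/
lemma mBracket_leftGen (ξ η : EG) (f : F) :
    mBracket (fun f ↦ leftGen G f ξ : F → EF) (fun f ↦ leftGen G f η) f =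
      -leftGen G f (lieAlgebraBracket G ξ η) := by
  -- The bracket of the Lie algebra is that of left invariant fields at `1`. On the side of `F` the
  -- two minus signs cancel in the bracket, and the derivative of `g ↦ g⁻¹ • f` at `1` leaves one.
  have h := tder_mBracket_of_related (ψ := fun g : G ↦ g⁻¹ • f) (n₀ := 1)
    (V := leftInvariantField G ξ) (W := leftInvariantField G η)
    (V' := fun f ↦ -leftGen G f ξ) (W' := fun f ↦ -leftGen G f η)
    (contMDiff_inv_smul hact f).contMDiffAt
    (smoothAlongAt_leftInvariantField _ _) (smoothAlongAt_leftInvariantField _ _)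
    (by simpa only [map_neg] using smoothAlongAt_leftGen hact (-ξ) _)
    (by simpa only [map_neg] using smoothAlongAt_leftGen hact (-η) _)
    (Eventually.of_forall fun g ↦ tder_inv_smul_leftInvariantField hact f ξ g)
    (Eventually.of_forall fun g ↦ tder_inv_smul_leftInvariantField hact f η g)
  rw [mBracket_neg_neg, tder_inv_smul_one hact, inv_one, one_smul] at h
  exact h.symm

end GeneratorBracket

/-! ### The associated bundle in coordinates on `EB × EF` -/

section Coordinates

open Set Filter Topology AssociatedBundle

variable {EG : Type*} [NormedAddCommGroup EG] [NormedSpace ℝ EG]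
  {G : Type*} [TopologicalSpace G] [ChartedSpace EG G] [Group G] [LieGroup 𝓘(ℝ, EG) ∞ G]
  {EB : Type*} [NormedAddCommGroup EB] [NormedSpace ℝ EB]
  {B : Type*} [TopologicalSpace B] [ChartedSpace EB B] [IsManifold 𝓘(ℝ, EB) ∞ B]
  {EP : Type*} [NormedAddCommGroup EP] [NormedSpace ℝ EP]
  {P : Type*} [TopologicalSpace P] [ChartedSpace EP P] [IsManifold 𝓘(ℝ, EP) ∞ P]
  [MulAction Gᵐᵒᵖ P]
  {EF : Type*} [NormedAddCommGroup EF] [NormedSpace ℝ EF]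
  {F : Type*} [TopologicalSpace F] [ChartedSpace EF F] [IsManifold 𝓘(ℝ, EF) ∞ F] [MulAction G F]
  {pr : P → B}
variable {EM : Type*} [NormedAddCommGroup EM] [NormedSpace ℝ EM]
  [ChartedSpace EM (AssociatedBundle G P F)] [IsManifold 𝓘(ℝ, EM) ∞ (AssociatedBundle G P F)]

variable (G EB EF) in
/-- The inverse of a chart of the associated bundle. -/
def bundleCoord (s : B → P) (b : B) (f : F) (z : EB × EF) : AssociatedBundle G P F :=
  AssociatedBundle.mk G (s ((chartAt EB b).symm z.1)) ((chartAt EF f).symm z.2)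

variable (EB EF) in
/-- The domain of `bundleCoord`. -/
def coordDomain (U : Set B) (b : B) (f : F) : Set (EB × EF) :=
  ((chartAt EB b).target ∩ (chartAt EB b).symm ⁻¹' U) ×ˢ (chartAt EF f).target

lemma bundleCoord_self (s : B → P) (b : B) (f : F) :
    bundleCoord G EB EF s b f (chartAt EB b b, chartAt EF f f) = AssociatedBundle.mk G (s b) f := by
  simp [bundleCoord]

lemma isOpen_coordDomain {U : Set B} (hU : IsOpen U) (b : B) (f : F) :
    IsOpen (coordDomain EB EF U b f) :=
  ((chartAt EB b).isOpen_inter_preimage_symm hU).prod (chartAt EF f).open_target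

lemma self_mem_coordDomain {U : Set B} {b : B} (hb : b ∈ U) (f : F) :
    (chartAt EB b b, chartAt EF f f) ∈ coordDomain EB EF U b f := by
  refine ⟨⟨mem_chart_target EB b, ?_⟩, mem_chart_target EF f⟩
  simpa using hb

lemma contMDiffAt_chart_symm_fst {b : B} {z : EB × EF} (hz : z.1 ∈ (chartAt EB b).target) :
    ContMDiffAt 𝓘(ℝ, EB × EF) 𝓘(ℝ, EB) ∞ (fun z : EB × EF ↦ (chartAt EB b).symm z.1) z :=
  ContMDiffAt.comp z (g := (chartAt EB b).symm) (f := Prod.fst) (contMDiffOn_chart_symm.contMDiffAt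
    ((chartAt EB b).open_target.mem_nhds hz)) contDiffAt_fst.contMDiffAt

lemma contMDiffAt_chart_symm_snd {f : F} {z : EB × EF} (hz : z.2 ∈ (chartAt EF f).target) :
    ContMDiffAt 𝓘(ℝ, EB × EF) 𝓘(ℝ, EF) ∞ (fun z : EB × EF ↦ (chartAt EF f).symm z.2) z :=
  ContMDiffAt.comp z (g := (chartAt EF f).symm) (f := Prod.snd) (contMDiffOn_chart_symm.contMDiffAt
    ((chartAt EF f).open_target.mem_nhds hz)) contDiffAt_snd.contMDiffAt

lemma tder_chart_symm_fst {b : B} {z : EB × EF} (hz : z.1 ∈ (chartAt EB b).target) (w : EB × EF) :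
    tder 𝓘(ℝ, EB × EF) 𝓘(ℝ, EB) (fun z : EB × EF ↦ (chartAt EB b).symm z.1) z w =
      tder 𝓘(ℝ, EB) 𝓘(ℝ, EB) (chartAt EB b).symm z.1 w.1 := by
  rw [tder_comp (IN := 𝓘(ℝ, EB)) (g := (chartAt EB b).symm) (f := Prod.fst)
    ((mdifferentiable_chart (I := 𝓘(ℝ, EB)) b).mdifferentiableAt_symm hz)
    differentiableAt_fst.mdifferentiableAt, tder_eq_fderiv, fderiv_fst]
  rfl

lemma tder_chart_symm_snd {f : F} {z : EB × EF} (hz : z.2 ∈ (chartAt EF f).target) (w : EB × EF) :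
    tder 𝓘(ℝ, EB × EF) 𝓘(ℝ, EF) (fun z : EB × EF ↦ (chartAt EF f).symm z.2) z w =
      tder 𝓘(ℝ, EF) 𝓘(ℝ, EF) (chartAt EF f).symm z.2 w.2 := by
  rw [tder_comp (IN := 𝓘(ℝ, EF)) (g := (chartAt EF f).symm) (f := Prod.snd)
    ((mdifferentiable_chart (I := 𝓘(ℝ, EF)) f).mdifferentiableAt_symm hz)
    differentiableAt_snd.mdifferentiableAt, tder_eq_fderiv, fderiv_snd]
  rfl

variable {hpr : IsPrincipalBundle EG G EP EB pr}
  (hM : IsBundleManifold EG EB EP EF F EM hpr) (θ : PrincipalConnection EG G EP P)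
  {U : Set B} {s : B → P} (hs : IsLocalSection EB EP pr U s)

include hM hs

lemma IsBundleManifold.contMDiffAt_bundleCoord {b : B} {f : F} {z : EB × EF}
    (hz : z ∈ coordDomain EB EF U b f) :
    ContMDiffAt 𝓘(ℝ, EB × EF) 𝓘(ℝ, EM) ∞ (bundleCoord G EB EF s b f) z :=
  ContMDiffAt.comp z (g := fun z : B × F ↦ AssociatedBundle.mk G (s z.1) z.2)
    (f := fun z : EB × EF ↦ ((chartAt EB b).symm z.1, (chartAt EF f).symm z.2))
    (hM.smooth_section U s hs ((chartAt EB b).symm z.1, (chartAt EF f).symm z.2) hz.1.2)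
    ((contMDiffAt_chart_symm_fst hz.1.1).prodMk (contMDiffAt_chart_symm_snd hz.2))

lemma IsBundleManifold.tder_bundleCoord {b : B} {f : F} {z : EB × EF}
    (hz : z ∈ coordDomain EB EF U b f) (w : EB × EF) :
    tder 𝓘(ℝ, EB × EF) 𝓘(ℝ, EM) (bundleCoord G EB EF s b f) z w =
      tder (𝓘(ℝ, EB).prod 𝓘(ℝ, EF)) 𝓘(ℝ, EM) (fun z : B × F ↦ AssociatedBundle.mk G (s z.1) z.2)
        ((chartAt EB b).symm z.1, (chartAt EF f).symm z.2)
        (tder 𝓘(ℝ, EB) 𝓘(ℝ, EB) (chartAt EB b).symm z.1 w.1,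
          tder 𝓘(ℝ, EF) 𝓘(ℝ, EF) (chartAt EF f).symm z.2 w.2) := by
  have h1 := (contMDiffAt_chart_symm_fst (EF := EF) hz.1.1).mdifferentiableAt (by simp)
  have h2 := (contMDiffAt_chart_symm_snd (EB := EB) hz.2).mdifferentiableAt (by simp)
  rw [← tder_chart_symm_fst hz.1.1, ← tder_chart_symm_snd hz.2, ← tder_prodMk h1 h2]
  exact tder_comp (g := fun z : B × F ↦ AssociatedBundle.mk G (s z.1) z.2)
    (f := fun z : EB × EF ↦ ((chartAt EB b).symm z.1, (chartAt EF f).symm z.2))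
    ((hM.smooth_section U s hs ((chartAt EB b).symm z.1, (chartAt EF f).symm z.2) hz.1.2
      ).mdifferentiableAt (by simp)) (h1.prodMk h2) w

/-- The coordinate representation of a vertical field. -/
lemma IsBundleManifold.tder_bundleCoord_vertical {b : B} {f : F} {z : EB × EF}
    (hz : z ∈ coordDomain EB EF U b f) {v : EM} (hv : tder 𝓘(ℝ, EM) 𝓘(ℝ, EB) (proj pr hpr.proj_smul)
      (bundleCoord G EB EF s b f z) v = 0) :
    tder 𝓘(ℝ, EB × EF) 𝓘(ℝ, EM) (bundleCoord G EB EF s b f) z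
      (0, tder 𝓘(ℝ, EF) 𝓘(ℝ, EF) (chartAt EF f) ((chartAt EF f).symm z.2)
        (vertProj EF F EM hpr θ s (bundleCoord G EB EF s b f z) v)) = v := by
  have h := tder_chart_symm_chart ((chartAt EF f).map_target hz.2)
    (vertProj EF F EM hpr θ s (bundleCoord G EB EF s b f z) v)
  rw [(chartAt EF f).right_inv hz.2] at h
  rw [hM.tder_bundleCoord hs hz, map_zero, h, hM.tder_section_apply hs hz.1.2]
  exact hM.tder_mk_vertProj θ hs hz.1.2 _ hv

/-- The coordinate representation of a horizontal lift. -/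
lemma IsBundleManifold.tder_bundleCoord_horLift {b : B} {f : F} {z : EB × EF}
    (hz : z ∈ coordDomain EB EF U b f) (u : B → EB) :
    tder 𝓘(ℝ, EB × EF) 𝓘(ℝ, EM) (bundleCoord G EB EF s b f) z
      (chartField b u z.1, -chartField f (fun f ↦ leftGen G f
        (θ.pullback s ((chartAt EB b).symm z.1) (u ((chartAt EB b).symm z.1)))) z.2) =
      horLift EF F EM hpr θ s (bundleCoord G EB EF s b f z)
        (u (proj pr hpr.proj_smul (bundleCoord G EB EF s b f z))) := by
  have hp : proj pr hpr.proj_smul (bundleCoord G EB EF s b f z) = (chartAt EB b).symm z.1 :=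
    hs.proj _ hz.1.2
  have hτ : fibreCoord pr s (bundleCoord G EB EF s b f z) = (chartAt EF f).symm z.2 :=
    fibreCoord_mk_section hpr hs hz.1.2 _
  rw [hM.tder_bundleCoord hs hz, tder_symm_chartField u hz.1.1, map_neg,
    tder_symm_chartField _ hz.2, horLift_apply, hp, hτ]

end Coordinates

/-! ### Brackets of horizontal and vertical fields on a product of normed spaces -/

section Calculus

open Set Filter Topology

variable {E₁ E₂ E₃ : Type*} [NormedAddCommGroup E₁] [NormedSpace ℝ E₁] [NormedAddCommGroup E₂]
  [NormedSpace ℝ E₂] [NormedAddCommGroup E₃] [NormedSpace ℝ E₃]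

lemma fderiv_horizontal {u : E₁ → E₁} {a : E₁ → E₃} {K : E₂ → E₃ →L[ℝ] E₂} {z : E₁ × E₂}
    (hu : DifferentiableAt ℝ u z.1) (ha : DifferentiableAt ℝ a z.1) (hK : DifferentiableAt ℝ K z.2)
    (w : E₁ × E₂) :
    fderiv ℝ (fun z : E₁ × E₂ ↦ (u z.1, -K z.2 (a z.1))) z w =
      (fderiv ℝ u z.1 w.1, -(fderiv ℝ K z.2 w.2 (a z.1) + K z.2 (fderiv ℝ a z.1 w.1))) := by
  have h1 := hu.hasFDerivAt.comp z (hasFDerivAt_fst (𝕜 := ℝ) (E := E₁) (F := E₂))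
  have h2 := ha.hasFDerivAt.comp z (hasFDerivAt_fst (𝕜 := ℝ) (E := E₁) (F := E₂))
  have h3 := hK.hasFDerivAt.comp z (hasFDerivAt_snd (𝕜 := ℝ) (E := E₁) (F := E₂))
  have h := (h1.prodMk (h3.clm_apply h2).neg).fderiv
  refine (congrArg (fun L : E₁ × E₂ →L[ℝ] E₁ × E₂ ↦ L w) h).trans ?_
  simp [add_comm]

/-- The model of a bracket of horizontal lifts: `K` stands for the generators of the action, `a` and
`c` for the connection form on `u` and `v`. By the product rule, derivatives of `K` give the bracket
of the generators with `a` and `c` frozen at `z.1`, and the other terms give the derivatives of `a`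
and `c`. -/
lemma lieBracket_horizontal {u v : E₁ → E₁} {a c : E₁ → E₃} {K : E₂ → E₃ →L[ℝ] E₂} {z : E₁ × E₂}
    (hu : DifferentiableAt ℝ u z.1) (ha : DifferentiableAt ℝ a z.1)
    (hv : DifferentiableAt ℝ v z.1) (hc : DifferentiableAt ℝ c z.1)
    (hK : DifferentiableAt ℝ K z.2) :
    lieBracket ℝ (fun z : E₁ × E₂ ↦ (u z.1, -K z.2 (a z.1)))
      (fun z : E₁ × E₂ ↦ (v z.1, -K z.2 (c z.1))) z =
      (lieBracket ℝ u v z.1, lieBracket ℝ (fun y ↦ K y (a z.1)) (fun y ↦ K y (c z.1)) z.2 -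
        K z.2 (fderiv ℝ c z.1 (u z.1) - fderiv ℝ a z.1 (v z.1))) := by
  have h : ∀ e w, fderiv ℝ (fun y ↦ K y e) z.2 w = fderiv ℝ K z.2 w e := fun e w ↦ by
    have := (hK.hasFDerivAt.clm_apply (hasFDerivAt_const e z.2)).fderiv
    refine (congrArg (fun L : E₂ →L[ℝ] E₂ ↦ L w) this).trans ?_
    simp
  simp only [lieBracket]
  rw [fderiv_horizontal hu ha hK, fderiv_horizontal hv hc hK, h, h]
  ext1
  · simp
  · simp
    abel

/-- Where the connection form vanishes, the derivative of `K` is multiplied by zero, and the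
derivative of `a` is taken along the zero base component of the vertical field. -/
lemma lieBracket_horizontal_vertical {u : E₁ → E₁} {a : E₁ → E₃} {K : E₂ → E₃ →L[ℝ] E₂}
    {x : E₁ × E₂ → E₂} {z : E₁ × E₂}
    (hu : DifferentiableAt ℝ u z.1) (ha : DifferentiableAt ℝ a z.1)
    (hK : DifferentiableAt ℝ K z.2) (hx : DifferentiableAt ℝ x z) (ha0 : a z.1 = 0) :
    lieBracket ℝ (fun z : E₁ × E₂ ↦ (u z.1, -K z.2 (a z.1)))
      (fun z : E₁ × E₂ ↦ ((0 : E₁), x z)) z = (0, fderiv ℝ x z (u z.1, 0)) := by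
  have h : ∀ w, fderiv ℝ (fun z : E₁ × E₂ ↦ ((0 : E₁), x z)) z w = (0, fderiv ℝ x z w) := fun w ↦ by
    have := ((hasFDerivAt_const (0 : E₁) z).prodMk hx.hasFDerivAt).fderiv
    refine (congrArg (fun L : E₁ × E₂ →L[ℝ] E₁ × E₂ ↦ L w) this).trans ?_
    simp
  simp only [lieBracket]
  rw [h, fderiv_horizontal hu ha hK, ha0]
  simp

end Calculus

/-! ### The curvature of the induced connection -/

section Curvature

open Set Filter Topology AssociatedBundle

variable {EG : Type*} [NormedAddCommGroup EG] [NormedSpace ℝ EG]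
  {G : Type*} [TopologicalSpace G] [ChartedSpace EG G] [Group G] [LieGroup 𝓘(ℝ, EG) ∞ G]
  {EB : Type*} [NormedAddCommGroup EB] [NormedSpace ℝ EB]
  {B : Type*} [TopologicalSpace B] [ChartedSpace EB B] [IsManifold 𝓘(ℝ, EB) ∞ B]
  {EP : Type*} [NormedAddCommGroup EP] [NormedSpace ℝ EP]
  {P : Type*} [TopologicalSpace P] [ChartedSpace EP P] [IsManifold 𝓘(ℝ, EP) ∞ P]
  [MulAction Gᵐᵒᵖ P]
  {EF : Type*} [NormedAddCommGroup EF] [NormedSpace ℝ EF]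
  {F : Type*} [TopologicalSpace F] [ChartedSpace EF F] [IsManifold 𝓘(ℝ, EF) ∞ F] [MulAction G F]
  {pr : P → B}

variable (G) in
/-- The generators of the action on the fibre, in a chart. -/
def genCoord (f : F) (z : EF) : EG →L[ℝ] EF :=
  (tder 𝓘(ℝ, EF) 𝓘(ℝ, EF) (chartAt EF f) ((chartAt EF f).symm z)).comp
    (leftGen G ((chartAt EF f).symm z))

lemma genCoord_apply (f : F) (z : EF) (ξ : EG) :
    genCoord G f z ξ = chartField f (fun f ↦ leftGen G f ξ : F → EF) z := rfl

lemma contDiffAt_genCoord [FiniteDimensional ℝ EG]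
    (hact : ContMDiff (𝓘(ℝ, EG).prod 𝓘(ℝ, EF)) 𝓘(ℝ, EF) ∞ (fun y : G × F ↦ y.1 • y.2)) {f f' : F}
    (hf : f' ∈ (chartAt EF f).source) :
    ContDiffAt ℝ ∞ (genCoord (EG := EG) G f) (chartAt EF f f') :=
  (contMDiffAt_of_forall_apply fun ξ ↦
    (contDiffAt_chartField hf (smoothAlongAt_leftGen hact ξ f')).contMDiffAt).contDiffAt

/-- The local curvature form, on the model spaces. -/
def PrincipalConnection.curvatureForm (θ : PrincipalConnection EG G EP P) (s : B → P) (u v : B → EB)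
    (b : B) : EG :=
  tder 𝓘(ℝ, EB) 𝓘(ℝ, EG) (fun b ↦ θ.pullback s b (v b)) b (u b)
    - tder 𝓘(ℝ, EB) 𝓘(ℝ, EG) (fun b ↦ θ.pullback s b (u b)) b (v b)
    - θ.pullback s b (mBracket u v b)
    + lieAlgebraBracket G (θ.pullback s b (u b)) (θ.pullback s b (v b))

lemma fderiv_comp_chart_symm {E' : Type*} [NormedAddCommGroup E'] [NormedSpace ℝ E'] {k : B → E'}
    {b : B} (hk : MDifferentiableAt 𝓘(ℝ, EB) 𝓘(ℝ, E') k b) (w : EB) :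
    fderiv ℝ (fun z ↦ k ((chartAt EB b).symm z)) (chartAt EB b b) w =
      tder 𝓘(ℝ, EB) 𝓘(ℝ, E') k b w := by
  have hb : (chartAt EB b).symm (chartAt EB b b) = b := (chartAt EB b).left_inv (mem_chart_source EB b)
  have h := tder_chart_symm_chart (mem_chart_source EB b) w
  rw [tder_chartAt_self] at h
  rw [← tder_eq_fderiv, tder_comp (IN := 𝓘(ℝ, EB)) (g := k) (f := (chartAt EB b).symm) (by rwa [hb])
    ((mdifferentiable_chart (I := 𝓘(ℝ, EB)) b).mdifferentiableAt_symm (mem_chart_target EB b)), hb, h]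

lemma contDiffAt_comp_chart_symm {E' : Type*} [NormedAddCommGroup E'] [NormedSpace ℝ E'] {k : B → E'}
    {b : B} (hk : ContMDiffAt 𝓘(ℝ, EB) 𝓘(ℝ, E') ∞ k b) :
    ContDiffAt ℝ ∞ (fun z ↦ k ((chartAt EB b).symm z)) (chartAt EB b b) := by
  have hb : (chartAt EB b).symm (chartAt EB b b) = b := (chartAt EB b).left_inv (mem_chart_source EB b)
  refine (ContMDiffAt.comp _ (g := k) (f := (chartAt EB b).symm) (by rwa [hb])
    (contMDiffOn_chart_symm.contMDiffAt
      ((chartAt EB b).open_target.mem_nhds (mem_chart_target EB b)))).contDiffAt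

variable {EM : Type*} [NormedAddCommGroup EM] [NormedSpace ℝ EM]
  [ChartedSpace EM (AssociatedBundle G P F)] [IsManifold 𝓘(ℝ, EM) ∞ (AssociatedBundle G P F)]
  {hpr : IsPrincipalBundle EG G EP EB pr}
  (hact : ContMDiff (𝓘(ℝ, EG).prod 𝓘(ℝ, EF)) 𝓘(ℝ, EF) ∞ (fun y : G × F ↦ y.1 • y.2))
  (hM : IsBundleManifold EG EB EP EF F EM hpr) (θ : PrincipalConnection EG G EP P)
  {U : Set B} {s : B → P} (hs : IsLocalSection EB EP pr U s) {b : B} (hb : b ∈ U) (f : F)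

include hM hs hb in
lemma IsBundleManifold.tder_bundleCoord_self (w : EB × EF) :
    tder 𝓘(ℝ, EB × EF) 𝓘(ℝ, EM) (bundleCoord G EB EF s b f) (chartAt EB b b, chartAt EF f f) w =
      tder (𝓘(ℝ, EB).prod 𝓘(ℝ, EF)) 𝓘(ℝ, EM)
        (fun z : B × F ↦ AssociatedBundle.mk G (s z.1) z.2) (b, f) w := by
  have h1 := tder_chart_symm_chart (mem_chart_source EB b) w.1
  have h2 := tder_chart_symm_chart (mem_chart_source EF f) w.2
  rw [tder_chartAt_self] at h1 h2
  rw [hM.tder_bundleCoord hs (self_mem_coordDomain hb f), h1, h2]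
  simp

variable (G EF) in
/-- The coordinate representation of a horizontal lift. -/
def horCoord (s : B → P) (b : B) (f : F) (u : B → EB) (z : EB × EF) : EB × EF :=
  (chartField b u z.1, -genCoord G f z.2
    (θ.pullback s ((chartAt EB b).symm z.1) (u ((chartAt EB b).symm z.1))))

lemma horCoord_self (u : B → EB) :
    horCoord G EF θ s b f u (chartAt EB b b, chartAt EF f f) =
      (u b, -leftGen G f (θ.pullback s b (u b))) := by
  rw [horCoord, genCoord_apply, chartField_self, chartField_self]
  simp

section

variable {u : B → EB} (hu : SmoothAlongAt 𝓘(ℝ, EB) 𝓘(ℝ, EB) (fun b : B ↦ b) u b)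
include hs hb hu

lemma contDiffAt_pullback_chart :
    ContDiffAt ℝ ∞ (fun z ↦ θ.pullback s ((chartAt EB b).symm z) (u ((chartAt EB b).symm z)))
      (chartAt EB b b) :=
  contDiffAt_comp_chart_symm (hu.pullback θ hs hb)

include hact in
lemma smoothAlongAt_horCoord [FiniteDimensional ℝ EG] :
    SmoothAlongAt 𝓘(ℝ, EB × EF) 𝓘(ℝ, EB × EF) (fun z ↦ z) (horCoord G EF θ s b f u)
      (chartAt EB b b, chartAt EF f f) := by
  refine smoothAlongAt_vectorSpace.2 ⟨contMDiffAt_id, ContDiffAt.contMDiffAt ?_⟩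
  refine ContDiffAt.prodMk ?_ (ContDiffAt.neg (ContDiffAt.clm_apply ?_ ?_))
  · exact ContDiffAt.comp (g := chartField b u) (chartAt EB b b, chartAt EF f f)
      (contDiffAt_chartField (mem_chart_source EB b) hu) contDiffAt_fst
  · exact ContDiffAt.comp (g := genCoord G f) (chartAt EB b b, chartAt EF f f)
      (contDiffAt_genCoord hact (mem_chart_source EF f)) contDiffAt_snd
  · exact ContDiffAt.comp (g := fun z ↦ θ.pullback s ((chartAt EB b).symm z)
      (u ((chartAt EB b).symm z))) (chartAt EB b b, chartAt EF f f)
      (contDiffAt_pullback_chart θ hs hb hu) contDiffAt_fst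

end

include hM hs hb in
lemma IsBundleManifold.eventually_horCoord (u : B → EB) :
    ∀ᶠ z in 𝓝 (chartAt EB b b, chartAt EF f f), tder 𝓘(ℝ, EB × EF) 𝓘(ℝ, EM)
      (bundleCoord G EB EF s b f) z (horCoord G EF θ s b f u z) =
        (bundleConnection θ hM hact).liftField u (bundleCoord G EB EF s b f z) := by
  filter_upwards [(isOpen_coordDomain hs.isOpen b f).mem_nhds (self_mem_coordDomain hb f)] with z hz
  refine (hM.tder_bundleCoord_horLift θ hs hz u).trans ?_
  have hp : proj pr hpr.proj_smul (bundleCoord G EB EF s b f z) ∈ U := by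
    refine mem_of_eq_of_mem (hs.proj _ hz.1.2) hz.1.2
  exact (DFunLike.congr_fun (hM.bundleLift_eq θ hs hact hp) _).symm

include hs hb in
/-- The curvature of the induced connection is given by the local curvature forms. -/
theorem IsBundleManifold.curvature_mk [FiniteDimensional ℝ EG] {u v : B → EB}
    (hu : IsSmoothVectorField u) (hv : IsSmoothVectorField v) :
    (bundleConnection θ hM hact).curvature u v (AssociatedBundle.mk G (s b) f) =
      tder 𝓘(ℝ, EF) 𝓘(ℝ, EM) (fun f ↦ AssociatedBundle.mk G (s b) f) f
        (-leftGen G f (θ.curvatureForm s u v b)) := by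
  set z₀ := (chartAt EB b b, chartAt EF f f)
  have hz₀ : bundleCoord G EB EF s b f z₀ = AssociatedBundle.mk G (s b) f := bundleCoord_self s b f
  have hlift : ∀ {u : B → EB}, IsSmoothVectorField u → SmoothAlongAt 𝓘(ℝ, EM) 𝓘(ℝ, EM)
      (fun y : AssociatedBundle G P F ↦ y) ((bundleConnection θ hM hact).liftField u)
      (bundleCoord G EB EF s b f z₀) := fun {u} hu ↦
    ((bundleConnection θ hM hact).smooth_lift u hu).contMDiffAt
  -- The coordinate fields `horCoord` are related to the horizontal lifts, so the bracket of the
  -- lifts is computed on `EB × EF`.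
  have h := tder_mBracket_of_related
    (hM.contMDiffAt_bundleCoord hs (self_mem_coordDomain hb f))
    (smoothAlongAt_horCoord hact θ hs hb f hu.contMDiffAt)
    (smoothAlongAt_horCoord hact θ hs hb f hv.contMDiffAt) (hlift hu) (hlift hv)
    (hM.eventually_horCoord hact θ hs hb f u) (hM.eventually_horCoord hact θ hs hb f v)
  have hd : ∀ {u : B → EB}, IsSmoothVectorField u → DifferentiableAt ℝ (chartField b u) z₀.1 :=
    fun hu ↦ (contDiffAt_chartField (mem_chart_source EB b) hu.contMDiffAt).differentiableAt (by simp)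
  have ha : ∀ {u : B → EB}, IsSmoothVectorField u → DifferentiableAt ℝ
      (fun z ↦ θ.pullback s ((chartAt EB b).symm z) (u ((chartAt EB b).symm z))) z₀.1 :=
    fun hu ↦ (contDiffAt_pullback_chart θ hs hb hu.contMDiffAt).differentiableAt (by simp)
  have hda : ∀ {u : B → EB}, IsSmoothVectorField u → ∀ w, fderiv ℝ
      (fun z ↦ θ.pullback s ((chartAt EB b).symm z) (u ((chartAt EB b).symm z))) z₀.1 w =
      tder 𝓘(ℝ, EB) 𝓘(ℝ, EG) (fun b ↦ θ.pullback s b (u b)) b w := fun {u} hu w ↦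
    fderiv_comp_chart_symm (k := fun b ↦ θ.pullback s b (u b))
      ((SmoothAlongAt.pullback θ hs hu.contMDiffAt hb).mdifferentiableAt (by simp)) w
  have hbr := lieBracket_horizontal (hd hu) (ha hu) (hd hv) (ha hv)
    ((contDiffAt_genCoord hact (mem_chart_source EF f)).differentiableAt (by simp))
  -- The anti-homomorphism sign makes the bracket of the generators enter with the same sign as the
  -- derivatives of the connection form.
  have hK : ∀ ξ η : EG, lieBracket ℝ (fun y ↦ genCoord G f y ξ) (fun y ↦ genCoord G f y η) z₀.2 =
      -leftGen G f (lieAlgebraBracket G ξ η) := fun ξ η ↦ by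
    rw [← mBracket_leftGen hact, mBracket_eq_lieBracket]
    rfl
  have hb' : (chartAt EB b).symm z₀.1 = b := (chartAt EB b).left_inv (mem_chart_source EB b)
  have hg : ∀ ξ : EG, genCoord G f z₀.2 ξ = leftGen G f ξ := fun ξ ↦
    chartField_self f (fun f ↦ leftGen G f ξ : F → EF)
  have hû : ∀ u : B → EB, chartField b u z₀.1 = u b := fun u ↦ chartField_self b u
  rw [← mBracket_eq_lieBracket, hda hu, hda hv, hû, hû, hK, hg, hb'] at hbr
  rw [mBracket_vectorSpace, hM.tder_bundleCoord_self hs hb] at h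
  replace h := (congrArg _ hbr).symm.trans h
  rw [hz₀] at h
  have hy : proj pr hpr.proj_smul (AssociatedBundle.mk G (s b) f) = b := hs.proj b hb
  -- Subtracting the lift of `[u, v]` removes the base component and supplies the term `a([u, v])`.
  have hl : bundleLift EF F EM hpr θ (AssociatedBundle.mk G (s b) f)
      (mBracket u v (proj pr hpr.proj_smul (AssociatedBundle.mk G (s b) f))) =
      tder (𝓘(ℝ, EB).prod 𝓘(ℝ, EF)) 𝓘(ℝ, EM)
        (fun z : B × F ↦ AssociatedBundle.mk G (s z.1) z.2) (b, f)
        (mBracket u v b, -leftGen G f (θ.pullback s b (mBracket u v b))) := by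
    refine (DFunLike.congr_fun (hM.bundleLift_eq θ hs hact (mem_of_eq_of_mem hy hb)) _).trans ?_
    rw [horLift_apply, hy, fibreCoord_mk_section hpr hs hb]
  refine (congrArg₂ (fun x y : EM ↦ x - y) h.symm hl).trans ?_
  rw [← map_sub, ← hM.tder_section_apply hs hb]
  refine congrArg _ (Prod.ext (sub_self _) ?_)
  simp only [PrincipalConnection.curvatureForm, Prod.snd_sub, map_sub, map_add]
  abel

end Curvature

/-! ### Sections whose connection form vanishes at a point -/

section NormalizedSection

open Set Filter Topology AssociatedBundle

variable {EG : Type*} [NormedAddCommGroup EG] [NormedSpace ℝ EG]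
  {G : Type*} [TopologicalSpace G] [ChartedSpace EG G] [Group G] [LieGroup 𝓘(ℝ, EG) ∞ G]
  {EB : Type*} [NormedAddCommGroup EB] [NormedSpace ℝ EB]
  {B : Type*} [TopologicalSpace B] [ChartedSpace EB B] [IsManifold 𝓘(ℝ, EB) ∞ B]
  {EP : Type*} [NormedAddCommGroup EP] [NormedSpace ℝ EP]
  {P : Type*} [TopologicalSpace P] [ChartedSpace EP P] [IsManifold 𝓘(ℝ, EP) ∞ P]
  [MulAction Gᵐᵒᵖ P]
  {EF : Type*} [NormedAddCommGroup EF] [NormedSpace ℝ EF]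
  {F : Type*} [TopologicalSpace F] [ChartedSpace EF F] [IsManifold 𝓘(ℝ, EF) ∞ F] [MulAction G F]
  {pr : P → B}

/-- A section through a given fibre whose local connection form vanishes at the given point. -/
lemma IsPrincipalBundle.exists_localSection_pullback_eq_zero
    (hpr : IsPrincipalBundle EG G EP EB pr) (θ : PrincipalConnection EG G EP P) (b : B) :
    ∃ (U : Set B) (s : B → P), IsLocalSection EB EP pr U s ∧ b ∈ U ∧ θ.pullback (EB := EB) s b = 0 := by
  obtain ⟨U, s, hs, hb⟩ := hpr.exists_localSection_at b
  set c := chartAt EG (1 : G)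
  -- The section is multiplied by the group-valued map `c.symm ∘ q`, which is `1` at `b` and has
  -- derivative `-a` there; `q` is affine in the base chart. At `b` this changes the local
  -- connection form `a` into `a - a = 0`.
  set q : B → EG := fun b' ↦ c 1 - θ.pullback s b (chartAt EB b b' - chartAt EB b b)
  have hq1 : q b = c 1 := by simp [q]
  have hcb : ContMDiffOn 𝓘(ℝ, EB) 𝓘(ℝ, EB) ∞ (chartAt EB b) (chartAt EB b).source :=
    contMDiffOn_chart
  have hq : ContMDiffOn 𝓘(ℝ, EB) 𝓘(ℝ, EG) ∞ q (chartAt EB b).source :=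
    contMDiffOn_const.sub ((θ.pullback s b).contMDiff.comp_contMDiffOn (hcb.sub contMDiffOn_const))
  set U' := U ∩ ((chartAt EB b).source ∩ q ⁻¹' c.target)
  have hU' : IsOpen U' :=
    hs.isOpen.inter (hq.continuousOn.isOpen_inter_preimage (chartAt EB b).open_source c.open_target)
  have hbU' : b ∈ U' := ⟨hb, mem_chart_source EB b, by
    rw [mem_preimage, hq1]; exact mem_chart_target EG 1⟩
  have hg : ContMDiffOn 𝓘(ℝ, EB) 𝓘(ℝ, EG) ∞ (fun b' ↦ c.symm (q b')) U' :=
    (contMDiffOn_chart_symm (x := (1 : G))).comp (hq.mono fun x hx ↦ hx.2.1) fun x hx ↦ hx.2.2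
  have hs' : ContMDiffOn 𝓘(ℝ, EB) 𝓘(ℝ, EP) ∞ (fun b' ↦ op (c.symm (q b')) • s b') U' :=
    hpr.smooth_action.comp_contMDiffOn ((hs.smooth.mono inter_subset_left).prodMk hg)
  refine ⟨U', _, ⟨hU', hs', fun b' hb' ↦ ?_⟩, hbU', ?_⟩
  · rw [hpr.proj_smul, hs.proj _ hb'.1]
  have hg1 : c.symm (q b) = 1 := by rw [hq1]; exact c.left_inv (mem_chart_source EG 1)
  have hgd : MDifferentiableAt 𝓘(ℝ, EB) 𝓘(ℝ, EG) (fun b' ↦ c.symm (q b')) b :=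
    (hg.contMDiffAt (hU'.mem_nhds hbU')).mdifferentiableAt (by simp)
  have hsd : MDifferentiableAt 𝓘(ℝ, EB) 𝓘(ℝ, EP) s b :=
    (hs.contMDiffAt hb).mdifferentiableAt (by simp)
  have hqd : MDifferentiableAt 𝓘(ℝ, EB) 𝓘(ℝ, EG) q b :=
    (hq.contMDiffAt ((chartAt EB b).open_source.mem_nhds (mem_chart_source EB b))).mdifferentiableAt
      (by simp)
  have hcbd : MDifferentiableAt 𝓘(ℝ, EB) 𝓘(ℝ, EB) (chartAt EB b) b :=
    (mdifferentiable_chart (I := 𝓘(ℝ, EB)) b).mdifferentiableAt (mem_chart_source EB b)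
  have hdg : ∀ u, tder 𝓘(ℝ, EB) 𝓘(ℝ, EG) (fun b' ↦ c.symm (q b')) b u = -θ.pullback s b u := by
    intro u
    have h1 := tder_chart_symm_chart (mem_chart_source EG (1 : G))
    simp only [tder_chartAt_self] at h1
    rw [tder_comp (IN := 𝓘(ℝ, EG)) (g := c.symm) (f := q) (by
      rw [hq1]; exact (mdifferentiable_chart (I := 𝓘(ℝ, EG)) (1 : G)).mdifferentiableAt_symm
        (mem_chart_target EG 1)) hqd, hq1, h1]
    have h2 := tder_comp (IN := 𝓘(ℝ, EB)) (IM := 𝓘(ℝ, EG))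
      (g := fun z ↦ c 1 - θ.pullback s b (z - chartAt EB b b)) (f := chartAt EB b) (a := b)
      (DifferentiableAt.mdifferentiableAt (by fun_prop)) hcbd u
    refine h2.trans ?_
    rw [tder_chartAt_self, tder_eq_fderiv]
    have h3 : HasFDerivAt (fun z ↦ c 1 - θ.pullback s b (z - chartAt EB b b)) (-θ.pullback s b)
        (chartAt EB b b) := by
      have := ((θ.pullback s b).hasFDerivAt.comp (chartAt EB b b)
        ((hasFDerivAt_id (𝕜 := ℝ) (chartAt EB b b)).sub_const (chartAt EB b b))).const_sub (c 1)
      simpa using this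
    rw [h3.fderiv]
    rfl
  ext u
  have h := tder_comp (g := fun y : P × G ↦ op y.2 • y.1) (f := fun b' ↦ (s b', c.symm (q b')))
    (a := b) (hpr.smooth_action.contMDiffAt.mdifferentiableAt (by simp)) (hsd.prodMk hgd) u
  rw [tder_prodMk hsd hgd, tder_prod (hpr.smooth_action.contMDiffAt.mdifferentiableAt (by simp))] at h
  simp only [hg1, op_one, one_smul, tder_id] at h
  rw [PrincipalConnection.pullback, ContinuousLinearMap.comp_apply, h]
  simp only [hg1, op_one, one_smul, map_add, hdg]
  have h5 := θ.form_rightGen (s b) (-θ.pullback s b u)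
  refine (congrArg _ h5).trans ?_
  exact add_neg_cancel _

end NormalizedSection

/-! ### Derivatives along straight lines -/

section Line

variable {E E' : Type*} [NormedAddCommGroup E] [NormedSpace ℝ E] [NormedAddCommGroup E']
  [NormedSpace ℝ E']

lemma hasDerivAt_line (z w : E) : HasDerivAt (fun t : ℝ ↦ z + t • w) w 0 := by
  simpa using ((hasDerivAt_id (0 : ℝ)).smul_const w).const_add z

lemma ContDiffAt.hasDerivAt_line {k : E → E'} {z : E} (hk : ContDiffAt ℝ ∞ k z) (w : E) :
    HasDerivAt (fun t : ℝ ↦ k (z + t • w)) (fderiv ℝ k z w) 0 := by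
  refine HasFDerivAt.comp_hasDerivAt (f := fun t : ℝ ↦ z + t • w) 0 ?_ (_root_.hasDerivAt_line z w)
  simpa using (hk.differentiableAt (by simp)).hasFDerivAt

end Line

/-! ### Invariance of the vertical form under horizontal lifts -/

section LieDerivative

open Set Filter Topology AssociatedBundle

variable {EG : Type*} [NormedAddCommGroup EG] [NormedSpace ℝ EG]
  {G : Type*} [TopologicalSpace G] [ChartedSpace EG G] [Group G] [LieGroup 𝓘(ℝ, EG) ∞ G]
  {EB : Type*} [NormedAddCommGroup EB] [NormedSpace ℝ EB]
  {B : Type*} [TopologicalSpace B] [ChartedSpace EB B] [IsManifold 𝓘(ℝ, EB) ∞ B]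
  {EP : Type*} [NormedAddCommGroup EP] [NormedSpace ℝ EP]
  {P : Type*} [TopologicalSpace P] [ChartedSpace EP P] [IsManifold 𝓘(ℝ, EP) ∞ P]
  [MulAction Gᵐᵒᵖ P]
  {EF : Type*} [NormedAddCommGroup EF] [NormedSpace ℝ EF]
  {F : Type*} [TopologicalSpace F] [ChartedSpace EF F] [IsManifold 𝓘(ℝ, EF) ∞ F] [MulAction G F]
  {pr : P → B}

variable {EM : Type*} [NormedAddCommGroup EM] [NormedSpace ℝ EM]
  [ChartedSpace EM (AssociatedBundle G P F)] [IsManifold 𝓘(ℝ, EM) ∞ (AssociatedBundle G P F)]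
  {hpr : IsPrincipalBundle EG G EP EB pr}
  (hM : IsBundleManifold EG EB EP EF F EM hpr) (θ : PrincipalConnection EG G EP P)
  {U : Set B} {s : B → P} (hs : IsLocalSection EB EP pr U s) {b : B} (hb : b ∈ U) (f : F)

variable (EB EF F) in
/-- The fibre component of the coordinate representation of a vertical field. -/
def vertCoord (hpr : IsPrincipalBundle EG G EP EB pr) (s : B → P) (b : B) (f : F)
    (X : AssociatedBundle G P F → EM) (z : EB × EF) : EF :=
  tder 𝓘(ℝ, EF) 𝓘(ℝ, EF) (chartAt EF f) ((chartAt EF f).symm z.2)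
    (vertProj EF F EM hpr θ s (bundleCoord G EB EF s b f z) (X (bundleCoord G EB EF s b f z)))

lemma vertCoord_self (X : AssociatedBundle G P F → EM) (z : EB) :
    vertCoord EB EF F θ hpr s b f X (z, chartAt EF f f) = vertProj EF F EM hpr θ s
      (AssociatedBundle.mk G (s ((chartAt EB b).symm z)) f)
      (X (AssociatedBundle.mk G (s ((chartAt EB b).symm z)) f)) := by
  have h : (chartAt EF f).symm (chartAt EF f f) = f := (chartAt EF f).left_inv (mem_chart_source EF f)
  simp only [vertCoord, bundleCoord, h, tder_chartAt_self]

include hM hs hb in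
lemma IsBundleManifold.contDiffAt_vertCoord
    (hact : ContMDiff (𝓘(ℝ, EG).prod 𝓘(ℝ, EF)) 𝓘(ℝ, EF) ∞ (fun y : G × F ↦ y.1 • y.2))
    {X : AssociatedBundle G P F → EM} (hX : IsSmoothVectorField X) :
    ContDiffAt ℝ ∞ (vertCoord EB EF F θ hpr s b f X) (chartAt EB b b, chartAt EF f f) := by
  set z₀ := (chartAt EB b b, chartAt EF f f)
  have hz₀ : z₀ ∈ coordDomain EB EF U b f := self_mem_coordDomain hb f
  have hτ : ∀ z ∈ coordDomain EB EF U b f,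
      fibreCoord pr s (bundleCoord G EB EF s b f z) = (chartAt EF f).symm z.2 :=
    fun z hz ↦ fibreCoord_mk_section hpr hs hz.1.2 _
  have h1 := SmoothAlongAt.vertProj hact hM θ hs (a₀ := z₀)
    (SmoothAlongAt.comp (hX.contMDiffAt (x := bundleCoord G EB EF s b f z₀))
      (hM.contMDiffAt_bundleCoord hs hz₀))
    (mem_of_eq_of_mem (hs.proj _ hz₀.1.2) hz₀.1.2)
  have h2 := h1.tder (Φ := chartAt EF f) (contMDiffOn_chart.contMDiffAt
    ((chartAt EF f).open_source.mem_nhds (by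
      rw [hτ z₀ hz₀]; exact (chartAt EF f).map_target hz₀.2)))
  refine (smoothAlongAt_vectorSpace.1 h2).2.contDiffAt.congr_of_eventuallyEq ?_
  filter_upwards [(isOpen_coordDomain hs.isOpen b f).mem_nhds hz₀] with z hz
  rw [hτ z hz]
  rfl

/-- The induced connection preserves the vertical form. -/
theorem bundleTwoForm_lieDeriv [FiniteDimensional ℝ EG] [FiniteDimensional ℝ EM]
    {ωF : TwoForm EF F} (hω : IsSymplecticAction EG G ωF) {u : B → EB} (hu : IsSmoothVectorField u)
    {X Y : AssociatedBundle G P F → EM} (hX : IsVerticalField EB (proj pr hpr.proj_smul) X)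
    (hY : IsVerticalField EB (proj pr hpr.proj_smul) Y) (y : AssociatedBundle G P F) :
    (bundleTwoForm θ hM hω).lieDeriv ((bundleConnection θ hM hω.smooth_action).liftField u) X Y y
      = 0 := by
  have hact := hω.smooth_action
  -- With a section whose connection form vanishes at `b`, the horizontal lift at the point is `(u
  -- b, 0)` in coordinates.
  obtain ⟨U, s, b, f, hs, hb, ha, rfl⟩ : ∃ (U : Set B) (s : B → P) (b : B) (f : F),
      IsLocalSection EB EP pr U s ∧ b ∈ U ∧ θ.pullback s b = 0 ∧ AssociatedBundle.mk G (s b) f = y := by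
    obtain ⟨U, s, hs, hb, ha⟩ :=
      hpr.exists_localSection_pullback_eq_zero θ (proj pr hpr.proj_smul y)
    exact ⟨U, s, _, _, hs, hb, ha, mk_fibreCoord hpr hs hb⟩
  set h : AssociatedBundle G P F → EM := (bundleConnection θ hM hω.smooth_action).liftField u
  set z₀ := (chartAt EB b b, chartAt EF f f)
  have hz₀ : bundleCoord G EB EF s b f z₀ = AssociatedBundle.mk G (s b) f := bundleCoord_self s b f
  have hz₀' : z₀ ∈ coordDomain EB EF U b f := self_mem_coordDomain hb f
  have hnhds := (isOpen_coordDomain hs.isOpen b f).mem_nhds hz₀'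
  have hb' : (chartAt EB b).symm z₀.1 = b := (chartAt EB b).left_inv (mem_chart_source EB b)
  have hlift : SmoothAlongAt 𝓘(ℝ, EM) 𝓘(ℝ, EM) (fun y : AssociatedBundle G P F ↦ y) h
      (bundleCoord G EB EF s b f z₀) := ((bundleConnection θ hM hact).smooth_lift u hu).contMDiffAt
  -- The bracket of the lift with a vertical field is, at this point, the derivative of the fibre
  -- component in the base direction.
  have hbr : ∀ {X : AssociatedBundle G P F → EM}, IsVerticalField EB (proj pr hpr.proj_smul) X →
      vertProj EF F EM hpr θ s (AssociatedBundle.mk G (s b) f)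
        (mBracket h X (AssociatedBundle.mk G (s b) f)) =
      fderiv ℝ (vertCoord EB EF F θ hpr s b f X) z₀ (u b, 0) := by
    intro X hX
    have hx := hM.contDiffAt_vertCoord θ hs hb f hact hX.1
    have h1 := tder_mBracket_of_related (hM.contMDiffAt_bundleCoord hs hz₀')
      (smoothAlongAt_horCoord hact θ hs hb f hu.contMDiffAt)
      (smoothAlongAt_vectorSpace.2 ⟨contMDiffAt_id, (contDiffAt_const (c := (0 : EB)).prodMk
        hx).contMDiffAt⟩) hlift
      hX.1.contMDiffAt (hM.eventually_horCoord hact θ hs hb f u) (by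
        filter_upwards [hnhds] with z hz
        exact hM.tder_bundleCoord_vertical θ hs hz (hX.2 _))
    have h2 := lieBracket_horizontal_vertical (u := chartField b u)
      (a := fun z ↦ θ.pullback s ((chartAt EB b).symm z) (u ((chartAt EB b).symm z)))
      (K := genCoord G f) (x := vertCoord EB EF F θ hpr s b f X) (z := z₀)
      ((contDiffAt_chartField (mem_chart_source EB b) hu.contMDiffAt).differentiableAt (by simp))
      ((contDiffAt_pullback_chart θ hs hb hu.contMDiffAt).differentiableAt (by simp))
      ((contDiffAt_genCoord hact (mem_chart_source EF f)).differentiableAt (by simp))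
      (hx.differentiableAt (by simp)) (by simp only [hb']; exact DFunLike.congr_fun ha _)
    rw [mBracket_vectorSpace, hM.tder_bundleCoord_self hs hb] at h1
    replace h1 := (congrArg _ h2).symm.trans h1
    rw [hz₀, hM.tder_section_apply hs hb] at h1
    rw [← h1, hM.vertProj_tder_mk θ hs hb]
    have hû : chartField b u z₀.1 = u b := chartField_self b u
    rw [hû]
  have hder : tder 𝓘(ℝ, EM) 𝓘(ℝ, ℝ) (fun y ↦ (bundleTwoForm θ hM hω).form y (X y) (Y y))
      (AssociatedBundle.mk G (s b) f) (h (AssociatedBundle.mk G (s b) f)) =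
      ωF.form f (fderiv ℝ (vertCoord EB EF F θ hpr s b f X) z₀ (u b, 0))
        (vertProj EF F EM hpr θ s (AssociatedBundle.mk G (s b) f)
          (Y (AssociatedBundle.mk G (s b) f))) +
      ωF.form f (vertProj EF F EM hpr θ s (AssociatedBundle.mk G (s b) f)
          (X (AssociatedBundle.mk G (s b) f)))
        (fderiv ℝ (vertCoord EB EF F θ hpr s b f Y) z₀ (u b, 0)) := by
    set Q : AssociatedBundle G P F → ℝ := fun y ↦ (bundleTwoForm θ hM hω).form y (X y) (Y y)
    have hQ : ContMDiffAt 𝓘(ℝ, EM) 𝓘(ℝ, ℝ) ∞ Q (AssociatedBundle.mk G (s b) f) :=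
      SmoothAlongAt.form₂ (bundleTwoForm θ hM hω)
        (hX.1.contMDiffAt (x := AssociatedBundle.mk G (s b) f))
        (hY.1.contMDiffAt (x := AssociatedBundle.mk G (s b) f))
    have h1 : tder 𝓘(ℝ, EB × EF) 𝓘(ℝ, EM) (bundleCoord G EB EF s b f) z₀ (u b, 0) =
        h (AssociatedBundle.mk G (s b) f) := by
      have := (hM.eventually_horCoord hact θ hs hb f u).self_of_nhds
      rw [horCoord_self, ha] at this
      rw [← hz₀]
      refine Eq.trans ?_ this
      simp [z₀]
    have hψ := hM.contMDiffAt_bundleCoord hs hz₀'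
    rw [← h1, ← hz₀, ← tder_comp (g := Q) (by rw [hz₀]; exact hQ.mdifferentiableAt (by simp))
      (hψ.mdifferentiableAt (by simp)), tder_eq_fderiv]
    have hQψ : ContDiffAt ℝ ∞ (fun z ↦ Q (bundleCoord G EB EF s b f z)) z₀ :=
      (ContMDiffAt.comp z₀ (g := Q) (by rw [hz₀]; exact hQ) hψ).contDiffAt
    have hℓ := hasDerivAt_line z₀ ((u b, 0) : EB × EF)
    have hx := (hM.contDiffAt_vertCoord θ hs hb f hact hX.1).hasDerivAt_line ((u b, 0) : EB × EF)
    have hy := (hM.contDiffAt_vertCoord θ hs hb f hact hY.1).hasDerivAt_line ((u b, 0) : EB × EF)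
    have hp := ((ωF.form f).hasFDerivAt.comp_hasDerivAt (0 : ℝ) hx).clm_apply hy
    -- Along this line the fibre coordinate stays `f`, so `ωF` is taken at the fixed point `f` and
    -- the product rule for a constant bilinear form applies. Its two terms are the ones that the
    -- brackets subtract.
    have hev : (fun t : ℝ ↦ Q (bundleCoord G EB EF s b f (z₀ + t • ((u b, 0) : EB × EF)))) =ᶠ[𝓝 0]
        fun t ↦ ωF.form f (vertCoord EB EF F θ hpr s b f X (z₀ + t • ((u b, 0) : EB × EF)))
          (vertCoord EB EF F θ hpr s b f Y (z₀ + t • ((u b, 0) : EB × EF))) := by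
      have hc : ∀ᶠ t : ℝ in 𝓝 0, z₀ + t • ((u b, 0) : EB × EF) ∈ coordDomain EB EF U b f := by
        refine hℓ.continuousAt ?_
        simpa using hnhds
      filter_upwards [hc] with t ht
      have hzt : z₀ + t • ((u b, 0) : EB × EF) = (z₀.1 + t • u b, chartAt EF f f) := by
        ext1 <;> simp [z₀]
      rw [hzt] at ht ⊢
      rw [vertCoord_self, vertCoord_self, bundleCoord]
      have hf : (chartAt EF f).symm (chartAt EF f f) = f :=
        (chartAt EF f).left_inv (mem_chart_source EF f)
      simp only [hf, Q]
      rw [bundleTwoForm_apply θ hM hs hω, fibreCoord_mk_section hpr hs ht.1.2]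
      exact mem_of_eq_of_mem (hs.proj _ ht.1.2) ht.1.2
    have h3 := (hQψ.hasDerivAt_line ((u b, 0) : EB × EF)).unique (hp.congr_of_eventuallyEq hev)
    rw [h3]
    have hbb : (chartAt EB b).symm (chartAt EB b b) = b := hb'
    simp only [zero_smul, add_zero, Function.comp_apply, vertCoord_self, hbb, hz₀]
    rfl
  have hbf : proj pr hpr.proj_smul (AssociatedBundle.mk G (s b) f) ∈ U :=
    mem_of_eq_of_mem (hs.proj _ hb) hb
  refine (TwoForm.lieDeriv_eq _ h X Y _).trans ?_
  rw [hder, bundleTwoForm_apply θ hM hs hω hbf,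
    bundleTwoForm_apply θ hM hs hω hbf, fibreCoord_mk_section hpr hs hb, hbr hX, hbr hY]
  ring

end LieDerivative

/-! ### The local curvature form as a smooth tensor -/

section CurvatureTensor

open Set Filter Topology AssociatedBundle

variable {EG : Type*} [NormedAddCommGroup EG] [NormedSpace ℝ EG]
  {G : Type*} [TopologicalSpace G] [ChartedSpace EG G] [Group G] [LieGroup 𝓘(ℝ, EG) ∞ G]
  {EB : Type*} [NormedAddCommGroup EB] [NormedSpace ℝ EB]
  {B : Type*} [TopologicalSpace B] [ChartedSpace EB B] [IsManifold 𝓘(ℝ, EB) ∞ B]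
  {EP : Type*} [NormedAddCommGroup EP] [NormedSpace ℝ EP]
  {P : Type*} [TopologicalSpace P] [ChartedSpace EP P] [IsManifold 𝓘(ℝ, EP) ∞ P]
  [MulAction Gᵐᵒᵖ P]
  {EF : Type*} [NormedAddCommGroup EF] [NormedSpace ℝ EF]
  {F : Type*} [TopologicalSpace F] [ChartedSpace EF F] [IsManifold 𝓘(ℝ, EF) ∞ F] [MulAction G F]
  {pr : P → B}

variable (EG G) in
/-- The bracket of the Lie algebra of `G`, as a bilinear map on the model space. -/
def bracketCLM : EG →L[ℝ] EG →L[ℝ] EG :=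
  (fderiv ℝ (genCoord G (1 : G)) (chartAt EG (1 : G) 1)).flip -
    fderiv ℝ (genCoord G (1 : G)) (chartAt EG (1 : G) 1)

lemma leftGen_one (ξ : EG) : leftGen G (1 : G) ξ = ξ := by
  have : (fun g : G ↦ g • (1 : G)) = fun g ↦ g := by
    ext g
    simp
  change tder 𝓘(ℝ, EG) 𝓘(ℝ, EG) (fun g : G ↦ g • (1 : G)) 1 ξ = ξ
  rw [this, tder_id]

lemma contMDiff_smul_self :
    ContMDiff (𝓘(ℝ, EG).prod 𝓘(ℝ, EG)) 𝓘(ℝ, EG) ∞ (fun y : G × G ↦ y.1 • y.2) :=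
  contMDiff_mul 𝓘(ℝ, EG) ∞

/-- This is `mBracket_leftGen` for `G` acting on itself by left multiplication, read at `1` in the
chart. It makes the bracket continuous and bilinear on the model space. -/
lemma bracketCLM_apply [FiniteDimensional ℝ EG] (ξ η : EG) :
    bracketCLM EG G ξ η = lieAlgebraBracket G ξ η := by
  have h := mBracket_leftGen (EG := EG) (G := G) contMDiff_smul_self ξ η (1 : G)
  rw [leftGen_one, mBracket_eq_lieBracket] at h
  have hK : DifferentiableAt ℝ (genCoord (EG := EG) G (1 : G)) (chartAt EG (1 : G) 1) :=
    (contDiffAt_genCoord contMDiff_smul_self (mem_chart_source EG (1 : G))).differentiableAt (by simp)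
  have h1 : ∀ e w, fderiv ℝ (chartField (1 : G) (fun f ↦ leftGen G f e : G → EG))
      (chartAt EG (1 : G) 1) w = fderiv ℝ (genCoord G (1 : G)) (chartAt EG (1 : G) 1) w e :=
      fun e w ↦ by
    have := (hK.hasFDerivAt.clm_apply (hasFDerivAt_const e _)).fderiv
    refine (congrArg (fun L : EG →L[ℝ] EG ↦ L w) this).trans ?_
    simp
  rw [lieBracket, h1, h1, chartField_self, chartField_self, leftGen_one, leftGen_one] at h
  rw [← neg_eq_iff_eq_neg.2 h, bracketCLM]
  simp

/-- A connection form in the chart at `b`. -/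
def PrincipalConnection.coordForm (θ : PrincipalConnection EG G EP P) (s : B → P) (b : B) (z : EB) :
    EB →L[ℝ] EG :=
  (θ.pullback s ((chartAt EB b).symm z)).comp (tder 𝓘(ℝ, EB) 𝓘(ℝ, EB) (chartAt EB b).symm z)

/-- The local curvature form at a point, as a bilinear map. -/
def PrincipalConnection.curvatureTensor (θ : PrincipalConnection EG G EP P) (s : B → P) (b : B) :
    EB →L[ℝ] EB →L[ℝ] EG :=
  fderiv ℝ (θ.coordForm s b) (chartAt EB b b) - (fderiv ℝ (θ.coordForm s b) (chartAt EB b b)).flip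
    + (bracketCLM EG G).bilinearComp (θ.pullback s b) (θ.pullback s b)

variable (θ : PrincipalConnection EG G EP P) {U : Set B} {s : B → P}
  (hs : IsLocalSection EB EP pr U s) {b : B} (hb : b ∈ U)

lemma PrincipalConnection.curvatureTensor_self (s : B → P) (b : B) (e : EB) :
    θ.curvatureTensor s b e e = 0 := by
  simp [curvatureTensor, bracketCLM]

include hs hb in
lemma PrincipalConnection.contDiffAt_coordForm [FiniteDimensional ℝ EB] :
    ContDiffAt ℝ ∞ (θ.coordForm s b) (chartAt EB b b) := by
  refine (contMDiffAt_of_forall_apply fun e ↦ ?_).contDiffAt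
  have hb' : (chartAt EB b).symm (chartAt EB b b) = b := (chartAt EB b).left_inv (mem_chart_source EB b)
  have h : SmoothAlongAt 𝓘(ℝ, EB) 𝓘(ℝ, EB) (fun z ↦ z) (fun _ : EB ↦ e) (chartAt EB b b) :=
    smoothAlongAt_vectorSpace.2 ⟨contMDiffAt_id, contMDiffAt_const⟩
  exact SmoothAlongAt.pullback θ hs (h.tder (contMDiffOn_chart_symm.contMDiffAt
    ((chartAt EB b).open_target.mem_nhds (mem_chart_target EB b)))) (by rwa [hb'])

include hs hb in
-- The derivatives of `u` and `v` in the first two terms cancel with those in `a([u, v])`. Hence the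
-- curvature form depends only on the values at `b`, as the bilinear maps of a `BaseTwoForm`
-- require.
lemma PrincipalConnection.curvatureForm_eq [FiniteDimensional ℝ EB] [FiniteDimensional ℝ EG]
    {u v : B → EB} (hu : SmoothAlongAt 𝓘(ℝ, EB) 𝓘(ℝ, EB) (fun b : B ↦ b) u b)
    (hv : SmoothAlongAt 𝓘(ℝ, EB) 𝓘(ℝ, EB) (fun b : B ↦ b) v b) :
    θ.curvatureForm s u v b = θ.curvatureTensor s b (u b) (v b) := by
  have hb' : (chartAt EB b).symm (chartAt EB b b) = b := (chartAt EB b).left_inv (mem_chart_source EB b)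
  have hα := (θ.contDiffAt_coordForm hs hb).differentiableAt (by simp)
  have hα0 : ∀ e, θ.coordForm s b (chartAt EB b b) e = θ.pullback s b e := fun e ↦ by
    have h := tder_chart_symm_chart (mem_chart_source EB b) e
    rw [tder_chartAt_self] at h
    rw [coordForm, ContinuousLinearMap.comp_apply, h, hb']
  have hd : ∀ {u : B → EB}, SmoothAlongAt 𝓘(ℝ, EB) 𝓘(ℝ, EB) (fun b : B ↦ b) u b → ∀ w,
      tder 𝓘(ℝ, EB) 𝓘(ℝ, EG) (fun b ↦ θ.pullback s b (u b)) b w =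
        fderiv ℝ (θ.coordForm s b) (chartAt EB b b) w (u b) +
          θ.pullback s b (fderiv ℝ (chartField b u) (chartAt EB b b) w) := fun {u} hu w ↦ by
    rw [← fderiv_comp_chart_symm ((SmoothAlongAt.pullback θ hs hu hb).mdifferentiableAt (by simp))]
    have hU := (contDiffAt_chartField (mem_chart_source EB b) hu).differentiableAt (by simp)
    have hev : (fun z ↦ θ.pullback s ((chartAt EB b).symm z) (u ((chartAt EB b).symm z)))
        =ᶠ[𝓝 (chartAt EB b b)] fun z ↦ θ.coordForm s b z (chartField b u z) := by
      filter_upwards [(chartAt EB b).open_target.mem_nhds (mem_chart_target EB b)] with z hz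
      rw [coordForm, ContinuousLinearMap.comp_apply, tder_symm_chartField u hz]
    rw [hev.fderiv_eq, (hα.hasFDerivAt.clm_apply hU.hasFDerivAt).fderiv]
    simp [hα0, chartField_self, add_comm]
  rw [curvatureForm, hd hv, hd hu, mBracket_eq_lieBracket, lieBracket, chartField_self,
    chartField_self, ← bracketCLM_apply]
  simp [curvatureTensor]
  abel

include hs hb in
lemma PrincipalConnection.contMDiffAt_curvatureForm [FiniteDimensional ℝ EB] [FiniteDimensional ℝ EG]
    {u v : B → EB} (hu : IsSmoothVectorField u) (hv : IsSmoothVectorField v) :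
    ContMDiffAt 𝓘(ℝ, EB) 𝓘(ℝ, EG) ∞ (θ.curvatureForm s u v) b := by
  have hp : ∀ {u : B → EB}, IsSmoothVectorField u →
      ContMDiffAt 𝓘(ℝ, EB) 𝓘(ℝ, EG) ∞ (fun b ↦ θ.pullback s b (u b)) b :=
    fun hu ↦ SmoothAlongAt.pullback θ hs hu.contMDiffAt hb
  have hd : ∀ {u v : B → EB}, IsSmoothVectorField u → IsSmoothVectorField v →
      ContMDiffAt 𝓘(ℝ, EB) 𝓘(ℝ, EG) ∞
        (fun b ↦ tder 𝓘(ℝ, EB) 𝓘(ℝ, EG) (fun b ↦ θ.pullback s b (v b)) b (u b)) b :=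
    fun {u v} hu hv ↦ (smoothAlongAt_vectorSpace.1 (SmoothAlongAt.tder (IA := 𝓘(ℝ, EB))
      (g := fun b : B ↦ b) (hu.contMDiffAt (x := b)) (hp hv))).2
  have hbr : IsSmoothVectorField (mBracket u v : B → EB) := by
    have : CompleteSpace EB := FiniteDimensional.complete ℝ EB
    have : IsManifold 𝓘(ℝ, EB) (((⊤ : ℕ∞) : ℕ∞ω) + 1) B := by simpa using ‹IsManifold 𝓘(ℝ, EB) ∞ B›
    have : IsManifold 𝓘(ℝ, EB) (minSmoothness ℝ 2) B := by
      rw [minSmoothness_of_isRCLikeNormedField]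
      exact IsManifold.of_le (n := ∞) (WithTop.coe_le_coe.2 (le_top : (2 : ℕ∞) ≤ ⊤))
    have : IsManifold 𝓘(ℝ, EB) (minSmoothness ℝ 3) B := by
      rw [minSmoothness_of_isRCLikeNormedField]
      exact IsManifold.of_le (n := ∞) (WithTop.coe_le_coe.2 (le_top : (3 : ℕ∞) ≤ ⊤))
    exact fun b ↦ ContMDiffAt.mlieBracket_vectorField (m := ⊤) (n := ⊤) (hu b) (hv b) (by simp)
  have hl : ContMDiffAt 𝓘(ℝ, EB) 𝓘(ℝ, EG) ∞
      (fun b ↦ lieAlgebraBracket G (θ.pullback s b (u b)) (θ.pullback s b (v b))) b := by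
    simp only [← bracketCLM_apply]
    exact (ContMDiffAt.clm_apply (contMDiffAt_const (c := bracketCLM EG G)) (hp hu)).clm_apply (hp hv)
  exact (((hd hu hv).sub (hd hv hu)).sub (hp hbr)).add hl

end CurvatureTensor

/-! ### Hamiltonian functions for the curvature, glued by a partition of unity -/

section GluedForm

lemma tder_sum_smul {E : Type*} [NormedAddCommGroup E] [NormedSpace ℝ E] {N : Type*}
    [TopologicalSpace N] [ChartedSpace E N] {ι : Type*} {T : Finset ι} {q : ι → N → ℝ} {n : N}
    (h : ∀ i ∈ T, MDifferentiableAt 𝓘(ℝ, E) 𝓘(ℝ, ℝ) (q i) n) (c : ι → ℝ) :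
    MDifferentiableAt 𝓘(ℝ, E) 𝓘(ℝ, ℝ) (∑ i ∈ T, c i • q i) n ∧ ∀ w,
      tder 𝓘(ℝ, E) 𝓘(ℝ, ℝ) (∑ i ∈ T, c i • q i) n w =
        ∑ i ∈ T, c i * tder 𝓘(ℝ, E) 𝓘(ℝ, ℝ) (q i) n w := by
  classical
  induction T using Finset.induction_on with
  | empty => exact ⟨mdifferentiableAt_const (c := (0 : ℝ)), fun w ↦
      congrArg (fun L : E →L[ℝ] ℝ ↦ L w) (hasMFDerivAt_const (0 : ℝ) n).mfderiv⟩
  | insert i T hi ih =>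
    obtain ⟨h1, h2⟩ := ih fun j hj ↦ h j (Finset.mem_insert_of_mem hj)
    have h3 := ((h i (Finset.mem_insert_self i T)).hasMFDerivAt.const_smul (c i)).add
      h1.hasMFDerivAt
    rw [Finset.sum_insert hi]
    refine ⟨h3.mdifferentiableAt, fun w ↦ ?_⟩
    rw [Finset.sum_insert hi, ← h2]
    exact congrArg (fun L : E →L[ℝ] ℝ ↦ L w) h3.mfderiv

open Set Filter Topology AssociatedBundle

variable {EG : Type*} [NormedAddCommGroup EG] [NormedSpace ℝ EG]
  {G : Type*} [TopologicalSpace G] [ChartedSpace EG G] [Group G] [LieGroup 𝓘(ℝ, EG) ∞ G]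
  {EB : Type*} [NormedAddCommGroup EB] [NormedSpace ℝ EB]
  {B : Type*} [TopologicalSpace B] [ChartedSpace EB B] [IsManifold 𝓘(ℝ, EB) ∞ B]
  {EP : Type*} [NormedAddCommGroup EP] [NormedSpace ℝ EP]
  {P : Type*} [TopologicalSpace P] [ChartedSpace EP P] [IsManifold 𝓘(ℝ, EP) ∞ P]
  [MulAction Gᵐᵒᵖ P]
  {EF : Type*} [NormedAddCommGroup EF] [NormedSpace ℝ EF]
  {F : Type*} [TopologicalSpace F] [ChartedSpace EF F] [IsManifold 𝓘(ℝ, EF) ∞ F] [MulAction G F]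
  {pr : P → B}
variable {EM : Type*} [NormedAddCommGroup EM] [NormedSpace ℝ EM]
  [ChartedSpace EM (AssociatedBundle G P F)] [IsManifold 𝓘(ℝ, EM) ∞ (AssociatedBundle G P F)]
  {hpr : IsPrincipalBundle EG G EP EB pr}
  (hM : IsBundleManifold EG EB EP EF F EM hpr) (θ : PrincipalConnection EG G EP P)

/-- The value of a moment map, as a linear form on the model space. -/
def momentForm (J : F → (GroupLieAlgebra 𝓘(ℝ, EG) G →L[ℝ] ℝ)) (f : F) : EG →L[ℝ] ℝ := J f

lemma IsMomentMap.tder_eq {ωF : TwoForm EF F} {J : F → (GroupLieAlgebra 𝓘(ℝ, EG) G →L[ℝ] ℝ)}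
    (hJ : IsMomentMap ωF J) (ξ : EG) (f : F) (w : EF) :
    tder 𝓘(ℝ, EF) 𝓘(ℝ, ℝ) (fun f ↦ momentForm J f ξ) f w = -ωF.form f (leftGen G f ξ) w :=
  hJ.moment ξ f w

lemma IsMomentMap.contMDiff_momentForm [FiniteDimensional ℝ EG] {ωF : TwoForm EF F}
    {J : F → (GroupLieAlgebra 𝓘(ℝ, EG) G →L[ℝ] ℝ)} (hJ : IsMomentMap ωF J) :
    ContMDiff 𝓘(ℝ, EF) 𝓘(ℝ, EG →L[ℝ] ℝ) ∞ (momentForm J) := fun f ↦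
  contMDiffAt_of_forall_apply fun ξ ↦ (hJ.smooth ξ).contMDiffAt (x := f)

section

variable [FiniteDimensional ℝ EM] [FiniteDimensional ℝ EG] {ωF : TwoForm EF F}
  (hω : IsSymplecticAction EG G ωF)
  {J : F → (GroupLieAlgebra 𝓘(ℝ, EG) G →L[ℝ] ℝ)} (hJ : IsMomentMap ωF J)
  {U : Set B} {s : B → P} (hs : IsLocalSection EB EP pr U s)

include hM hJ hs in
omit [FiniteDimensional ℝ EM] in
lemma IsBundleManifold.contMDiffAt_momentForm_fibreCoord {y : AssociatedBundle G P F}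
    (hy : proj pr hpr.proj_smul y ∈ U) :
    ContMDiffAt 𝓘(ℝ, EM) 𝓘(ℝ, EG →L[ℝ] ℝ) ∞ (fun y ↦ momentForm J (fibreCoord pr s y)) y :=
  ContMDiffAt.comp y (hJ.contMDiff_momentForm.contMDiffAt (x := fibreCoord pr s y))
    (hM.smooth_fibreCoord U s hs _ hy)

include hJ hs in
/-- The moment map, in the trivialization given by a section, is hamiltonian for the curvature. -/
lemma bundleTwoForm_curvature {u v : B → EB} (hu : IsSmoothVectorField u)
    (hv : IsSmoothVectorField v) {y : AssociatedBundle G P F} (hy : proj pr hpr.proj_smul y ∈ U)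
    {w : EM} (hw : tder 𝓘(ℝ, EM) 𝓘(ℝ, EB) (proj pr hpr.proj_smul) y w = 0) :
    tder 𝓘(ℝ, EM) 𝓘(ℝ, ℝ) (fun y' ↦ momentForm J (fibreCoord pr s y')
      (θ.curvatureForm s u v (proj pr hpr.proj_smul y))) y w =
      (bundleTwoForm θ hM hω).form y ((bundleConnection θ hM hω.smooth_action).curvature u v y) w := by
  obtain ⟨b, f, hb, rfl⟩ : ∃ b f, b ∈ U ∧ AssociatedBundle.mk G (s b) f = y :=
    ⟨_, _, hy, mk_fibreCoord hpr hs hy⟩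
  set C : EM := (bundleConnection θ hM hω.smooth_action).curvature u v (AssociatedBundle.mk G (s b) f)
    with hC
  have h1 : C = _ := hM.curvature_mk hω.smooth_action θ hs hb f hu hv
  have hp : proj pr hpr.proj_smul (AssociatedBundle.mk G (s b) f) = b := hs.proj b hb
  -- The curvature is minus the fundamental vector of `Ω = θ.curvatureForm s u v b`, a fixed element
  -- of the Lie algebra on this fibre. So the claim is the moment map condition for `Ω`.
  rw [bundleTwoForm_apply θ hM hs hω hy, h1, hM.vertProj_tder_mk θ hs hb, vertProj_apply, hw,
    map_zero, map_zero, add_zero, hp]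
  rw [tder_comp (g := fun f ↦ momentForm J f (θ.curvatureForm s u v b)) (f := fibreCoord pr s)
    ((hJ.smooth _).contMDiffAt.mdifferentiableAt (by simp))
    ((hM.smooth_fibreCoord U s hs _ hy).mdifferentiableAt (by simp)), hJ.tder_eq,
    fibreCoord_mk_section hpr hs hb]
  simp

end

section

variable {ι : Type*} (ρ : SmoothPartitionOfUnity ι 𝓘(ℝ, EB) B) (s : ι → B → P)
  (J : F → (GroupLieAlgebra 𝓘(ℝ, EG) G →L[ℝ] ℝ))

variable (hpr) in
/-- The values of the glued form. -/
def gluedBilin (y : AssociatedBundle G P F) : EB →L[ℝ] EB →L[ℝ] ℝ :=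
  ∑ i ∈ ρ.finsupport (proj pr hpr.proj_smul y), ρ i (proj pr hpr.proj_smul y) •
    (ContinuousLinearMap.compL ℝ EB EG ℝ (momentForm J (fibreCoord pr (s i) y))).comp
      (θ.curvatureTensor (s i) (proj pr hpr.proj_smul y))

lemma gluedBilin_apply (y : AssociatedBundle G P F) (u v : EB) :
    gluedBilin hpr θ ρ s J y u v = ∑ i ∈ ρ.finsupport (proj pr hpr.proj_smul y),
      ρ i (proj pr hpr.proj_smul y) * momentForm J (fibreCoord pr (s i) y)
        (θ.curvatureTensor (s i) (proj pr hpr.proj_smul y) u v) := by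
  simp [gluedBilin]

variable [FiniteDimensional ℝ EG] [FiniteDimensional ℝ EB]
  {ρ} {s} {U : ι → Set B} (hρ : ρ.IsSubordinate U) (hs : ∀ i, IsLocalSection EB EP pr (U i) (s i))

include hρ hs in
lemma gluedBilin_apply_field {u v : B → EB} (hu : IsSmoothVectorField u)
    (hv : IsSmoothVectorField v) (y : AssociatedBundle G P F) :
    gluedBilin hpr θ ρ s J y (u (proj pr hpr.proj_smul y)) (v (proj pr hpr.proj_smul y)) =
      ∑ i ∈ ρ.finsupport (proj pr hpr.proj_smul y), ρ i (proj pr hpr.proj_smul y) *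
        momentForm J (fibreCoord pr (s i) y)
          (θ.curvatureForm (s i) u v (proj pr hpr.proj_smul y)) := by
  rw [gluedBilin_apply]
  refine Finset.sum_congr rfl fun i hi ↦ ?_
  rw [θ.curvatureForm_eq (hs i) (hρ i (subset_tsupport _ ((ρ.mem_finsupport _).1 hi)))
    hu.contMDiffAt hv.contMDiffAt]

include hρ hs in
lemma gluedBilin_apply_field_finsum {u v : B → EB} (hu : IsSmoothVectorField u)
    (hv : IsSmoothVectorField v) (y : AssociatedBundle G P F) :
    gluedBilin hpr θ ρ s J y (u (proj pr hpr.proj_smul y)) (v (proj pr hpr.proj_smul y)) =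
      ∑ᶠ i, ρ i (proj pr hpr.proj_smul y) * momentForm J (fibreCoord pr (s i) y)
          (θ.curvatureForm (s i) u v (proj pr hpr.proj_smul y)) := by
  rw [gluedBilin_apply_field θ J hρ hs hu hv]
  refine (finsum_eq_sum_of_support_subset _ fun i hi ↦ ?_).symm
  exact (ρ.mem_finsupport _).2 (left_ne_zero_of_mul hi)

variable {J} {ωF : TwoForm EF F} (hJ : IsMomentMap ωF J)

/-- The form on the base, with values in functions on the associated bundle, which is glued by a
partition of unity from the local curvature forms. -/
def gluedForm : BaseTwoForm EM EB (proj pr hpr.proj_smul : AssociatedBundle G P F → B) where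
  toFun := gluedBilin hpr θ ρ s J
  alternating y u := by
    refine (gluedBilin_apply θ ρ s J y u u).trans (Finset.sum_eq_zero fun i _ ↦ ?_)
    refine (congrArg (fun ξ : EG ↦ _ * momentForm J _ ξ) (θ.curvatureTensor_self _ _ _)).trans ?_
    rw [map_zero, mul_zero]
  smooth u v hu hv := by
    refine ContMDiff.congr ?_ fun y ↦ gluedBilin_apply_field_finsum θ J hρ hs hu hv y
    intro y
    refine _root_.contMDiffAt_finsum ?_ fun i ↦ ?_
    · refine (ρ.locallyFinite.preimage_continuous (continuous_proj hpr)).subset fun i y hy ↦ ?_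
      exact fun h ↦ hy (by simp [h])
    -- Over the closed support of `ρ i`, which lies in `U i`, the local expression is smooth; over
    -- its open complement the term vanishes.
    · by_cases hy : proj pr hpr.proj_smul y ∈ tsupport (ρ i)
      · have hp := hM.smooth_proj.contMDiffAt (x := y)
        refine ContMDiffAt.mul (ContMDiffAt.comp y (ρ i).contMDiff.contMDiffAt hp)
          (ContMDiffAt.clm_apply (hM.contMDiffAt_momentForm_fibreCoord hJ (hs i) (hρ i hy)) ?_)
        exact ContMDiffAt.comp y (θ.contMDiffAt_curvatureForm (hs i) (hρ i hy) hu hv) hp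
      · refine (contMDiffAt_const (c := (0 : ℝ))).congr_of_eventuallyEq ?_
        filter_upwards [((isClosed_tsupport (ρ i)).isOpen_compl.preimage
          (continuous_proj hpr)).mem_nhds hy] with z hz
        rw [image_eq_zero_of_notMem_tsupport hz, zero_mul]

lemma gluedForm_isGluedForm :
    IsGluedForm (gluedForm hM θ hρ hs hJ) θ J ρ U s := by
  intro u v hu hv y f hf
  refine (gluedBilin_apply_field_finsum (hpr := hpr) θ J hρ hs hu hv y).trans
    (finsum_congr fun i ↦ ?_)
  by_cases hy : proj pr hpr.proj_smul y ∈ U i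
  · have h := hf i hy
    have : fibreCoord pr (s i) y = f i := by
      conv_lhs => rw [← h]
      exact fibreCoord_mk_section hpr (hs i) hy _
    rw [this]
    rfl
  -- Outside `U i` the point `f i` is arbitrary, but `ρ i` vanishes.
  · rw [image_eq_zero_of_notMem_tsupport fun h ↦ hy (hρ i h), zero_mul, zero_mul]

/-- On a fibre the weights are constants with sum `1`, and all local terms of nonzero weight have
the same vertical derivative `c`, even where the functions themselves differ. -/
lemma gluedForm_prescribesCurvature [FiniteDimensional ℝ EM] (hω : IsSymplecticAction EG G ωF) :
    PrescribesCurvature (bundleConnection θ hM hω.smooth_action) (bundleTwoForm θ hM hω)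
      (gluedForm hM θ hρ hs hJ) := by
  intro u v hu hv y (w : EM) hw
  change tder 𝓘(ℝ, EM) 𝓘(ℝ, EB) (proj pr hpr.proj_smul) y w = 0 at hw
  set Ω : AssociatedBundle G P F → ℝ := fun y ↦
    gluedBilin hpr θ ρ s J y (u (proj pr hpr.proj_smul y)) (v (proj pr hpr.proj_smul y)) with hdef
  have hsm : ContMDiff 𝓘(ℝ, EM) 𝓘(ℝ, ℝ) ∞ Ω := (gluedForm hM θ hρ hs hJ).smooth u v hu hv
  suffices h : tder 𝓘(ℝ, EM) 𝓘(ℝ, ℝ) Ω y w = (bundleTwoForm θ hM hω).form y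
      ((bundleConnection θ hM hω.smooth_action).curvature u v y) w by
    exact neg_add_eq_zero.2 h.symm
  obtain ⟨V, r, b, f, hr, hb, rfl⟩ := hpr.exists_mk_section y
  have hy : proj pr hpr.proj_smul (AssociatedBundle.mk G (r b) f) = b := hr.proj b hb
  -- The Lie algebra element is frozen at its value at `b`, and so are the weights in `H` below.
  -- This does not change the functions on the fibre over `b`, to which `w` is tangent.
  set q : ι → AssociatedBundle G P F → ℝ := fun i y' ↦
    momentForm J (fibreCoord pr (s i) y') (θ.curvatureForm (s i) u v b)
  set c := (bundleTwoForm θ hM hω).form (AssociatedBundle.mk G (r b) f)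
    ((bundleConnection θ hM hω.smooth_action).curvature u v (AssociatedBundle.mk G (r b) f)) w
  have hq : ∀ i ∈ ρ.finsupport b, MDifferentiableAt 𝓘(ℝ, EM) 𝓘(ℝ, ℝ) (q i)
      (AssociatedBundle.mk G (r b) f) ∧
      tder 𝓘(ℝ, EM) 𝓘(ℝ, ℝ) (q i) (AssociatedBundle.mk G (r b) f) w = c := by
    intro i hi
    have hbi : proj pr hpr.proj_smul (AssociatedBundle.mk G (r b) f) ∈ U i :=
      mem_of_eq_of_mem hy (hρ i (subset_tsupport _ ((ρ.mem_finsupport _).1 hi)))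
    refine ⟨?_, ?_⟩
    · exact (((hM.contMDiffAt_momentForm_fibreCoord hJ (hs i) hbi).clm_apply
        contMDiffAt_const).mdifferentiableAt (by simp))
    · have := bundleTwoForm_curvature hM θ hω hJ (hs i) hu hv hbi hw
      rwa [hy] at this
  have hι : MDifferentiableAt 𝓘(ℝ, EF) 𝓘(ℝ, EM) (fun f ↦ AssociatedBundle.mk G (r b) f) f :=
    (hM.contMDiff_mk_right hω.smooth_action (r b)).contMDiffAt.mdifferentiableAt (by simp)
  set H : AssociatedBundle G P F → ℝ := ∑ i ∈ ρ.finsupport b, (ρ i b) • q i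
  obtain ⟨hH, hH'⟩ := tder_sum_smul (fun i hi ↦ (hq i hi).1) fun i ↦ ρ i b
  have hΩH : (fun f ↦ Ω (AssociatedBundle.mk G (r b) f)) =
      fun f ↦ H (AssociatedBundle.mk G (r b) f) := by
    ext f
    have hy' : proj pr hpr.proj_smul (AssociatedBundle.mk G (r b) f) = b := hr.proj b hb
    rw [hdef]
    beta_reduce
    rw [gluedBilin_apply_field θ J hρ hs hu hv, hy']
    simp [H, q]
  have hwv := hM.tder_mk_vertProj θ hr hb f hw
  rw [← hwv, ← tder_comp (f := fun f ↦ AssociatedBundle.mk G (r b) f) (g := Ω)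
    (hsm.contMDiffAt.mdifferentiableAt (by simp)) hι, hΩH,
    tder_comp (f := fun f ↦ AssociatedBundle.mk G (r b) f) (g := H) hH hι, hwv, hH' w]
  rw [Finset.sum_congr rfl fun i hi ↦ by rw [(hq i hi).2], ← Finset.sum_mul,
    ρ.sum_finsupport _ (mem_univ b), one_mul]

end

lemma exists_gluedForm [FiniteDimensional ℝ EG] [FiniteDimensional ℝ EB] [FiniteDimensional ℝ EM]
    [T2Space B] [SecondCountableTopology B] {ωF : TwoForm EF F} (hω : IsSymplecticAction EG G ωF)
    {J : F → (GroupLieAlgebra 𝓘(ℝ, EG) G →L[ℝ] ℝ)} (hJ : IsMomentMap ωF J) :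
    ∃ ωH : BaseTwoForm EM EB (proj pr hpr.proj_smul : AssociatedBundle G P F → B),
      PrescribesCurvature (bundleConnection θ hM hω.smooth_action) (bundleTwoForm θ hM hω) ωH := by
  have : LocallyCompactSpace B := ChartedSpace.locallyCompactSpace EB B
  obtain ⟨ρ, hρ⟩ := SmoothPartitionOfUnity.exists_isSubordinate 𝓘(ℝ, EB) isClosed_univ
    hpr.sectionDomain (fun b ↦ (hpr.isLocalSection_sectionAt b).isOpen)
    fun b _ ↦ mem_iUnion.2 ⟨b, hpr.mem_sectionDomain b⟩
  exact ⟨_, gluedForm_prescribesCurvature hM θ hρ hpr.isLocalSection_sectionAt hJ hω⟩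

end GluedForm

/-! ### Smooth local solutions of differential equations -/

section IntegralCurves

open Set Filter Topology

variable {E : Type*} [NormedAddCommGroup E] [NormedSpace ℝ E] [CompleteSpace E]

/-- Picard–Lindelöf gives a differentiable solution. On a closed interval small enough for it to
stay in `W`, regularity of solutions makes it smooth. -/
lemma exists_contDiffAt_integralCurve {f : E → E} {W : Set E} (hW : IsOpen W)
    (hf : ContDiffOn ℝ ∞ f W) {x₀ : E} (hx : x₀ ∈ W) (t₀ : ℝ) :
    ∃ α : ℝ → E, α t₀ = x₀ ∧ ∃ ε > 0, ∀ t ∈ Ioo (t₀ - ε) (t₀ + ε),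
      α t ∈ W ∧ ContDiffAt ℝ ∞ α t ∧ HasDerivAt α (f (α t)) t := by
  obtain ⟨α, hα, ε, hε, h⟩ := ((hf.contDiffAt (hW.mem_nhds hx)).of_le
    (by simp)).exists_forall_mem_closedBall_exists_eq_forall_mem_Ioo_hasDerivAt₀ t₀
  have hc : α ⁻¹' W ∈ 𝓝 t₀ := (h t₀ (by simp [hε])).continuousAt (hW.mem_nhds (by rwa [hα]))
  obtain ⟨δ, hδ, hδW⟩ := Metric.mem_nhds_iff.1 hc
  set η := min ε δ / 2
  have hη : 0 < η := by positivity
  have hηε : η < ε := by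
    have := min_le_left ε δ
    simp only [η]
    linarith
  have hηδ : η < δ := by
    have := min_le_right ε δ
    simp only [η]
    linarith
  have hI : ∀ t ∈ Icc (t₀ - η) (t₀ + η), t ∈ Ioo (t₀ - ε) (t₀ + ε) := fun t ht ↦
    ⟨by linarith [ht.1], by linarith [ht.2]⟩
  have hI' : ∀ t ∈ Icc (t₀ - η) (t₀ + η), α t ∈ W := fun t ht ↦
    hδW (by rw [Real.ball_eq_Ioo]; exact ⟨by linarith [ht.1], by linarith [ht.2]⟩)
  have hs : ContDiffOn ℝ ∞ α (Icc (t₀ - η) (t₀ + η)) :=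
    ODE.contDiffOn_enat_Icc_of_hasDerivWithinAt (n := ⊤) (f := fun _ ↦ f) (u := W)
      (hf.comp contDiffOn_snd fun p hp ↦ hp.2) (fun t ht ↦ (h t (hI t ht)).hasDerivWithinAt) hI'
  exact ⟨α, hα, η, hη, fun t ht ↦ ⟨hI' t (Ioo_subset_Icc_self ht),
    hs.contDiffAt (Icc_mem_nhds ht.1 ht.2), h t (hI t (Ioo_subset_Icc_self ht))⟩⟩

/-- The equation is made autonomous by adding time as a coordinate of velocity `1`; that coordinate
then equals `t`. -/
lemma exists_contDiffAt_solution {E' : Type*} [NormedAddCommGroup E'] [NormedSpace ℝ E']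
    {K : E → E' →L[ℝ] E} {a : ℝ → E'} {I : Set ℝ} {V : Set E} (hI : IsOpen I) (hV : IsOpen V)
    (hK : ContDiffOn ℝ ∞ K V) (ha : ContDiffOn ℝ ∞ a I) {t₀ : ℝ} {z₀ : E} (ht : t₀ ∈ I)
    (hz : z₀ ∈ V) :
    ∃ z : ℝ → E, z t₀ = z₀ ∧ ∃ ε > 0, ∀ t ∈ Ioo (t₀ - ε) (t₀ + ε),
      t ∈ I ∧ z t ∈ V ∧ ContDiffAt ℝ ∞ z t ∧ HasDerivAt z (-K (z t) (a t)) t := by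
  have hf : ContDiffOn ℝ ∞ (fun p : ℝ × E ↦ ((1 : ℝ), -K p.2 (a p.1))) (I ×ˢ V) :=
    contDiffOn_const.prodMk ((hK.comp contDiffOn_snd fun p hp ↦ hp.2).clm_apply
      (ha.comp contDiffOn_fst fun p hp ↦ hp.1)).neg
  obtain ⟨α, hα, ε, hε, h⟩ := exists_contDiffAt_integralCurve (hI.prod hV) hf
    (x₀ := (t₀, z₀)) ⟨ht, hz⟩ t₀
  have h1 : ∀ t ∈ Ioo (t₀ - ε) (t₀ + ε), HasDerivAt (fun t ↦ (α t).1) 1 t := fun t ht ↦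
    (hasFDerivAt_fst (𝕜 := ℝ) (p := α t)).comp_hasDerivAt t (h t ht).2.2
  have h2 : ∀ t ∈ Ioo (t₀ - ε) (t₀ + ε), HasDerivAt (fun t ↦ (α t).2)
      (-K (α t).2 (a (α t).1)) t := fun t ht ↦ 
    (hasFDerivAt_snd (𝕜 := ℝ) (p := α t)).comp_hasDerivAt t (h t ht).2.2
  have h3 : EqOn (fun t ↦ (α t).1) (fun t ↦ t) (Ioo (t₀ - ε) (t₀ + ε)) := by
    refine isOpen_Ioo.eqOn_of_deriv_eq isPreconnected_Ioo
      (fun t ht ↦ (h1 t ht).differentiableAt.differentiableWithinAt) differentiableOn_id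
      (fun t ht ↦ by rw [(h1 t ht).deriv, deriv_id'']) (x := t₀) (by simp [hε]) (by simp [hα])
  refine ⟨fun t ↦ (α t).2, congrArg Prod.snd hα, ε, hε, fun t ht ↦ ?_⟩
  have h4 : (α t).1 = t := h3 ht
  have h5 := h2 t ht
  rw [h4] at h5
  refine ⟨?_, (h t ht).1.2, (h t ht).2.1.snd, h5⟩
  rw [← h4]
  exact (h t ht).1.1

end IntegralCurves

/-! ### The connection form on curves moved by the group -/

section Horizontal

open Set Filter Topology AssociatedBundle

variable {EG : Type*} [NormedAddCommGroup EG] [NormedSpace ℝ EG]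
  {G : Type*} [TopologicalSpace G] [ChartedSpace EG G] [Group G] [LieGroup 𝓘(ℝ, EG) ∞ G]
  {EB : Type*} [NormedAddCommGroup EB] [NormedSpace ℝ EB]
  {B : Type*} [TopologicalSpace B] [ChartedSpace EB B] [IsManifold 𝓘(ℝ, EB) ∞ B]
  {EP : Type*} [NormedAddCommGroup EP] [NormedSpace ℝ EP]
  {P : Type*} [TopologicalSpace P] [ChartedSpace EP P] [IsManifold 𝓘(ℝ, EP) ∞ P]
  [MulAction Gᵐᵒᵖ P]
  {EF : Type*} [NormedAddCommGroup EF] [NormedSpace ℝ EF]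
  {F : Type*} [TopologicalSpace F] [ChartedSpace EF F] [IsManifold 𝓘(ℝ, EF) ∞ F] [MulAction G F]
  {pr : P → B}

/-- Conjugation by `k⁻¹` is `h ↦ k⁻¹ * (h * k)`: the right invariant vector at `k` is translated
back to `1` from the left. -/
lemma adjointAction_eq (k : G) (ξ : EG) :
    adjointAction (G := G) (EG := EG) k⁻¹ ξ =
      tder 𝓘(ℝ, EG) 𝓘(ℝ, EG) (fun h : G ↦ k⁻¹ * h) k (leftGen G k ξ) := by
  have h := tder_comp (g := fun h : G ↦ k⁻¹ * h) (f := fun h : G ↦ h • k) (a := 1)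
    ((contMDiff_mul_left (I := 𝓘(ℝ, EG)) (n := ∞)).contMDiffAt.mdifferentiableAt (by simp))
    ((contMDiff_smul_right contMDiff_smul_self k).contMDiffAt.mdifferentiableAt (by simp)) ξ
  simp only [one_smul] at h
  refine Eq.trans ?_ h
  change tder 𝓘(ℝ, EG) 𝓘(ℝ, EG) (fun h : G ↦ k⁻¹ * h * k⁻¹⁻¹) 1 ξ = _
  simp only [inv_inv, smul_eq_mul, mul_assoc]

lemma tder_mul_left_injective {k : G} {v : EG}
    (h : tder 𝓘(ℝ, EG) 𝓘(ℝ, EG) (fun h : G ↦ k⁻¹ * h) k v = 0) : v = 0 := by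
  have h' := tder_comp (g := fun h : G ↦ k * h) (f := fun h : G ↦ k⁻¹ * h) (a := k)
    ((contMDiff_mul_left (I := 𝓘(ℝ, EG)) (n := ∞)).contMDiffAt.mdifferentiableAt (by simp))
    ((contMDiff_mul_left (I := 𝓘(ℝ, EG)) (n := ∞)).contMDiffAt.mdifferentiableAt (by simp)) v
  simp only [mul_inv_cancel_left, tder_id] at h'
  rw [h', h, map_zero]

variable (hpr : IsPrincipalBundle EG G EP EB pr) (θ : PrincipalConnection EG G EP P)

include hpr

/-- Since `x · h = (x · k) · (k⁻¹ * h)`, the vector is fundamental at `x · k`, with generator the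
left translate of `η` to `1`. -/
lemma PrincipalConnection.form_tder_orbit (x : P) (k : G) (η : EG) :
    θ.form (op k • x) (tder 𝓘(ℝ, EG) 𝓘(ℝ, EP) (fun h : G ↦ op h • x) k η) =
      tder 𝓘(ℝ, EG) 𝓘(ℝ, EG) (fun h : G ↦ k⁻¹ * h) k η := by
  have h := tder_comp (g := fun h : G ↦ op h • (op k • x)) (f := fun h : G ↦ k⁻¹ * h) (a := k)
    ((hpr.contMDiff_orbit _).contMDiffAt.mdifferentiableAt (by simp))
    ((contMDiff_mul_left (I := 𝓘(ℝ, EG)) (n := ∞)).contMDiffAt.mdifferentiableAt (by simp)) η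
  simp only [smul_smul, ← op_mul, mul_inv_cancel_left, inv_mul_cancel] at h
  rw [h]
  have h1 := θ.form_rightGen (op k • x) (tder 𝓘(ℝ, EG) 𝓘(ℝ, EG) (fun h : G ↦ k⁻¹ * h) k η)
  rw [rightGen] at h1
  simpa only [smul_smul, ← op_mul] using h1

/-- The connection form on the derivative of a curve which is moved by a curve in the group. -/
lemma PrincipalConnection.form_tder_smul {c : ℝ → P} {k : ℝ → G} {t : ℝ}
    (hc : MDifferentiableAt 𝓘(ℝ, ℝ) 𝓘(ℝ, EP) c t) (hk : MDifferentiableAt 𝓘(ℝ, ℝ) 𝓘(ℝ, EG) k t) :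
    θ.form (op (k t) • c t) (tder 𝓘(ℝ, ℝ) 𝓘(ℝ, EP) (fun t ↦ op (k t) • c t) t 1) =
      tder 𝓘(ℝ, EG) 𝓘(ℝ, EG) (fun h : G ↦ (k t)⁻¹ * h) (k t)
        (leftGen G (k t) (θ.form (c t) (tder 𝓘(ℝ, ℝ) 𝓘(ℝ, EP) c t 1)) +
          tder 𝓘(ℝ, ℝ) 𝓘(ℝ, EG) k t 1) := by
  have hd : MDifferentiableAt (𝓘(ℝ, EP).prod 𝓘(ℝ, EG)) 𝓘(ℝ, EP)
    (fun y : P × G ↦ op y.2 • y.1) (c t, k t) :=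
    hpr.smooth_action.contMDiffAt.mdifferentiableAt (by simp)
  rw [tder_comp (g := fun y : P × G ↦ op y.2 • y.1) (f := fun t ↦ (c t, k t)) hd (hc.prodMk hk),
    tder_prodMk hc hk, tder_prod hd, map_add, map_add, θ.form_tder_orbit hpr, ← adjointAction_eq]
  congr 1
  exact θ.equivariant _ _ _

end Horizontal

/-! ### Curves with zero derivative in a manifold -/

section LocallyConstant

open Set Filter Topology

variable {E : Type*} [NormedAddCommGroup E] [NormedSpace ℝ E]
  {N : Type*} [TopologicalSpace N] [ChartedSpace E N] [IsManifold 𝓘(ℝ, E) ∞ N]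

lemma eventually_eq_of_tder_eq_zero {g : ℝ → N} {t₀ : ℝ}
    (hg : ∀ᶠ t in 𝓝 t₀, MDifferentiableAt 𝓘(ℝ, ℝ) 𝓘(ℝ, E) g t ∧ tder 𝓘(ℝ, ℝ) 𝓘(ℝ, E) g t 1 = 0) :
    ∀ᶠ t in 𝓝 t₀, g t = g t₀ := by
  set ψ := chartAt E (g t₀)
  have hc : ∀ᶠ t in 𝓝 t₀, g t ∈ ψ.source := hg.self_of_nhds.1.continuousAt
    (ψ.open_source.mem_nhds (mem_chart_source E _))
  obtain ⟨ε, hε, h⟩ := Metric.eventually_nhds_iff_ball.1 (hg.and hc)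
  have hd : ∀ t ∈ Metric.ball t₀ ε, HasDerivAt (fun t ↦ ψ (g t)) 0 t := fun t ht ↦ by
    obtain ⟨⟨h1, h2⟩, h3⟩ := h t ht
    have hψ : MDifferentiableAt 𝓘(ℝ, E) 𝓘(ℝ, E) ψ (g t) :=
      (mdifferentiable_chart (I := 𝓘(ℝ, E)) (g t₀)).mdifferentiableAt h3
    have h4 := tder_comp (g := ψ) (f := g) hψ h1 1
    rw [h2, map_zero, tder_eq_fderiv] at h4
    have h5 : DifferentiableAt ℝ (fun t ↦ ψ (g t)) t := (hψ.comp t h1).differentiableAt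
    have h6 := h5.hasDerivAt
    rwa [← fderiv_apply_one_eq_deriv, h4] at h6
  filter_upwards [Metric.ball_mem_nhds t₀ hε] with t ht
  have h0 := Metric.mem_ball_self (x := t₀) hε
  have := Metric.isOpen_ball.is_const_of_deriv_eq_zero (convex_ball t₀ ε).isPreconnected
    (fun t ht ↦ (hd t ht).differentiableAt.differentiableWithinAt) (fun t ht ↦ (hd t ht).deriv)
    ht h0
  exact ψ.injOn (h t ht).2 (h t₀ h0).2 this

end LocallyConstant

/-! ### Parallel transport in the principal bundle, and completeness -/

section HorizontalLifts

open Set Filter Topology AssociatedBundle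

variable {EG : Type*} [NormedAddCommGroup EG] [NormedSpace ℝ EG]
  {G : Type*} [TopologicalSpace G] [ChartedSpace EG G] [Group G] [LieGroup 𝓘(ℝ, EG) ∞ G]
  {EB : Type*} [NormedAddCommGroup EB] [NormedSpace ℝ EB]
  {B : Type*} [TopologicalSpace B] [ChartedSpace EB B] [IsManifold 𝓘(ℝ, EB) ∞ B]
  {EP : Type*} [NormedAddCommGroup EP] [NormedSpace ℝ EP]
  {P : Type*} [TopologicalSpace P] [ChartedSpace EP P] [IsManifold 𝓘(ℝ, EP) ∞ P]
  [MulAction Gᵐᵒᵖ P]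
  {EF : Type*} [NormedAddCommGroup EF] [NormedSpace ℝ EF]
  {F : Type*} [TopologicalSpace F] [ChartedSpace EF F] [IsManifold 𝓘(ℝ, EF) ∞ F] [MulAction G F]
  {pr : P → B}

/-- The curve `c` is a horizontal lift of `γ` on the set `S`. -/
structure IsHorizontalLift (pr : P → B) (θ : PrincipalConnection EG G EP P) (γ : ℝ → B) (c : ℝ → P)
    (S : Set ℝ) : Prop where
  smooth : ∀ t ∈ S, ContMDiffAt 𝓘(ℝ, ℝ) 𝓘(ℝ, EP) ∞ c t
  proj : ∀ t ∈ S, pr (c t) = γ t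
  horizontal : ∀ t ∈ S, θ.form (c t) (tder 𝓘(ℝ, ℝ) 𝓘(ℝ, EP) c t 1) = 0

variable {θ : PrincipalConnection EG G EP P} {γ : ℝ → B} {c c₁ c₂ : ℝ → P} {S S₁ S₂ : Set ℝ}

lemma IsHorizontalLift.mono (h : IsHorizontalLift pr θ γ c S₁) (hS : S₂ ⊆ S₁) :
    IsHorizontalLift pr θ γ c S₂ :=
  ⟨fun t ht ↦ h.smooth t (hS ht), fun t ht ↦ h.proj t (hS ht), fun t ht ↦ h.horizontal t (hS ht)⟩

lemma IsHorizontalLift.union (h₁ : IsHorizontalLift pr θ γ c S₁) (h₂ : IsHorizontalLift pr θ γ c S₂) :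
    IsHorizontalLift pr θ γ c (S₁ ∪ S₂) :=
  ⟨fun t ht ↦ ht.elim (h₁.smooth t) (h₂.smooth t), fun t ht ↦ ht.elim (h₁.proj t) (h₂.proj t),
    fun t ht ↦ ht.elim (h₁.horizontal t) (h₂.horizontal t)⟩

lemma IsHorizontalLift.congr (h : IsHorizontalLift pr θ γ c₁ S) (hS : IsOpen S) (hc : EqOn c₂ c₁ S) :
    IsHorizontalLift pr θ γ c₂ S := by
  have hev : ∀ t ∈ S, c₂ =ᶠ[𝓝 t] c₁ := fun t ht ↦ hc.eventuallyEq_of_mem (hS.mem_nhds ht)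
  refine ⟨fun t ht ↦ (h.smooth t ht).congr_of_eventuallyEq (hev t ht),
    fun t ht ↦ by rw [hc ht, h.proj t ht], fun t ht ↦ ?_⟩
  rw [(hev t ht).tder_eq, hc ht, h.horizontal t ht]

variable (hpr : IsPrincipalBundle EG G EP EB pr)

include hpr

lemma IsHorizontalLift.smul (h : IsHorizontalLift pr θ γ c S) (g : G) :
    IsHorizontalLift pr θ γ (fun t ↦ op g • c t) S := by
  refine ⟨fun t ht ↦ ContMDiffAt.comp t ((hpr.contMDiff_op_smul g).contMDiffAt) (h.smooth t ht),
    fun t ht ↦ (hpr.proj_smul g (c t)).trans (h.proj t ht), fun t ht ↦ ?_⟩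
  rw [tder_comp (g := fun x ↦ op g • x) (f := c)
    ((hpr.contMDiff_op_smul g).contMDiffAt.mdifferentiableAt (by simp))
    ((h.smooth t ht).mdifferentiableAt (by simp))]
  exact θ.form_smul_eq_zero g (h.horizontal t ht)

/-- Horizontal lifts exist locally. -/
lemma exists_isHorizontalLift_Ioo [FiniteDimensional ℝ EG]
    (hγ : ContMDiff 𝓘(ℝ, ℝ) 𝓘(ℝ, EB) ∞ γ) (t₀ : ℝ) :
    ∃ ε > 0, ∃ c : ℝ → P, IsHorizontalLift pr θ γ c (Ioo (t₀ - ε) (t₀ + ε)) := by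
  have : CompleteSpace EG := FiniteDimensional.complete ℝ EG
  obtain ⟨U, s, hs, hU⟩ := hpr.exists_localSection_at (γ t₀)
  have hsγ : ∀ t ∈ γ ⁻¹' U, ContMDiffAt 𝓘(ℝ, ℝ) 𝓘(ℝ, EP) ∞ (fun t ↦ s (γ t)) t := fun t ht ↦
    ContMDiffAt.comp t (hs.contMDiffAt ht) hγ.contMDiffAt
  -- By `form_tder_smul`, the curve `s (γ t) · k t` is horizontal when `k' = -leftGen G k (a t)`.
  -- This equation is solved in the chart of `G` at `1`, where `genCoord` gives its coefficients.
  set a : ℝ → EG := fun t ↦ θ.form (s (γ t)) (tder 𝓘(ℝ, ℝ) 𝓘(ℝ, EP) (fun t ↦ s (γ t)) t 1)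
  have ha : ContDiffOn ℝ ∞ a (γ ⁻¹' U) := fun t ht ↦ by
    have h1 : SmoothAlongAt 𝓘(ℝ, ℝ) 𝓘(ℝ, ℝ) (fun t ↦ t) (fun _ : ℝ ↦ (1 : ℝ)) t :=
      smoothAlongAt_vectorSpace.2 ⟨contMDiffAt_id, contMDiffAt_const⟩
    exact ((h1.tder (hsγ t ht)).form θ).contDiffAt.contDiffWithinAt
  set φ := chartAt EG (1 : G)
  have hK : ContDiffOn ℝ ∞ (genCoord (EG := EG) G (1 : G)) φ.target := fun z hz ↦ by
    have := contDiffAt_genCoord (EG := EG) (G := G) contMDiff_smul_self (φ.map_target hz)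
    rw [φ.right_inv hz] at this
    exact this.contDiffWithinAt
  obtain ⟨z, -, ε, hε, h⟩ := exists_contDiffAt_solution (hs.isOpen.preimage hγ.continuous)
    φ.open_target hK ha (t₀ := t₀) (z₀ := φ 1) hU (mem_chart_target EG (1 : G))
  have hk : ∀ t ∈ Ioo (t₀ - ε) (t₀ + ε), ContMDiffAt 𝓘(ℝ, ℝ) 𝓘(ℝ, EG) ∞ (fun t ↦ φ.symm (z t)) t :=
    fun t ht ↦ ContMDiffAt.comp t (contMDiffOn_chart_symm.contMDiffAt
      (φ.open_target.mem_nhds (h t ht).2.1)) (h t ht).2.2.1.contMDiffAt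
  refine ⟨ε, hε, fun t ↦ op (φ.symm (z t)) • s (γ t), fun t ht ↦ ?_, fun t ht ↦ ?_, fun t ht ↦ ?_⟩
  · exact ContMDiffAt.comp t (hpr.smooth_action.contMDiffAt (x := (s (γ t), φ.symm (z t))))
      ((hsγ t (h t ht).1).prodMk (hk t ht))
  · exact (hpr.proj_smul _ _).trans (hs.proj _ (h t ht).1)
  · obtain ⟨htU, hzt, hzs, hzd⟩ := h t ht
    rw [θ.form_tder_smul hpr (k := fun t ↦ φ.symm (z t))
      ((hsγ t htU).mdifferentiableAt (by simp)) ((hk t ht).mdifferentiableAt (by simp))]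
    have h1 : tder 𝓘(ℝ, ℝ) 𝓘(ℝ, EG) (fun t ↦ φ.symm (z t)) t 1 =
        -leftGen G (φ.symm (z t)) (a t) := by
      rw [tder_comp (g := φ.symm) (f := z)
        ((mdifferentiable_chart (I := 𝓘(ℝ, EG)) (1 : G)).mdifferentiableAt_symm hzt)
        (hzs.contMDiffAt.mdifferentiableAt (by simp)), tder_eq_fderiv, fderiv_apply_one_eq_deriv,
        hzd.deriv, map_neg]
      exact congrArg Neg.neg (tder_symm_chartField (fun g : G ↦ leftGen G g (a t)) hzt)
    rw [h1]
    exact (congrArg _ (add_neg_cancel _)).trans (map_zero _)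

/-- Two horizontal lifts of a curve differ by a locally constant element of the group. -/
lemma IsHorizontalLift.eventually_eq_smul (hS : IsOpen S) (h₁ : IsHorizontalLift pr θ γ c₁ S)
    (h₂ : IsHorizontalLift pr θ γ c₂ S) {t₀ : ℝ} (ht₀ : t₀ ∈ S) :
    ∃ g : G, ∀ᶠ t in 𝓝 t₀, c₂ t = op g • c₁ t := by
  obtain ⟨U, s, hs, hU⟩ := hpr.exists_localSection_at (γ t₀)
  have hc₁ : ContinuousAt c₁ t₀ := (h₁.smooth t₀ ht₀).continuousAt
  have hev : ∀ᶠ t in 𝓝 t₀, t ∈ S ∧ pr (c₁ t) ∈ U ∧ pr (c₂ t) ∈ U := by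
    have : ∀ᶠ t in 𝓝 t₀, pr (c₁ t) ∈ U :=
      (hpr.smooth_proj.continuous.continuousAt.comp hc₁) (hs.isOpen.mem_nhds (by
        simpa only [Function.comp_apply, h₁.proj t₀ ht₀] using hU))
    filter_upwards [hS.mem_nhds ht₀, this] with t ht htU
    exact ⟨ht, htU, by rwa [h₂.proj t ht, ← h₁.proj t ht]⟩
  set g : ℝ → G := fun t ↦ (groupCoord G pr s (c₁ t))⁻¹ * groupCoord G pr s (c₂ t)
  have hg : ∀ᶠ t in 𝓝 t₀, c₂ t = op (g t) • c₁ t := by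
    filter_upwards [hev] with t ⟨ht, ht₁, ht₂⟩
    have e₁ := groupCoord_smul hpr hs ht₁
    have e₂ := groupCoord_smul hpr hs ht₂
    rw [h₁.proj t ht] at e₁
    rw [h₂.proj t ht] at e₂
    conv_lhs => rw [← e₂]
    conv_rhs => rw [← e₁]
    rw [smul_smul, ← op_mul, mul_inv_cancel_left]
  have hgd : ∀ᶠ t in 𝓝 t₀, MDifferentiableAt 𝓘(ℝ, ℝ) 𝓘(ℝ, EG) g t ∧
      tder 𝓘(ℝ, ℝ) 𝓘(ℝ, EG) g t 1 = 0 := by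
    filter_upwards [hev, hg.eventually_nhds] with t ⟨ht, ht₁, ht₂⟩ hgt
    have hgm : MDifferentiableAt 𝓘(ℝ, ℝ) 𝓘(ℝ, EG) g t := by
      refine ContMDiffAt.mdifferentiableAt (n := ∞) ?_ (by simp)
      exact (ContMDiffAt.comp (g := groupCoord G pr s) t (contMDiffAt_groupCoord hpr hs ht₁)
        (h₁.smooth t ht)).inv.mul (ContMDiffAt.comp (g := groupCoord G pr s) t
          (contMDiffAt_groupCoord hpr hs ht₂) (h₂.smooth t ht))
    refine ⟨hgm, ?_⟩
    -- As both curves are horizontal, what remains of the formula is the left translate of the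
    -- derivative of `g`, which must vanish.
    have h3 := θ.form_tder_smul hpr ((h₁.smooth t ht).mdifferentiableAt (by simp)) hgm
    have h4 := h₂.horizontal t ht
    rw [Filter.EventuallyEq.tder_eq (f := c₂) (g := fun t ↦ op (g t) • c₁ t) hgt,
      hgt.self_of_nhds, h3, h₁.horizontal t ht, map_zero, zero_add] at h4
    exact tder_mul_left_injective h4
  refine ⟨g t₀, ?_⟩
  filter_upwards [hg, eventually_eq_of_tder_eq_zero hgd] with t h3 h4
  rw [h3, h4]

/-- Uniqueness of horizontal lifts. -/
lemma IsHorizontalLift.eqOn (hS : IsOpen S) (hS' : IsPreconnected S)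
    (h₁ : IsHorizontalLift pr θ γ c₁ S) (h₂ : IsHorizontalLift pr θ γ c₂ S) {t₀ : ℝ} (ht₀ : t₀ ∈ S)
    (h : c₁ t₀ = c₂ t₀) : EqOn c₁ c₂ S := by
  intro t ht
  -- Near each time the lifts differ by one element `g`, and by freeness they agree exactly when `g
  -- = 1`. So agreement is a locally constant condition on the connected set `S`.
  refine (hS'.induction₂ (fun t t' ↦ (c₁ t = c₂ t ↔ c₁ t' = c₂ t')) (fun t ht ↦ ?_)
    (fun _ _ _ _ _ _ ↦ Iff.trans) (fun _ _ _ _ ↦ Iff.symm) ht₀ ht).1 h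
  obtain ⟨g, hg⟩ := h₁.eventually_eq_smul hpr hS h₂ ht
  have key : ∀ t, c₂ t = op g • c₁ t → (c₁ t = c₂ t ↔ g = 1) := fun t ht ↦ by
    rw [ht]
    constructor
    · intro h
      exact (hpr.smul_injective (g := 1) (by simpa using h)).symm
    · rintro rfl
      simp
  filter_upwards [nhdsWithin_le_nhds hg] with t' ht'
  rw [key t hg.self_of_nhds, key t' ht']

/-- The second lift is moved by the group to meet the first at a time `m` of the overlap. By
uniqueness they agree on the whole overlap, so switching at `m` is smooth. -/
lemma IsHorizontalLift.exists_glue {a₁ b₁ a₂ b₂ : ℝ} (h₁ : IsHorizontalLift pr θ γ c₁ (Ioo a₁ b₁))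
    (h₂ : IsHorizontalLift pr θ γ c₂ (Ioo a₂ b₂)) (ha : a₁ ≤ a₂) (hab : a₂ < b₁) (hb : b₁ ≤ b₂) :
    ∃ c : ℝ → P, IsHorizontalLift pr θ γ c (Ioo a₁ b₂) := by
  obtain ⟨m, hm₂, hm₁⟩ := exists_between hab
  have hm : m ∈ Ioo a₂ b₁ := ⟨hm₂, hm₁⟩
  have hI₁ : Ioo a₂ b₁ ⊆ Ioo a₁ b₁ := Ioo_subset_Ioo_left ha
  have hI₂ : Ioo a₂ b₁ ⊆ Ioo a₂ b₂ := Ioo_subset_Ioo_right hb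
  obtain ⟨g, hg⟩ := hpr.exists_smul_eq ((h₂.proj m (hI₂ hm)).trans (h₁.proj m (hI₁ hm)).symm)
  have h₃ := h₂.smul hpr g
  have heq : EqOn c₁ (fun t ↦ op g • c₂ t) (Ioo a₂ b₁) :=
    (h₁.mono hI₁).eqOn hpr isOpen_Ioo isPreconnected_Ioo (h₃.mono hI₂) hm hg.symm
  have e₁ : EqOn (fun t ↦ if t < m then c₁ t else op g • c₂ t) c₁ (Ioo a₁ b₁) := fun t ht ↦ by
    by_cases htm : t < m
    · simp [htm]
    · simpa [htm] using (heq ⟨by linarith, ht.2⟩).symm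
  have e₂ : EqOn (fun t ↦ if t < m then c₁ t else op g • c₂ t) (fun t ↦ op g • c₂ t)
      (Ioo a₂ b₂) := fun t ht ↦ by
    by_cases htm : t < m
    · simpa [htm] using heq ⟨ht.1, by linarith⟩
    · simp [htm]
  refine ⟨_, ((h₁.congr isOpen_Ioo e₁).union (h₃.congr isOpen_Ioo e₂)).mono fun t ht ↦ ?_⟩
  by_cases htm : t < m
  · exact Or.inl ⟨ht.1, by linarith⟩
  · exact Or.inr ⟨by linarith, ht.2⟩

/-- If the end points that can be reached from `a` were bounded, a local lift around their supremum
`σ` could be glued on and would reach beyond it. -/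
lemma exists_isHorizontalLift [FiniteDimensional ℝ EG] (hγ : ContMDiff 𝓘(ℝ, ℝ) 𝓘(ℝ, EB) ∞ γ)
    (a b : ℝ) : ∃ c : ℝ → P, IsHorizontalLift pr θ γ c (Ioo a b) := by
  set T : Set ℝ := {b | ∃ c : ℝ → P, IsHorizontalLift pr θ γ c (Ioo a b)}
  have hmono : ∀ b ∈ T, ∀ b' ≤ b, b' ∈ T := fun b ⟨c, hc⟩ b' hb' ↦
    ⟨c, hc.mono (Ioo_subset_Ioo_right hb')⟩
  by_contra hb
  have hbd : BddAbove T := ⟨b, fun b' hb' ↦ le_of_not_ge fun h ↦ hb (hmono b' hb' b h)⟩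
  obtain ⟨ε₀, hε₀, c₀, hc₀⟩ := exists_isHorizontalLift_Ioo (θ := θ) hpr hγ a
  have ha : a + ε₀ ∈ T := ⟨c₀, hc₀.mono (Ioo_subset_Ioo_left (by linarith))⟩
  set σ := sSup T
  have haσ : a < σ := by linarith [le_csSup hbd ha]
  obtain ⟨ε, hε, c₂, hc₂⟩ := exists_isHorizontalLift_Ioo (θ := θ) hpr hγ σ
  -- The maximum with `a` keeps the start of the second interval at or after that of the first, as
  -- the gluing lemma demands, even if `σ - ε` lies before `a`.
  obtain ⟨b₁, ⟨c₁, hc₁⟩, hb₁⟩ := exists_lt_of_lt_csSup ⟨_, ha⟩ (max_lt haσ (sub_lt_self σ hε))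
  have hσ : σ + ε ∈ T := hc₁.exists_glue hpr (hc₂.mono (Ioo_subset_Ioo_left (le_max_right a _)))
    (le_max_left _ _) hb₁ (by linarith [le_csSup hbd ⟨c₁, hc₁⟩])
  linarith [le_csSup hbd hσ]

/-- Parallel transport: every smooth curve in the base has a horizontal lift. -/
theorem exists_isHorizontalLift_univ [FiniteDimensional ℝ EG] (θ : PrincipalConnection EG G EP P)
    (hγ : ContMDiff 𝓘(ℝ, ℝ) 𝓘(ℝ, EB) ∞ γ) {x : P} (hx : pr x = γ 0) :
    ∃ c : ℝ → P, c 0 = x ∧ IsHorizontalLift pr θ γ c univ := by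
  -- Lifts on growing intervals are normalized at time `0`, agree by uniqueness, and are combined by
  -- using the one of index `⌈|t|⌉₊` at time `t`. The bound `n + 1` puts `0` in the interval already
  -- for `n = 0` and makes `|t| < n + 1` strict.
  have h : ∀ n : ℕ, ∃ c : ℝ → P, c 0 = x ∧
      IsHorizontalLift pr θ γ c (Ioo (-(n + 1 : ℝ)) (n + 1)) := fun n ↦ by
    obtain ⟨c, hc⟩ := exists_isHorizontalLift (θ := θ) hpr hγ (-(n + 1 : ℝ)) (n + 1)
    have h0 : (0 : ℝ) ∈ Ioo (-(n + 1 : ℝ)) (n + 1) := by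
      constructor <;> linarith [n.cast_nonneg (α := ℝ)]
    obtain ⟨g, hg⟩ := hpr.exists_smul_eq ((hc.proj 0 h0).trans hx.symm)
    exact ⟨_, hg, hc.smul hpr g⟩
  choose c hc0 hc using h
  have heq : ∀ n m : ℕ, n ≤ m → EqOn (c m) (c n) (Ioo (-(n + 1 : ℝ)) (n + 1)) := fun n m hnm ↦ by
    have : (n : ℝ) ≤ m := mod_cast hnm
    refine ((hc m).mono (Ioo_subset_Ioo (by linarith) (by linarith))).eqOn hpr isOpen_Ioo
      isPreconnected_Ioo (hc n) (t₀ := 0) ?_ ((hc0 m).trans (hc0 n).symm)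
    constructor <;> linarith [n.cast_nonneg (α := ℝ)]
  have hmem : ∀ (t : ℝ) (n : ℕ), ⌈|t|⌉₊ ≤ n → t ∈ Ioo (-(n + 1 : ℝ)) (n + 1) := fun t n hn ↦ by
    have := Nat.ceil_le.1 hn
    exact abs_lt.1 (by linarith)
  have key : ∀ n : ℕ, EqOn (fun t ↦ c ⌈|t|⌉₊ t) (c n) (Ioo (-(n + 1 : ℝ)) (n + 1)) := fun n t ht ↦ by
    rcases le_total n ⌈|t|⌉₊ with h | h
    · exact heq n _ h ht
    · exact (heq _ n h (hmem t _ le_rfl)).symm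
  have hlift : ∀ n : ℕ, IsHorizontalLift pr θ γ (fun t ↦ c ⌈|t|⌉₊ t) (Ioo (-(n + 1 : ℝ)) (n + 1)) :=
    fun n ↦ (hc n).congr isOpen_Ioo (key n)
  refine ⟨fun t ↦ c ⌈|t|⌉₊ t, hc0 _, fun t _ ↦ ?_, fun t _ ↦ ?_, fun t _ ↦ ?_⟩
  · exact (hlift _).smooth t (hmem t _ le_rfl)
  · exact (hlift _).proj t (hmem t _ le_rfl)
  · exact (hlift _).horizontal t (hmem t _ le_rfl)

variable {EM : Type*} [NormedAddCommGroup EM] [NormedSpace ℝ EM]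
  [ChartedSpace EM (AssociatedBundle G P F)] [IsManifold 𝓘(ℝ, EM) ∞ (AssociatedBundle G P F)]

omit hpr in
-- The lift through `[x, f]` is `t ↦ [c t, f]`, where `c` is the horizontal lift to `P` through `x`;
-- the point `f` is kept fixed.
theorem bundleConnection_isComplete [FiniteDimensional ℝ EG]
    {hpr : IsPrincipalBundle EG G EP EB pr} (θ : PrincipalConnection EG G EP P)
    (hM : IsBundleManifold EG EB EP EF F EM hpr)
    (hact : ContMDiff (𝓘(ℝ, EG).prod 𝓘(ℝ, EF)) 𝓘(ℝ, EF) ∞ (fun y : G × F ↦ y.1 • y.2)) :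
    (bundleConnection θ hM hact).IsComplete := by
  intro γ hγ y hy
  obtain ⟨x, f, rfl⟩ := exists_rep y
  obtain ⟨c, hc0, hc⟩ := exists_isHorizontalLift_univ hpr θ hγ (x := x) hy
  refine ⟨fun t ↦ AssociatedBundle.mk G (c t) f, fun t ↦ ?_, ?_, fun t ↦ ?_, fun t ↦ ?_⟩
  · exact ContMDiffAt.comp (g := fun x ↦ AssociatedBundle.mk G x f) t
      (hM.contMDiff_mk_left hact f).contMDiffAt (hc.smooth t (mem_univ t))
  · exact congrArg (fun x ↦ AssociatedBundle.mk G x f) hc0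
  · exact hc.proj t (mem_univ t)
  · have h1 := bundleConnection_isInduced θ hM hact (c t) f _ (hc.horizontal t (mem_univ t))
    refine mem_of_eq_of_mem ?_ h1
    exact tder_comp (g := fun x ↦ AssociatedBundle.mk G x f) (f := c)
      ((hM.contMDiff_mk_left hact f).contMDiffAt.mdifferentiableAt (by simp))
      ((hc.smooth t (mem_univ t)).mdifferentiableAt (by simp)) 1

end HorizontalLifts

/-! ### The weakly hamiltonian fibration and the main theorem -/

section Fibration

open AssociatedBundle

variable {EG : Type*} [NormedAddCommGroup EG] [NormedSpace ℝ EG]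
  {G : Type*} [TopologicalSpace G] [ChartedSpace EG G] [Group G] [LieGroup 𝓘(ℝ, EG) ∞ G]
  {EB : Type*} [NormedAddCommGroup EB] [NormedSpace ℝ EB]
  {B : Type*} [TopologicalSpace B] [ChartedSpace EB B] [IsManifold 𝓘(ℝ, EB) ∞ B]
  {EP : Type*} [NormedAddCommGroup EP] [NormedSpace ℝ EP]
  {P : Type*} [TopologicalSpace P] [ChartedSpace EP P] [IsManifold 𝓘(ℝ, EP) ∞ P]
  [MulAction Gᵐᵒᵖ P]
  {EF : Type*} [NormedAddCommGroup EF] [NormedSpace ℝ EF]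
  {F : Type*} [TopologicalSpace F] [ChartedSpace EF F] [IsManifold 𝓘(ℝ, EF) ∞ F] [MulAction G F]
  {pr : P → B}
variable {EM : Type*} [NormedAddCommGroup EM] [NormedSpace ℝ EM]
  [ChartedSpace EM (AssociatedBundle G P F)] [IsManifold 𝓘(ℝ, EM) ∞ (AssociatedBundle G P F)]
  {hpr : IsPrincipalBundle EG G EP EB pr}

/-- The weakly hamiltonian fibration structure of the associated bundle. -/
def bundleFibration [FiniteDimensional ℝ EG] [FiniteDimensional ℝ EB] [FiniteDimensional ℝ EM]
    [T2Space B] [SecondCountableTopology B] (hM : IsBundleManifold EG EB EP EF F EM hpr)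
    (θ : PrincipalConnection EG G EP P) {ωF : TwoForm EF F} (hω : IsSymplecticAction EG G ωF)
    {J : F → (GroupLieAlgebra 𝓘(ℝ, EG) G →L[ℝ] ℝ)} (hJ : IsMomentMap ωF J) :
    WeaklyHamiltonianFibration EM EB
      (proj pr hpr.proj_smul : AssociatedBundle G P F → B) where
  smooth_proj := hM.smooth_proj
  submersion y u := ⟨_, (bundleConnection θ hM hω.smooth_action).proj_lift y u⟩
  conn := bundleConnection θ hM hω.smooth_action
  complete := bundleConnection_isComplete θ hM hω.smooth_action
  ωV := bundleTwoForm θ hM hω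
  ωV_horizontal := bundleTwoForm_horizontal hM θ hω
  nondegenerate := bundleTwoForm_nondegenerate hM θ hω
  vertically_closed _ _ _ hX hY hZ := bundleTwoForm_verticallyClosed hM θ hω hX hY hZ
  symplectic_conn _ hu _ _ hX hY := bundleTwoForm_lieDeriv hM θ hω hu hX hY
  hamiltonian_curvature := exists_gluedForm hM θ hω hJ

end Fibration

theorem mainTheorem11
    {EG : Type*} [NormedAddCommGroup EG] [NormedSpace ℝ EG] [FiniteDimensional ℝ EG]
    {G : Type*} [TopologicalSpace G] [ChartedSpace EG G] [Group G]
    [LieGroup 𝓘(ℝ, EG) ∞ G] [T2Space G]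
    {EB : Type*} [NormedAddCommGroup EB] [NormedSpace ℝ EB] [FiniteDimensional ℝ EB]
    {B : Type*} [TopologicalSpace B] [ChartedSpace EB B] [IsManifold 𝓘(ℝ, EB) ∞ B]
    [T2Space B] [SecondCountableTopology B]
    {EP : Type*} [NormedAddCommGroup EP] [NormedSpace ℝ EP] [FiniteDimensional ℝ EP]
    {P : Type*} [TopologicalSpace P] [ChartedSpace EP P] [IsManifold 𝓘(ℝ, EP) ∞ P]
    [T2Space P] [MulAction Gᵐᵒᵖ P]
    {EF : Type*} [NormedAddCommGroup EF] [NormedSpace ℝ EF] [FiniteDimensional ℝ EF]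
    {F : Type*} [TopologicalSpace F] [ChartedSpace EF F] [IsManifold 𝓘(ℝ, EF) ∞ F]
    [T2Space F] [SecondCountableTopology F] [MulAction G F]
    (pr : P → B) (hpr : IsPrincipalBundle EG G EP EB pr)
    (θ : PrincipalConnection EG G EP P)
    (ωF : TwoForm EF F) (hω : IsSymplecticAction EG G ωF)
    (J : F → (GroupLieAlgebra 𝓘(ℝ, EG) G →L[ℝ] ℝ)) (hJ : IsMomentMap ωF J) :
    ∃ (_ : ChartedSpace (EB × EF) (AssociatedBundle G P F))
      (_ : IsManifold 𝓘(ℝ, EB × EF) ∞ (AssociatedBundle G P F)),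
      T2Space (AssociatedBundle G P F) ∧
      SecondCountableTopology (AssociatedBundle G P F) ∧
      IsQuotientManifold G EP P EF F (EB × EF) ∧
      ∃ W : WeaklyHamiltonianFibration (EB × EF) EB
          (AssociatedBundle.proj (F := F) pr hpr.proj_smul),
        IsInducedConnection W.conn θ ∧
        IsInducedForm W.ωV ωF ∧
        ∀ (ι : Type*) (ρ : SmoothPartitionOfUnity ι 𝓘(ℝ, EB) B) (U : ι → Set B)
          (s : ι → B → P),
          (∀ i, IsOpen (U i)) → ρ.IsSubordinate U →
          (∀ i, ContMDiffOn 𝓘(ℝ, EB) 𝓘(ℝ, EP) ∞ (s i) (U i)) →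
          (∀ i, ∀ b ∈ U i, pr (s i b) = b) →
          ∃ ωH : BaseTwoForm (EB × EF) EB (AssociatedBundle.proj (F := F) pr hpr.proj_smul),
            IsGluedForm ωH θ J ρ U s ∧ PrescribesCurvature W.conn W.ωV ωH := by
  have hact := hω.smooth_action
  let _ : ChartedSpace (EB × EF) (AssociatedBundle G P F) := bundleChartedSpace EB EP F hpr hact
  have _ : IsManifold 𝓘(ℝ, EB × EF) ∞ (AssociatedBundle G P F) := isManifold_bundle hpr hact
  have hM : IsBundleManifold EG EB EP EF F (EB × EF) hpr := isBundleManifold hpr hact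
  refine ⟨inferInstance, inferInstance, AssociatedBundle.t2Space hpr hact,
    AssociatedBundle.secondCountableTopology hact (hpr := hpr), hM.isQuotientManifold hact,
    bundleFibration hM θ hω hJ, bundleConnection_isInduced θ hM hact,
    bundleTwoForm_isInduced hM θ hω, ?_⟩
  intro ι ρ U s hU hρ hs hpb
  have hs' : ∀ i, IsLocalSection EB EP pr (U i) (s i) := fun i ↦ ⟨hU i, hs i, hpb i⟩
  exact ⟨gluedForm hM θ hρ hs' hJ, gluedForm_isGluedForm hM θ hρ hs' hJ,
    gluedForm_prescribesCurvature hM θ hρ hs' hJ hω⟩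

end
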